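/- Let $p,q,s\ge 1$, $L_x,L_y,T>0$, $\Omega=(0,L_x)\times(0,L_y)$, let $a_l,c_m,d_r,b_1,b_2,b_3>0$, $1<\gamma_l<2$, $0<\alpha_m,\beta_r<1$ for $1\le l\le p$, $1\le m\le q$, $1\le r\le s$. Let $u$ solve $$\sum_{l=1}^p a_lD_t^{\gamma_l}u+b_1u_t+\sum_{m=1}^q c_mD_t^{\alpha_m}u+b_2u=b_3(u_{xx}+u_{yy})+\sum_{r=1}^s d_rD_t^{\beta_r}(u_{xx}+u_{yy})+f\quad\text{in }\Omega\times(0,T],$$ with $u(x,y,0)=\varphi(x,y)$ on $\overline\Omega$, $u_t(x,y,0)=\phi(x,y)$ in $\Omega$ and $u=0$ on $\partial\Omega\times(0,T]$, where $D_t^{\gamma}v(t)=\frac1{\Gamma(2-\gamma)}\int_0^t(t-s)^{1-\gamma}v''(s)\,ds$ for $1<\gamma<2$ and $D_t^{\alpha}v(t)=\frac1{\Gamma(1-\alpha)}\int_0^t(t-s)^{-\alpha}v'(s)\,ds$ for $0<\alpha<1$ (Caputo derivatives). Assume $u\in C^{4,4,3}_{x,y,t}$ up to the boundary: all $\partial_x^i\partial_y^j\partial_t^ku$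 with $i,j\le4$, $k\le3$ exist and are continuous on $\overline\Omega\times[0,T]$. For integers $M_x,M_y,N\ge1$ put $h_x=L_x/M_x$, $h_y=L_y/M_y$, $\tau=T/N$, $x_i=ih_x$, $y_j=jh_y$, $t_n=n\tau$, $t_{n-1/2}=(n-\frac12)\tau$, $\nabla_tv^n=(v^n-v^{n-1})/\tau$, $v^{n-1/2}=(v^n+v^{n-1})/2$, $\nabla_xv_{ij}=(v_{ij}-v_{i-1,j})/h_x$, $\nabla_yv_{ij}=(v_{ij}-v_{i,j-1})/h_y$, and let $\delta_x^2,\delta_y^2$ be the central second difference quotients. For $1<\gamma<2$ let $a^{(\gamma)}_k=(k+1)^{2-\gamma}-k^{2-\gamma}$. For $0<\alpha<1$ let $a^{(\alpha)}_0=(\frac12)^{1-\alpha}$ and, for $k\ge1$, $a^{(\alpha)}_k=(k+\frac12)^{1-\alpha}-(k-\frac12)^{1-\alpha}$, $b^{(\alpha)}_k=\frac1{2-\alpha}[(k+\frac12)^{2-\alpha}-(k-\frac12)^{2-\alpha}]-\frac12[(k+\frac12)^{1-\alpha}+(k-\frac12)^{1-\alpha}]$; at time level $n=1$ let $c^{(\alpha)}_0=a^{(\alpha)}_0$,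 and at time level $n\ge2$ let $c^{(\alpha)}_0=a^{(\alpha)}_0+b^{(\alpha)}_1$, $c^{(\alpha)}_k=a^{(\alpha)}_k+b^{(\alpha)}_{k+1}-b^{(\alpha)}_k$ for $1\le k\le n-2$, $c^{(\alpha)}_{n-1}=a^{(\alpha)}_{n-1}-b^{(\alpha)}_{n-1}$. The implicit finite difference scheme for $U_{ij}^n$ is: for $1\le n\le N$, $1\le i\le M_x-1$, $1\le j\le M_y-1$, $$\sum_{l}\frac{a_l\tau^{1-\gamma_l}}{\Gamma(3-\gamma_l)}\Big[a_0^{(\gamma_l)}\nabla_tU_{ij}^n-\sum_{k=1}^{n-1}(a_{n-k-1}^{(\gamma_l)}-a_{n-k}^{(\gamma_l)})\nabla_tU_{ij}^k-a_{n-1}^{(\gamma_l)}\phi(x_i,y_j)\Big]+b_1\nabla_tU_{ij}^n+\sum_m\frac{c_m\tau^{1-\alpha_m}}{\Gamma(2-\alpha_m)}\sum_{k=1}^nc_{n-k}^{(\alpha_m)}\nabla_tU_{ij}^k+b_2U_{ij}^{n-\frac12}$$ $$=b_3(\delta_x^2+\delta_y^2)U_{ij}^{n-\frac12}+\sum_r\frac{d_r\tau^{1-\beta_r}}{\Gamma(2-\beta_r)}\sum_{k=1}^nc_{n-k}^{(\beta_r)}\nabla_t(\delta_x^2+\delta_y^2)U_{ij}^k+f_{ij}^{n-\frac12},$$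 with $U_{ij}^0=\varphi(x_i,y_j)$ at all grid points and $U_{ij}^n=0$ at boundary grid points for $1\le n\le N$. Let $\sigma=\min_{l,m,r}\{3-\gamma_l,\,2-\alpha_m,\,2-\beta_r\}$ and, for grid functions $v$, $$\|v\|_{H^1}=\Big(b_2h_xh_y\sum_{i=1}^{M_x-1}\sum_{j=1}^{M_y-1}v_{ij}^2+b_3|v|_1^2\Big)^{1/2},$$ where $|v|_1^2$ is either $h_xh_y\sum_{i=1}^{M_x}\sum_{j=1}^{M_y}\big((\nabla_xv_{ij})^2+(\nabla_yv_{ij})^2\big)$ or $h_xh_y\sum_{i=1}^{M_x}\sum_{j=1}^{M_y}(\nabla_xv_{ij}+\nabla_yv_{ij})^2$. Then, for the scheme with $f_{ij}^{n-1/2}=f(x_i,y_j,t_{n-1/2})$, there is a constant $C>0$, independent of $M_x,M_y,N$ (that is, of $h_x,h_y,\tau$), such that for all $M_x,M_y,N\ge1$, every solution $U$ of the scheme and all $0\le n\le N$, with either choice of $|\cdot|_1$, $$\|u^n-U^n\|_{H^1}\le C\sqrt{\frac{TL_xL_y}{\sum_{l=1}^p\frac{a_lT^{1-\gamma_l}}{\Gamma(2-\gamma_l)}+2b_1}}\;\big(\tau^{\sigma}+h_x^2+h_y^2\big),$$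 where $u^n_{ij}=u(x_i,y_j,t_n)$. The same holds for the scheme with the averaged source $f_{ij}^{n-1/2}=\frac12\big(f(x_i,y_j,t_n)+f(x_i,y_j,t_{n-1})\big)$, provided that the averaging is consistent to the order of the scheme: for some $K$, $\big|\frac12(f(x,y,t+\tau)+f(x,y,t))-f(x,y,t+\frac\tau2)\big|\le K\tau^{\sigma}$ for all $(x,y)\in\Omega$, $t\ge0$, $\tau>0$ with $t+\tau\le T$. -/

import Mathlib

open Set

noncomputable section

namespace OldroydB

/-- Caputo derivative of order `α ∈ (0,1)` on `[0,T]`: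
`1/Γ(1-α) ∫₀ᵗ (t-s)^(-α) v'(s) ds`. -/
def caputo₁ (T α : ℝ) (v : ℝ → ℝ) (t : ℝ) : ℝ :=
  1 / Real.Gamma (1 - α) *
    ∫ s in (0 : ℝ)..t, (t - s) ^ (-α) * derivWithin v (Icc 0 T) s

/-- Caputo derivative of order `γ ∈ (1,2)` on `[0,T]`:
`1/Γ(2-γ) ∫₀ᵗ (t-s)^(1-γ) v''(s) ds`. -/
def caputo₂ (T γ : ℝ) (v : ℝ → ℝ) (t : ℝ) : ℝ :=
  1 / Real.Gamma (2 - γ) *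
    ∫ s in (0 : ℝ)..t, (t - s) ^ (1 - γ) * iteratedDerivWithin 2 v (Icc 0 T) s

/-- The data of the two-dimensional multi-term time-fractional Oldroyd-B problem: coefficients,
fractional orders, lengths of the domain, final time, initial value `φ`, initial velocity `ϕ`,
source `f`. -/
structure Data (p q s : ℕ) where
  a : Fin p → ℝ
  γ : Fin p → ℝ
  c : Fin q → ℝ
  α : Fin q → ℝ
  d : Fin s → ℝ
  β : Fin s → ℝ
  b₁ : ℝ
  b₂ : ℝ
  b₃ : ℝ
  Lx : ℝ
  Ly : ℝ
  T : ℝ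
  φ : ℝ → ℝ → ℝ
  ϕ : ℝ → ℝ → ℝ
  f : ℝ → ℝ → ℝ → ℝ

variable {p q s : ℕ}

/-- The standing sign and range conditions on the parameters. -/
structure Data.Admissible (P : Data p q s) : Prop where
  p_pos : 0 < p
  q_pos : 0 < q
  s_pos : 0 < s
  a_pos : ∀ l, 0 < P.a l
  γ_mem : ∀ l, P.γ l ∈ Ioo (1 : ℝ) 2
  c_pos : ∀ m, 0 < P.c m
  α_mem : ∀ m, P.α m ∈ Ioo (0 : ℝ) 1
  d_pos : ∀ r, 0 < P.d r
  β_mem : ∀ r, P.β r ∈ Ioo (0 : ℝ) 1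
  b₁_pos : 0 < P.b₁
  b₂_pos : 0 < P.b₂
  b₃_pos : 0 < P.b₃
  Lx_pos : 0 < P.Lx
  Ly_pos : 0 < P.Ly
  T_pos : 0 < P.T

/-- The spatial Laplacian `∂²u/∂x² + ∂²u/∂y²` on `[0,Lx] × [0,Ly]`. -/
def laplacian (Lx Ly : ℝ) (u : ℝ → ℝ → ℝ → ℝ) (x y t : ℝ) : ℝ :=
  iteratedDerivWithin 2 (fun ξ => u ξ y t) (Icc 0 Lx) x +
    iteratedDerivWithin 2 (fun η => u x η t) (Icc 0 Ly) y

/-- `u` is of class `C^{4,4,3}_{x,y,t}` on `[0,Lx] × [0,Ly] × [0,T]`: the partial derivatives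
`D i j k = ∂ₓⁱ ∂ᵧʲ ∂ₜᵏ u`, `i, j ≤ 4`, `k ≤ 3`, exist and are continuous up to the boundary
(one-sided derivatives at the end points). -/
def IsC443 (Lx Ly T : ℝ) (u : ℝ → ℝ → ℝ → ℝ) : Prop :=
  ∃ D : ℕ → ℕ → ℕ → ℝ → ℝ → ℝ → ℝ,
    (∀ x ∈ Icc 0 Lx, ∀ y ∈ Icc 0 Ly, ∀ t ∈ Icc 0 T, D 0 0 0 x y t = u x y t) ∧
    (∀ i ≤ 4, ∀ j ≤ 4, ∀ k ≤ 3,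
      ContinuousOn (fun z : ℝ × ℝ × ℝ => D i j k z.1 z.2.1 z.2.2)
        (Icc 0 Lx ×ˢ Icc 0 Ly ×ˢ Icc 0 T)) ∧
    (∀ i < 4, ∀ j ≤ 4, ∀ k ≤ 3, ∀ x ∈ Icc 0 Lx, ∀ y ∈ Icc 0 Ly, ∀ t ∈ Icc 0 T,
      HasDerivWithinAt (fun ξ => D i j k ξ y t) (D (i + 1) j k x y t) (Icc 0 Lx) x) ∧
    (∀ i ≤ 4, ∀ j < 4, ∀ k ≤ 3, ∀ x ∈ Icc 0 Lx, ∀ y ∈ Icc 0 Ly, ∀ t ∈ Icc 0 T,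
      HasDerivWithinAt (fun η => D i j k x η t) (D i (j + 1) k x y t) (Icc 0 Ly) y) ∧
    (∀ i ≤ 4, ∀ j ≤ 4, ∀ k < 3, ∀ x ∈ Icc 0 Lx, ∀ y ∈ Icc 0 Ly, ∀ t ∈ Icc 0 T,
      HasDerivWithinAt (fun r => D i j k x y r) (D i j (k + 1) x y t) (Icc 0 T) t)

/-- `u` solves the initial-boundary value problem with data `P`. -/
structure IsExactSolution (P : Data p q s) (u : ℝ → ℝ → ℝ → ℝ) : Prop where
  equation : ∀ x ∈ Ioo 0 P.Lx, ∀ y ∈ Ioo 0 P.Ly, ∀ t ∈ Ioc 0 P.T,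
    (∑ l, P.a l * caputo₂ P.T (P.γ l) (fun r => u x y r) t) +
        P.b₁ * derivWithin (fun r => u x y r) (Icc 0 P.T) t +
        (∑ m, P.c m * caputo₁ P.T (P.α m) (fun r => u x y r) t) + P.b₂ * u x y t =
      P.b₃ * laplacian P.Lx P.Ly u x y t +
        (∑ k, P.d k * caputo₁ P.T (P.β k) (fun r => laplacian P.Lx P.Ly u x y r) t) +
        P.f x y t
  initial : ∀ x ∈ Icc 0 P.Lx, ∀ y ∈ Icc 0 P.Ly, u x y 0 = P.φ x y
  initial_velocity : ∀ x ∈ Ioo 0 P.Lx, ∀ y ∈ Ioo 0 P.Ly,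
    derivWithin (fun r => u x y r) (Icc 0 P.T) 0 = P.ϕ x y
  boundary_x : ∀ y ∈ Icc 0 P.Ly, ∀ t ∈ Ioc 0 P.T, u 0 y t = 0 ∧ u P.Lx y t = 0
  boundary_y : ∀ x ∈ Icc 0 P.Lx, ∀ t ∈ Ioc 0 P.T, u x 0 t = 0 ∧ u x P.Ly t = 0

/-! ### Coefficients of the time discretizations -/

/-- `a_k^{(γ)} = (k+1)^{2-γ} - k^{2-γ}`, for orders `1 < γ < 2`. -/
def aHigh (γ : ℝ) (k : ℕ) : ℝ := ((k : ℝ) + 1) ^ (2 - γ) - (k : ℝ) ^ (2 - γ)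

/-- `a_0^{(α)} = (1/2)^{1-α}` and `a_k^{(α)} = (k+1/2)^{1-α} - (k-1/2)^{1-α}`, `k ≥ 1`,
for orders `0 < α < 1`. -/
def aLow (α : ℝ) (k : ℕ) : ℝ :=
  if k = 0 then (1 / 2 : ℝ) ^ (1 - α)
  else ((k : ℝ) + 1 / 2) ^ (1 - α) - ((k : ℝ) - 1 / 2) ^ (1 - α)

/-- `b_k^{(α)}`, `k ≥ 1`. -/
def bLow (α : ℝ) (k : ℕ) : ℝ :=
  1 / (2 - α) * (((k : ℝ) + 1 / 2) ^ (2 - α) - ((k : ℝ) - 1 / 2) ^ (2 - α)) -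
    1 / 2 * (((k : ℝ) + 1 / 2) ^ (1 - α) + ((k : ℝ) - 1 / 2) ^ (1 - α))

/-- The coefficient `c_k^{(α)}`, `0 ≤ k ≤ n - 1`, at time level `n ≥ 1`. -/
def cLow (α : ℝ) (n k : ℕ) : ℝ :=
  if n ≤ 1 then aLow α 0
  else if k = 0 then aLow α 0 + bLow α 1
  else if k + 1 = n then aLow α k - bLow α k
  else aLow α k + bLow α (k + 1) - bLow α k

/-! ### Grid functions -/

/-- Backward time difference quotient `(v^n - v^{n-1}) / τ`, for `n ≥ 1`. -/
def dt (τ : ℝ) (v : ℕ → ℕ → ℕ → ℝ) (n i j : ℕ) : ℝ := (v n i j - v (n - 1) i j) / τ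

/-- `(δ_x² + δ_y²) v_{ij}`, for interior indices. -/
def discLaplacian (hx hy : ℝ) (v : ℕ → ℕ → ℝ) (i j : ℕ) : ℝ :=
  (v (i - 1) j - 2 * v i j + v (i + 1) j) / hx ^ 2 +
    (v i (j - 1) - 2 * v i j + v i (j + 1)) / hy ^ 2

/-- Backward difference quotient in the first index. -/
def dx (hx : ℝ) (v : ℕ → ℕ → ℝ) (i j : ℕ) : ℝ := (v i j - v (i - 1) j) / hx

/-- Backward difference quotient in the second index. -/
def dy (hy : ℝ) (v : ℕ → ℕ → ℝ) (i j : ℕ) : ℝ := (v i j - v i (j - 1)) / hy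

/-- `‖v‖₀²`. -/
def normZeroSq (hx hy : ℝ) (Mx My : ℕ) (v : ℕ → ℕ → ℝ) : ℝ :=
  hx * hy * ∑ i ∈ Finset.Icc 1 (Mx - 1), ∑ j ∈ Finset.Icc 1 (My - 1), v i j ^ 2

/-- `|v|₁²`, where the symbol `∇_x + ∇_y` is the discrete gradient. -/
def seminormGradSq (hx hy : ℝ) (Mx My : ℕ) (v : ℕ → ℕ → ℝ) : ℝ :=
  hx * hy * ∑ i ∈ Finset.Icc 1 Mx, ∑ j ∈ Finset.Icc 1 My,
    (dx hx v i j ^ 2 + dy hy v i j ^ 2)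

/-- `|v|₁²`, where the symbol `∇_x + ∇_y` is the scalar sum of the two difference quotients. -/
def seminormSumSq (hx hy : ℝ) (Mx My : ℕ) (v : ℕ → ℕ → ℝ) : ℝ :=
  hx * hy * ∑ i ∈ Finset.Icc 1 Mx, ∑ j ∈ Finset.Icc 1 My,
    (dx hx v i j + dy hy v i j) ^ 2

/-- Discrete `H¹` norm `√(b₂‖v‖₀² + b₃|v|₁²)` with the discrete gradient. -/
def normH1Grad (P : Data p q s) (Mx My : ℕ) (v : ℕ → ℕ → ℝ) : ℝ :=
  Real.sqrt (P.b₂ * normZeroSq (P.Lx / Mx) (P.Ly / My) Mx My v +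
    P.b₃ * seminormGradSq (P.Lx / Mx) (P.Ly / My) Mx My v)

/-- Discrete `H¹` norm `√(b₂‖v‖₀² + b₃|v|₁²)` with the scalar sum of the difference quotients. -/
def normH1Sum (P : Data p q s) (Mx My : ℕ) (v : ℕ → ℕ → ℝ) : ℝ :=
  Real.sqrt (P.b₂ * normZeroSq (P.Lx / Mx) (P.Ly / My) Mx My v +
    P.b₃ * seminormSumSq (P.Lx / Mx) (P.Ly / My) Mx My v)

/-! ### The implicit finite difference scheme -/

/-- Source of the scheme at level `n`: the value `f(x_i, y_j, t_{n-1/2})`. -/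
def midSource (P : Data p q s) (Mx My N : ℕ) (n i j : ℕ) : ℝ :=
  P.f (i * (P.Lx / Mx)) (j * (P.Ly / My)) (((n : ℝ) - 1 / 2) * (P.T / N))

/-- Source of the scheme at level `n`: the mean of `f(x_i, y_j, t_n)` and
`f(x_i, y_j, t_{n-1})`. -/
def avgSource (P : Data p q s) (Mx My N : ℕ) (n i j : ℕ) : ℝ :=
  (P.f (i * (P.Lx / Mx)) (j * (P.Ly / My)) ((n : ℝ) * (P.T / N)) +
    P.f (i * (P.Lx / Mx)) (j * (P.Ly / My)) (((n : ℝ) - 1) * (P.T / N))) / 2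

/-- `U n i j = U_{ij}^n` solves the implicit finite difference scheme with `Mx × My` space cells,
`N` time steps and source `F n i j = f_{ij}^{n-1/2}`. -/
structure IsSchemeSolution (P : Data p q s) (Mx My N : ℕ) (F : ℕ → ℕ → ℕ → ℝ)
    (U : ℕ → ℕ → ℕ → ℝ) : Prop where
  equation : ∀ n ∈ Finset.Icc 1 N, ∀ i ∈ Finset.Icc 1 (Mx - 1), ∀ j ∈ Finset.Icc 1 (My - 1),
    (∑ l, P.a l * ((P.T / N) ^ (1 - P.γ l) / Real.Gamma (3 - P.γ l)) *
          (aHigh (P.γ l) 0 * dt (P.T / N) U n i j -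
            (∑ k ∈ Finset.Icc 1 (n - 1),
              (aHigh (P.γ l) (n - k - 1) - aHigh (P.γ l) (n - k)) * dt (P.T / N) U k i j) -
            aHigh (P.γ l) (n - 1) * P.ϕ (i * (P.Lx / Mx)) (j * (P.Ly / My)))) +
        P.b₁ * dt (P.T / N) U n i j +
        (∑ m, P.c m * ((P.T / N) ^ (1 - P.α m) / Real.Gamma (2 - P.α m)) *
          ∑ k ∈ Finset.Icc 1 n, cLow (P.α m) n (n - k) * dt (P.T / N) U k i j) +
        P.b₂ * ((U n i j + U (n - 1) i j) / 2) =
      P.b₃ * ((discLaplacian (P.Lx / Mx) (P.Ly / My) (U n) i j +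
          discLaplacian (P.Lx / Mx) (P.Ly / My) (U (n - 1)) i j) / 2) +
        (∑ r, P.d r * ((P.T / N) ^ (1 - P.β r) / Real.Gamma (2 - P.β r)) *
          ∑ k ∈ Finset.Icc 1 n, cLow (P.β r) n (n - k) *
            dt (P.T / N) (fun n' => discLaplacian (P.Lx / Mx) (P.Ly / My) (U n')) k i j) +
        F n i j
  initial : ∀ i ≤ Mx, ∀ j ≤ My, U 0 i j = P.φ (i * (P.Lx / Mx)) (j * (P.Ly / My))
  boundary : ∀ n ∈ Finset.Icc 1 N, ∀ i ≤ Mx, ∀ j ≤ My,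
    (i = 0 ∨ i = Mx ∨ j = 0 ∨ j = My) → U n i j = 0

/-- The error `e_{ij} = u(x_i, y_j, t_n) - U_{ij}^n` at level `n`. -/
def error (P : Data p q s) (Mx My N : ℕ) (u : ℝ → ℝ → ℝ → ℝ) (U : ℕ → ℕ → ℕ → ℝ)
    (n : ℕ) (i j : ℕ) : ℝ :=
  u (i * (P.Lx / Mx)) (j * (P.Ly / My)) (n * (P.T / N)) - U n i j

/-- The temporal order `min_{l,m,r} (3 - γ_l, 2 - α_m, 2 - β_r)`. -/
def order (P : Data p q s) : ℝ :=
  min (⨅ l, (3 - P.γ l)) (min (⨅ m, (2 - P.α m)) (⨅ r, (2 - P.β r)))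

/-- `√(T Lx Ly / (Σ_l a_l T^{1-γ_l} / Γ(2-γ_l) + 2 b₁)) (τ^order + h_x² + h_y²)`. -/
def rate (P : Data p q s) (Mx My N : ℕ) : ℝ :=
  Real.sqrt (P.T * P.Lx * P.Ly /
      ((∑ l, P.a l * P.T ^ (1 - P.γ l) / Real.Gamma (2 - P.γ l)) + 2 * P.b₁)) *
    ((P.T / N) ^ order P + (P.Lx / Mx) ^ 2 + (P.Ly / My) ^ 2)

/-- Replacing the midpoint value of `f` in time by the mean of the end point values costs at most
`O(τ^order)`, uniformly on the domain. -/
def AveragingConsistent (P : Data p q s) : Prop :=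
  ∃ K : ℝ, ∀ x ∈ Ioo 0 P.Lx, ∀ y ∈ Ioo 0 P.Ly, ∀ t τ : ℝ, 0 ≤ t → 0 < τ → t + τ ≤ P.T →
    |(P.f x y (t + τ) + P.f x y t) / 2 - P.f x y (t + τ / 2)| ≤ K * τ ^ order P

end OldroydB

end

namespace OldroydB

/-! ### Monotonicity of differences of the power kernel -/

lemma rpow_neg_le_of_le {α x y : ℝ} (hα : 0 < α) (hx : 0 < x) (hxy : x ≤ y) :
    y ^ (-α) ≤ x ^ (-α) :=
  Real.rpow_le_rpow_of_nonpos hx hxy (by linarith)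

lemma hasDerivAt_rpow_neg (α : ℝ) {x : ℝ} (hx : 0 < x) (c : ℝ) (hc : 0 ≤ c) :
    HasDerivAt (fun z : ℝ => (z + c) ^ (-α)) (-α * (x + c) ^ (-(α + 1))) x := by
  have h := ((hasDerivAt_id x).add_const c).rpow_const (p := -α) (Or.inl (by
    simp only [id]; linarith : (id x + c) ≠ 0))
  refine h.congr_deriv ?_
  rw [id, one_mul, show -(α + 1) = -α - 1 by ring]

lemma antitoneOn_rpow_diff {α : ℝ} (hα : 0 < α) :
    AntitoneOn (fun x : ℝ => x ^ (-α) - (x + 1) ^ (-α)) (Ioi 0) := by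
  have hd : ∀ x ∈ Ioi (0 : ℝ), HasDerivAt (fun x : ℝ => x ^ (-α) - (x + 1) ^ (-α))
      (-α * x ^ (-(α + 1)) - -α * (x + 1) ^ (-(α + 1))) x := by
    intro x hx
    have h0 := hasDerivAt_rpow_neg α hx 0 le_rfl
    simp only [add_zero] at h0
    exact h0.sub (hasDerivAt_rpow_neg α hx 1 zero_le_one)
  apply antitoneOn_of_deriv_nonpos (convex_Ioi 0)
  · exact fun x hx => (hd x hx).continuousAt.continuousWithinAt
  · rw [interior_Ioi]; exact fun x hx => (hd x hx).differentiableAt.differentiableWithinAt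
  · rw [interior_Ioi]
    intro x hx
    rw [(hd x hx).deriv]
    have := rpow_neg_le_of_le (α := α + 1) (x := x) (y := x + 1) (by linarith) hx (by linarith)
    nlinarith

lemma antitoneOn_rpow_diff_two {α : ℝ} (hα : 0 < α) :
    AntitoneOn (fun x : ℝ => x ^ (-α) - 2 * (x + 1) ^ (-α) + (x + 2) ^ (-α)) (Ioi 0) := by
  have hd : ∀ x ∈ Ioi (0 : ℝ), HasDerivAt
      (fun x : ℝ => x ^ (-α) - 2 * (x + 1) ^ (-α) + (x + 2) ^ (-α))
      (-α * x ^ (-(α + 1)) - 2 * (-α * (x + 1) ^ (-(α + 1))) + -α * (x + 2) ^ (-(α + 1))) x := by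
    intro x hx
    have h0 := hasDerivAt_rpow_neg α hx 0 le_rfl
    simp only [add_zero] at h0
    exact (h0.sub ((hasDerivAt_rpow_neg α hx 1 zero_le_one).const_mul 2)).add
      (hasDerivAt_rpow_neg α hx 2 zero_le_two)
  apply antitoneOn_of_deriv_nonpos (convex_Ioi 0)
  · exact fun x hx => (hd x hx).continuousAt.continuousWithinAt
  · rw [interior_Ioi]; exact fun x hx => (hd x hx).differentiableAt.differentiableWithinAt
  · rw [interior_Ioi]
    intro x hx
    rw [(hd x hx).deriv]
    have hx' : (0 : ℝ) < x := hx
    have := antitoneOn_rpow_diff (α := α + 1) (by linarith) hx'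
      (show x + 1 ∈ Ioi (0 : ℝ) from by simp only [mem_Ioi]; linarith) (by linarith)
    simp only at this
    rw [show x + 1 + 1 = x + 2 by ring] at this
    nlinarith

lemma rpow_diff_two_nonneg {α x : ℝ} (hα : 0 < α) (hx : 0 < x) :
    0 ≤ x ^ (-α) - 2 * (x + 1) ^ (-α) + (x + 2) ^ (-α) := by
  have := antitoneOn_rpow_diff hα hx
    (show x + 1 ∈ Ioi (0 : ℝ) from by simp only [mem_Ioi]; linarith) (by linarith)
  simp only at this
  rw [show x + 1 + 1 = x + 2 by ring] at this
  linarith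

lemma rpow_diff_three_nonneg {α x : ℝ} (hα : 0 < α) (hx : 0 < x) :
    0 ≤ x ^ (-α) - 3 * (x + 1) ^ (-α) + 3 * (x + 2) ^ (-α) - (x + 3) ^ (-α) := by
  have := antitoneOn_rpow_diff_two hα hx
    (show x + 1 ∈ Ioi (0 : ℝ) from by simp only [mem_Ioi]; linarith) (by linarith)
  simp only at this
  rw [show x + 1 + 1 = x + 2 by ring, show x + 1 + 2 = x + 3 by ring] at this
  linarith

/-! ### The coefficients `aLow`, `bLow` as integrals -/

lemma half_le_add {k : ℕ} (hk : 1 ≤ k) {y : ℝ} (hy : y ∈ Icc (-(1 / 2) : ℝ) (1 / 2)) :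
    1 / 2 ≤ (k : ℝ) + y := by
  have : (1 : ℝ) ≤ k := by exact_mod_cast hk
  linarith [hy.1]

lemma continuousOn_affine_rpow (α A B : ℝ) {k : ℕ} (hk : 1 ≤ k) :
    ContinuousOn (fun y : ℝ => (A + B * y) * ((k : ℝ) + y) ^ (-α)) (Icc (-(1 / 2)) (1 / 2)) := by
  apply ContinuousOn.mul (by fun_prop)
  apply ContinuousOn.rpow_const (by fun_prop)
  intro y hy
  left
  linarith [half_le_add hk hy]

lemma intervalIntegrable_affine_rpow (α A B : ℝ) {k : ℕ} (hk : 1 ≤ k) :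
    IntervalIntegrable (fun y : ℝ => (A + B * y) * ((k : ℝ) + y) ^ (-α)) MeasureTheory.volume
      (-(1 / 2)) (1 / 2) := by
  apply ContinuousOn.intervalIntegrable
  rw [uIcc_of_le (by norm_num)]
  exact continuousOn_affine_rpow α A B hk

lemma integral_affine_rpow {α : ℝ} (hα : α ∈ Ioo (0 : ℝ) 1) (A B : ℝ) {k : ℕ} (hk : 1 ≤ k) :
    (1 - α) * ∫ y in (-(1 / 2) : ℝ)..(1 / 2), (A + B * y) * ((k : ℝ) + y) ^ (-α) =
      A * aLow α k - B * bLow α k := by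
  have h1 : (1 - α) ≠ 0 := by linarith [hα.2]
  have h2 : (2 - α) ≠ 0 := by linarith [hα.2]
  have hF : ∀ y ∈ uIcc (-(1 / 2) : ℝ) (1 / 2), HasDerivAt
      (fun y : ℝ => (A + B * y) * ((k : ℝ) + y) ^ (1 - α) / (1 - α) -
        B * ((k : ℝ) + y) ^ (2 - α) / ((1 - α) * (2 - α)))
      ((A + B * y) * ((k : ℝ) + y) ^ (-α)) y := by
    intro y hy
    rw [uIcc_of_le (by norm_num)] at hy
    have hpos : (0 : ℝ) < k + y := by linarith [half_le_add hk hy]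
    have hb : HasDerivAt (fun y : ℝ => (k : ℝ) + y) 1 y := (hasDerivAt_id y).const_add _
    have hl : HasDerivAt (fun y : ℝ => A + B * y) B y := by
      simpa using ((hasDerivAt_id y).const_mul B).const_add A
    have e1 := hb.rpow_const (p := 1 - α) (Or.inl hpos.ne')
    have e2 := hb.rpow_const (p := 2 - α) (Or.inl hpos.ne')
    refine (((hl.mul e1).div_const (1 - α)).sub
      ((e2.const_mul B).div_const ((1 - α) * (2 - α)))).congr_deriv ?_
    rw [show (1 - α - 1) = -α by ring, show (2 - α - 1) = 1 - α by ring]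
    field_simp
    ring
  rw [intervalIntegral.integral_eq_sub_of_hasDerivAt hF
    (by simpa using intervalIntegrable_affine_rpow α A B hk)]
  have hk1 : (1 : ℝ) ≤ k := by exact_mod_cast hk
  have e1 : ((k : ℝ) + 1 / 2) ^ (2 - α) = ((k : ℝ) + 1 / 2) * ((k : ℝ) + 1 / 2) ^ (1 - α) := by
    rw [show (2 - α) = 1 + (1 - α) by ring, Real.rpow_add (by linarith), Real.rpow_one]
  have e2 : ((k : ℝ) - 1 / 2) ^ (2 - α) = ((k : ℝ) - 1 / 2) * ((k : ℝ) - 1 / 2) ^ (1 - α) := by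
    rw [show (2 - α) = 1 + (1 - α) by ring, Real.rpow_add (by linarith), Real.rpow_one]
  rw [aLow, bLow, if_neg (by omega)]
  rw [show (k : ℝ) + -(1 / 2) = k - 1 / 2 by ring]
  field_simp
  ring

lemma integral_affine_rpow_shift {α : ℝ} (hα : α ∈ Ioo (0 : ℝ) 1) (A B : ℝ) (k j : ℕ)
    (hk : 1 ≤ k) :
    (1 - α) * ∫ y in (-(1 / 2) : ℝ)..(1 / 2), (A + B * y) * ((k : ℝ) + y + j) ^ (-α) =
      A * aLow α (k + j) - B * bLow α (k + j) := by
  rw [← integral_affine_rpow hα A B (k := k + j) (by omega)]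
  congr 1
  apply intervalIntegral.integral_congr
  intro y _
  simp only
  push_cast
  ring_nf

lemma intervalIntegrable_affine_rpow_shift (α A B : ℝ) {k : ℕ} (j : ℕ) (hk : 1 ≤ k) :
    IntervalIntegrable (fun y : ℝ => (A + B * y) * ((k : ℝ) + y + j) ^ (-α)) MeasureTheory.volume
      (-(1 / 2)) (1 / 2) := by
  have := intervalIntegrable_affine_rpow α A B (k := k + j) (by omega)
  convert this using 3
  push_cast
  ring_nf

lemma integral_nonneg_half {f : ℝ → ℝ} (h : ∀ y ∈ Icc (-(1 / 2) : ℝ) (1 / 2), 0 ≤ f y) :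
    0 ≤ ∫ y in (-(1 / 2) : ℝ)..(1 / 2), f y :=
  intervalIntegral.integral_nonneg (by norm_num) h

lemma integral_neg_half : ∫ y in (-(1 / 2) : ℝ)..(1 / 2), (0 + -1 * y) = 0 := by
  simp_rw [zero_add]
  rw [intervalIntegral.integral_const_mul, integral_id]
  norm_num

section Low

variable {α : ℝ} (hα : α ∈ Ioo (0 : ℝ) 1)
include hα

lemma aLow_sub_bLow_nonneg {k : ℕ} (hk : 1 ≤ k) : 0 ≤ aLow α k - bLow α k := by
  have h := integral_affine_rpow hα 1 1 hk
  rw [one_mul, one_mul] at h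
  rw [← h]
  apply mul_nonneg (by linarith [hα.2])
  apply integral_nonneg_half
  intro y hy
  have := half_le_add hk hy
  exact mul_nonneg (by linarith [hy.1]) (Real.rpow_nonneg (by linarith) _)

lemma aLow_sub_bLow_antitone {k : ℕ} (hk : 1 ≤ k) :
    aLow α (k + 1) - bLow α (k + 1) ≤ aLow α k - bLow α k := by
  have h := integral_affine_rpow hα 1 1 hk
  have h' := integral_affine_rpow_shift hα 1 1 k 1 hk
  rw [one_mul, one_mul] at h h'
  rw [← h, ← h']
  apply mul_le_mul_of_nonneg_left _ (by linarith [hα.2])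
  apply intervalIntegral.integral_mono_on (by norm_num)
    (intervalIntegrable_affine_rpow_shift α 1 1 1 hk) (intervalIntegrable_affine_rpow α 1 1 hk)
  intro y hy
  have := half_le_add hk hy
  apply mul_le_mul_of_nonneg_left _ (by linarith [hy.1])
  exact rpow_neg_le_of_le hα.1 (by linarith) (by push_cast; linarith)

lemma aLow_nonneg (k : ℕ) : 0 ≤ aLow α k := by
  rcases Nat.eq_zero_or_pos k with rfl | hk
  · simp only [aLow, if_true]; positivity
  have h := integral_affine_rpow hα 1 0 hk
  rw [one_mul, zero_mul, sub_zero] at h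
  rw [← h]
  apply mul_nonneg (by linarith [hα.2])
  apply integral_nonneg_half
  intro y hy
  have := half_le_add hk hy
  exact mul_nonneg (by linarith [hy.1]) (Real.rpow_nonneg (by linarith) _)

lemma bLow_nonneg {k : ℕ} (hk : 1 ≤ k) : 0 ≤ bLow α k := by
  have h := integral_affine_rpow hα 0 (-1) hk
  have h0 := intervalIntegral.integral_nonneg (μ := MeasureTheory.volume)
    (f := fun y : ℝ => (0 + -1 * y) * (((k : ℝ) + y) ^ (-α) - (k : ℝ) ^ (-α)))
    (a := -(1 / 2)) (b := 1 / 2) (by norm_num) (by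
      intro y hy
      have := half_le_add hk hy
      have hk1 : (1 : ℝ) ≤ k := by exact_mod_cast hk
      rcases le_total 0 y with h0 | h0
      · have := rpow_neg_le_of_le (α := α) (x := k) (y := k + y) hα.1 (by linarith) (by linarith)
        nlinarith
      · have := rpow_neg_le_of_le (α := α) (x := k + y) (y := k) hα.1 (by linarith) (by linarith)
        nlinarith)
  have e : (∫ y in (-(1 / 2) : ℝ)..(1 / 2), (0 + -1 * y) * (((k : ℝ) + y) ^ (-α) - (k : ℝ) ^ (-α)))
      = ∫ y in (-(1 / 2) : ℝ)..(1 / 2), (0 + -1 * y) * ((k : ℝ) + y) ^ (-α) := by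
    have : ∀ y : ℝ, (0 + -1 * y) * (((k : ℝ) + y) ^ (-α) - (k : ℝ) ^ (-α)) =
      (0 + -1 * y) * ((k : ℝ) + y) ^ (-α) - (0 + -1 * y) * (k : ℝ) ^ (-α) := fun y => by ring
    simp_rw [this]
    rw [intervalIntegral.integral_sub (intervalIntegrable_affine_rpow α 0 (-1) hk)
      (Continuous.intervalIntegrable (by fun_prop) _ _)]
    rw [intervalIntegral.integral_mul_const, integral_neg_half]
    ring
  rw [e] at h0
  have : (1 - α) * 0 ≤ (1 - α) * ∫ y in (-(1 / 2) : ℝ)..(1 / 2), (0 + -1 * y) * ((k : ℝ) + y) ^ (-α) :=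
    mul_le_mul_of_nonneg_left h0 (by linarith [hα.2])
  linarith

lemma bLow_antitone {k : ℕ} (hk : 1 ≤ k) : bLow α (k + 1) ≤ bLow α k := by
  have h := integral_affine_rpow hα 0 (-1) hk
  have h' := integral_affine_rpow_shift hα 0 (-1) k 1 hk
  have hk1 : (1 : ℝ) ≤ k := by exact_mod_cast hk
  set c : ℝ := (k : ℝ) ^ (-α) - ((k : ℝ) + 1) ^ (-α) with hc
  have h0 := intervalIntegral.integral_nonneg (μ := MeasureTheory.volume)
    (f := fun y : ℝ => (0 + -1 * y) * ((((k : ℝ) + y) ^ (-α) - ((k : ℝ) + y + (1 : ℕ)) ^ (-α)) - c))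
    (a := -(1 / 2)) (b := 1 / 2) (by norm_num) (by
      intro y hy
      have := half_le_add hk hy
      have hm := antitoneOn_rpow_diff hα.1
      push_cast
      rcases le_total 0 y with h0 | h0
      · have := hm (show (k : ℝ) ∈ Ioi 0 by simp only [mem_Ioi]; linarith)
          (show (k : ℝ) + y ∈ Ioi 0 by simp only [mem_Ioi]; linarith) (by linarith)
        simp only at this
        nlinarith
      · have := hm (show (k : ℝ) + y ∈ Ioi 0 by simp only [mem_Ioi]; linarith)
          (show (k : ℝ) ∈ Ioi 0 by simp only [mem_Ioi]; linarith) (by linarith)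
        simp only at this
        nlinarith)
  have e : (∫ y in (-(1 / 2) : ℝ)..(1 / 2),
        (0 + -1 * y) * ((((k : ℝ) + y) ^ (-α) - ((k : ℝ) + y + (1 : ℕ)) ^ (-α)) - c))
      = (∫ y in (-(1 / 2) : ℝ)..(1 / 2), (0 + -1 * y) * ((k : ℝ) + y) ^ (-α)) -
        ∫ y in (-(1 / 2) : ℝ)..(1 / 2), (0 + -1 * y) * ((k : ℝ) + y + (1 : ℕ)) ^ (-α) := by
    have : ∀ y : ℝ, (0 + -1 * y) * ((((k : ℝ) + y) ^ (-α) - ((k : ℝ) + y + (1 : ℕ)) ^ (-α)) - c) =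
      ((0 + -1 * y) * ((k : ℝ) + y) ^ (-α) - (0 + -1 * y) * ((k : ℝ) + y + (1 : ℕ)) ^ (-α)) -
        (0 + -1 * y) * c := fun y => by ring
    simp_rw [this]
    have i1 := intervalIntegrable_affine_rpow α 0 (-1) hk
    have i2 := intervalIntegrable_affine_rpow_shift α 0 (-1) 1 hk
    rw [intervalIntegral.integral_sub (i1.sub i2) (Continuous.intervalIntegrable (by fun_prop) _ _),
      intervalIntegral.integral_sub i1 i2, intervalIntegral.integral_mul_const, integral_neg_half]
    ring
  rw [e] at h0
  have := mul_nonneg (show 0 ≤ 1 - α by linarith [hα.2]) h0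
  rw [mul_sub, h, h'] at this
  linarith

lemma bLow_le_aLow {k : ℕ} (hk : 1 ≤ k) : bLow α k ≤ aLow α k := by
  linarith [aLow_sub_bLow_nonneg hα hk]

omit hα in
lemma sum_aLow (n : ℕ) : ∑ k ∈ Finset.range (n + 1), aLow α k = ((n : ℝ) + 1 / 2) ^ (1 - α) := by
  induction n with
  | zero => simp [aLow]
  | succ n ih =>
    rw [Finset.sum_range_succ, ih, aLow, if_neg (by omega)]
    push_cast
    rw [show (n : ℝ) + 1 - 1 / 2 = n + 1 / 2 by ring]
    ring

end Low

/-- The convolution weights underlying `cLow`: `cLow α n (n - k)` equals `omegaLow α (n - k)` up to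
a correction in the first column `k = 1`. -/
noncomputable def omegaLow (α : ℝ) (k : ℕ) : ℝ :=
  if k = 0 then aLow α 0 + bLow α 1 else aLow α k + bLow α (k + 1) - bLow α k

section Omega

variable {α : ℝ} (hα : α ∈ Ioo (0 : ℝ) 1)
include hα

lemma omegaLow_succ_le {k : ℕ} (hk : 1 ≤ k) : omegaLow α (k + 1) ≤ omegaLow α k := by
  have key : omegaLow α k - omegaLow α (k + 1) = (1 - α) * ∫ y in (-(1 / 2) : ℝ)..(1 / 2),
      ((1 + 1 * y) * ((k : ℝ) + y + (0 : ℕ)) ^ (-α) + (-1 + -2 * y) * ((k : ℝ) + y + (1 : ℕ)) ^ (-α)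
        + (0 + 1 * y) * ((k : ℝ) + y + (2 : ℕ)) ^ (-α)) := by
    rw [intervalIntegral.integral_add (((intervalIntegrable_affine_rpow_shift α _ _ _ hk)).add
      (intervalIntegrable_affine_rpow_shift α _ _ _ hk))
      (intervalIntegrable_affine_rpow_shift α _ _ _ hk),
      intervalIntegral.integral_add (intervalIntegrable_affine_rpow_shift α _ _ _ hk)
      (intervalIntegrable_affine_rpow_shift α _ _ _ hk), mul_add, mul_add,
      integral_affine_rpow_shift hα _ _ _ _ hk, integral_affine_rpow_shift hα _ _ _ _ hk,
      integral_affine_rpow_shift hα _ _ _ _ hk]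
    rw [omegaLow, if_neg (by omega), omegaLow, if_neg (by omega)]
    simp only [Nat.add_zero]
    ring_nf
  have : 0 ≤ omegaLow α k - omegaLow α (k + 1) := by
    rw [key]
    apply mul_nonneg (by linarith [hα.2])
    apply integral_nonneg_half
    intro y hy
    have hx := half_le_add hk hy
    push_cast
    set x := (k : ℝ) + y
    have d2 := rpow_diff_two_nonneg (α := α) (x := x) hα.1 (by linarith)
    have g0 := rpow_neg_le_of_le (α := α) (x := x) (y := x + 1) hα.1 (by linarith) (by linarith)
    have g1 := rpow_neg_le_of_le (α := α) (x := x + 1) (y := x + 2) hα.1 (by linarith) (by linarith)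
    rw [add_zero]
    rcases le_total 0 y with h0 | h0
    · nlinarith
    · nlinarith [hy.1]
  linarith

lemma omegaLow_diff_antitone {k : ℕ} (hk : 1 ≤ k) :
    omegaLow α (k + 1) - omegaLow α (k + 2) ≤ omegaLow α k - omegaLow α (k + 1) := by
  have key : omegaLow α k - 2 * omegaLow α (k + 1) + omegaLow α (k + 2) =
      (1 - α) * ∫ y in (-(1 / 2) : ℝ)..(1 / 2),
      (((1 + 1 * y) * ((k : ℝ) + y + (0 : ℕ)) ^ (-α) + (-2 + -3 * y) * ((k : ℝ) + y + (1 : ℕ)) ^ (-α)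
        + (1 + 3 * y) * ((k : ℝ) + y + (2 : ℕ)) ^ (-α))
        + (0 + -1 * y) * ((k : ℝ) + y + (3 : ℕ)) ^ (-α)) := by
    have i : ∀ A B (j : ℕ), _ := fun A B j => intervalIntegrable_affine_rpow_shift α A B j hk
    rw [intervalIntegral.integral_add (((i _ _ _).add (i _ _ _)).add (i _ _ _)) (i _ _ _),
      intervalIntegral.integral_add ((i _ _ _).add (i _ _ _)) (i _ _ _),
      intervalIntegral.integral_add (i _ _ _) (i _ _ _), mul_add, mul_add, mul_add,
      integral_affine_rpow_shift hα _ _ _ _ hk, integral_affine_rpow_shift hα _ _ _ _ hk,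
      integral_affine_rpow_shift hα _ _ _ _ hk, integral_affine_rpow_shift hα _ _ _ _ hk]
    rw [omegaLow, if_neg (by omega), omegaLow, if_neg (by omega), omegaLow, if_neg (by omega)]
    simp only [Nat.add_zero]
    ring_nf
  have : 0 ≤ omegaLow α k - 2 * omegaLow α (k + 1) + omegaLow α (k + 2) := by
    rw [key]
    apply mul_nonneg (by linarith [hα.2])
    apply integral_nonneg_half
    intro y hy
    have hx := half_le_add hk hy
    push_cast
    set x := (k : ℝ) + y
    have d3 := rpow_diff_three_nonneg (α := α) (x := x) hα.1 (by linarith)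
    have g0 := rpow_diff_two_nonneg (α := α) (x := x) hα.1 (by linarith)
    have g1 := rpow_diff_two_nonneg (α := α) (x := x + 1) hα.1 (by linarith)
    rw [show x + 1 + 1 = x + 2 by ring, show x + 1 + 2 = x + 3 by ring] at g1
    rw [add_zero]
    rcases le_total 0 y with h0 | h0
    · nlinarith
    · nlinarith [hy.1]
  linarith

lemma omegaLow_nonneg (k : ℕ) : 0 ≤ omegaLow α k := by
  rw [omegaLow]
  split_ifs with h
  · have := aLow_nonneg hα 0
    have := bLow_nonneg hα (k := 1) le_rfl
    linarith
  · have := aLow_sub_bLow_nonneg hα (k := k) (by omega)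
    have := bLow_nonneg hα (k := k + 1) (by omega)
    linarith

omit hα in
lemma four_sub_rpow_nonneg {p : ℝ} (hp : p ≤ 1) : 0 ≤ 4 - 3 * (3 : ℝ) ^ p + (5 : ℝ) ^ p := by
  set r : ℝ := (3 : ℝ) ^ ((p - 1) / 2) with hr
  have hr0 : 0 < r := Real.rpow_pos_of_pos (by norm_num) _
  have hr1 : r ≤ 1 := Real.rpow_le_one_of_one_le_of_nonpos (by norm_num) (by linarith)
  have h3 : (3 : ℝ) ^ p = 3 * r ^ 2 := by
    rw [hr, ← Real.rpow_natCast, ← Real.rpow_mul (by norm_num)]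
    nth_rw 2 [← Real.rpow_one 3]
    rw [← Real.rpow_add (by norm_num)]
    congr 1; push_cast; ring
  have h5 : 5 * r ^ 3 ≤ (5 : ℝ) ^ p := by
    have e : r ^ 3 = (27 : ℝ) ^ ((p - 1) / 2) := by
      rw [hr, ← Real.rpow_natCast, ← Real.rpow_mul (by norm_num), mul_comm, Real.rpow_mul (by norm_num)]
      norm_num
    have e' : (5 : ℝ) ^ p = 5 * (25 : ℝ) ^ ((p - 1) / 2) := by
      rw [show (25 : ℝ) = 5 ^ (2 : ℝ) by norm_num, ← Real.rpow_mul (by norm_num)]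
      nth_rw 2 [← Real.rpow_one 5]
      rw [← Real.rpow_add (by norm_num)]
      congr 1; ring
    rw [e, e']
    apply mul_le_mul_of_nonneg_left _ (by norm_num)
    exact Real.rpow_le_rpow_of_nonpos (by norm_num) (by norm_num) (by linarith)
  have : 0 ≤ (1 - r) * (4 + 4 * r - 5 * r ^ 2) := by
    apply mul_nonneg (by linarith); nlinarith
  nlinarith

lemma omegaLow_diff_zero :
    omegaLow α 1 - omegaLow α 2 ≤ 2 * omegaLow α 0 - omegaLow α 1 := by
  have hb1 := bLow_nonneg hα (k := 1) le_rfl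
  have hb2 := bLow_antitone hα (k := 1) le_rfl
  have hb3 := bLow_nonneg hα (k := 3) (by norm_num)
  have h := four_sub_rpow_nonneg (p := 1 - α) (by linarith [hα.1])
  have key : 0 ≤ 2 * aLow α 0 - 2 * aLow α 1 + aLow α 2 := by
    have e : 2 * aLow α 0 - 2 * aLow α 1 + aLow α 2 =
        (1 / 2) ^ (1 - α) * (4 - 3 * (3 : ℝ) ^ (1 - α) + (5 : ℝ) ^ (1 - α)) := by
      simp only [aLow, if_true]
      norm_num
      rw [show (3 / 2 : ℝ) = (1 / 2) * 3 by norm_num, show (5 / 2 : ℝ) = (1 / 2) * 5 by norm_num,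
        Real.mul_rpow (by norm_num) (by norm_num), Real.mul_rpow (by norm_num) (by norm_num)]
      ring
    rw [e]
    exact mul_nonneg (by positivity) h
  simp only [omegaLow]
  norm_num at *
  linarith

lemma aLow_one_sub_bLow_one_le : aLow α 1 - bLow α 1 ≤ 2 * aLow α 0 := by
  have h := integral_affine_rpow hα 1 1 (k := 1) le_rfl
  rw [one_mul, one_mul] at h
  have hle : (∫ y in (-(1 / 2) : ℝ)..(1 / 2), (1 + 1 * y) * (((1 : ℕ) : ℝ) + y) ^ (-α)) ≤
      ∫ y in (-(1 / 2) : ℝ)..(1 / 2), (1 + 1 * y) * (1 / 2 : ℝ) ^ (-α) := by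
    apply intervalIntegral.integral_mono_on (by norm_num)
      (intervalIntegrable_affine_rpow α 1 1 le_rfl) (Continuous.intervalIntegrable (by fun_prop) _ _)
    intro y hy
    have := half_le_add (k := 1) le_rfl hy
    exact mul_le_mul_of_nonneg_left (rpow_neg_le_of_le hα.1 (by norm_num) this)
      (by linarith [hy.1])
  have e : (∫ y in (-(1 / 2) : ℝ)..(1 / 2), (1 + 1 * y) * (1 / 2 : ℝ) ^ (-α)) =
      (1 / 2 : ℝ) ^ (-α) := by
    rw [intervalIntegral.integral_mul_const]
    have : (∫ y in (-(1 / 2) : ℝ)..(1 / 2), (1 + 1 * y)) = 1 := by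
      rw [intervalIntegral.integral_add (by simp) (Continuous.intervalIntegrable (by fun_prop) _ _)]
      norm_num
    rw [this, one_mul]
  have e0 : aLow α 0 = 1 / 2 * (1 / 2 : ℝ) ^ (-α) := by
    simp only [aLow, if_true]
    rw [show 1 - α = 1 + -α by ring, Real.rpow_add (by norm_num), Real.rpow_one]
  rw [e] at hle
  have hp : 0 < (1 / 2 : ℝ) ^ (-α) := by positivity
  rw [← h, e0]
  calc _ ≤ (1 - α) * (1 / 2 : ℝ) ^ (-α) := mul_le_mul_of_nonneg_left hle (by linarith [hα.2])
    _ ≤ _ := by nlinarith [hα.1]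

end Omega

/-! ### The coefficients `aHigh` -/

section High

variable {γ : ℝ} (hγ : γ ∈ Ioo (1 : ℝ) 2)
include hγ

lemma aHigh_zero : aHigh γ 0 = 1 := by
  have : (0 : ℝ) ^ (2 - γ) = 0 := Real.zero_rpow (by linarith [hγ.2])
  simp [aHigh, this]

lemma aHigh_nonneg (k : ℕ) : 0 ≤ aHigh γ k := by
  rw [aHigh, sub_nonneg]
  exact Real.rpow_le_rpow (by positivity) (by linarith) (by linarith [hγ.2])

lemma le_aHigh_sub {k : ℕ} (hk : 1 ≤ k) :
    (2 - γ) * (γ - 1) * ((k : ℝ) + 1) ^ (-γ) ≤ aHigh γ (k - 1) - aHigh γ k := by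
  obtain ⟨j, rfl⟩ : ∃ j, k = j + 1 := ⟨k - 1, by omega⟩
  have hp : 0 < 2 - γ := by linarith [hγ.2]
  have hj : (0 : ℝ) ≤ j := by positivity
  obtain ⟨ξ, hξ, e⟩ := exists_hasDerivAt_eq_slope
    (fun x : ℝ => (x + 1) ^ (2 - γ) - x ^ (2 - γ))
    (fun x => (2 - γ) * (x + 1) ^ (1 - γ) - (2 - γ) * x ^ (1 - γ)) (a := j) (b := j + 1)
    (by linarith)
    (by
      apply ContinuousOn.sub
      · exact ContinuousOn.rpow_const (by fun_prop) (fun x _ => Or.inr hp.le)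
      · exact ContinuousOn.rpow_const (by fun_prop) (fun x _ => Or.inr hp.le))
    (by
      intro x hx
      have hx0 : 0 < x := by linarith [hx.1]
      have h1 := ((hasDerivAt_id x).add_const (1 : ℝ)).rpow_const (p := 2 - γ)
        (Or.inl (by simp only [id]; linarith : id x + 1 ≠ 0))
      have h2 := (hasDerivAt_id x).rpow_const (p := 2 - γ) (Or.inl (by simp only [id]; linarith))
      refine (h1.sub h2).congr_deriv ?_
      rw [id, one_mul, show 2 - γ - 1 = 1 - γ by ring])
  have hξ0 : 0 < ξ := by linarith [hξ.1]
  obtain ⟨η, hη, e'⟩ := exists_hasDerivAt_eq_slope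
    (fun x : ℝ => x ^ (1 - γ)) (fun x => (1 - γ) * x ^ (-γ)) (a := ξ) (b := ξ + 1)
    (by linarith)
    (ContinuousOn.rpow_const (by fun_prop) (fun x hx => Or.inl (by linarith [hx.1])))
    (by
      intro x hx
      have hx0 : 0 < x := by linarith [hx.1]
      have h2 := (hasDerivAt_id x).rpow_const (p := 1 - γ) (Or.inl (by simp only [id]; linarith))
      refine h2.congr_deriv ?_
      rw [id, one_mul, show 1 - γ - 1 = -γ by ring])
  have hmono : ((j : ℝ) + 1 + 1) ^ (-γ) ≤ η ^ (-γ) :=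
    rpow_neg_le_of_le (by linarith [hγ.1]) (by linarith [hη.1]) (by linarith [hη.2, hξ.2])
  simp only [add_sub_cancel_left, div_one] at e e'
  simp only [aHigh, Nat.add_sub_cancel]
  push_cast
  have h3 : 0 < (2 - γ) * (γ - 1) := mul_pos hp (by linarith [hγ.1])
  have h4 := mul_le_mul_of_nonneg_left hmono h3.le
  have e2 : (2 - γ) * ((1 - γ) * η ^ (-γ)) = (2 - γ) * ((ξ + 1) ^ (1 - γ) - ξ ^ (1 - γ)) := by
    rw [e']
  linarith

lemma aHigh_antitone {k : ℕ} (hk : 1 ≤ k) : aHigh γ k ≤ aHigh γ (k - 1) := by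
  have h := le_aHigh_sub hγ hk
  have : 0 ≤ (2 - γ) * (γ - 1) * ((k : ℝ) + 1) ^ (-γ) :=
    mul_nonneg (mul_nonneg (by linarith [hγ.2]) (by linarith [hγ.1])) (by positivity)
  linarith

lemma aHigh_le_one (k : ℕ) : aHigh γ k ≤ 1 := by
  induction k with
  | zero => rw [aHigh_zero hγ]
  | succ k ih => exact (aHigh_antitone hγ (k := k + 1) (by omega)).trans ih

end High


/-! ### Positivity of discrete quadratic forms -/

lemma sum_range_triangle (M : ℕ) (g : ℕ → ℕ → ℝ) :
    ∑ n ∈ Finset.range M, ∑ k ∈ Finset.range (n + 1), g n k =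
      ∑ k ∈ Finset.range M, ∑ n ∈ Finset.Ico k M, g n k := by
  apply Finset.sum_comm'
  intro n k
  simp only [Finset.mem_range, Finset.mem_Ico]
  omega

/-- A lower triangular form whose rows, with doubled diagonal, have increments `D n p` that are
nonnegative and nonincreasing in the row index `n`, is nonnegative. -/
lemma triangular_form_nonneg {A D : ℕ → ℕ → ℝ}
    (hoff : ∀ n k, k < n → ∑ p ∈ Finset.range (k + 1), D n p = A n k)
    (hdiag : ∀ n, ∑ p ∈ Finset.range (n + 1), D n p = 2 * A n n)
    (hnn : ∀ n p, p ≤ n → 0 ≤ D n p) (hmono : ∀ n p, p ≤ n → D (n + 1) p ≤ D n p)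
    (x : ℕ → ℝ) (M : ℕ) :
    0 ≤ ∑ n ∈ Finset.range M, x n * ∑ k ∈ Finset.range (n + 1), A n k * x k := by
  set σ : ℕ → ℕ → ℝ := fun p m => ∑ k ∈ Finset.Ico p m, x k with hσ
  have row : ∀ n, 2 * (x n * ∑ k ∈ Finset.range (n + 1), A n k * x k) =
      ∑ p ∈ Finset.range (n + 1), D n p * (σ p (n + 1) ^ 2 - σ p n ^ 2) := by
    intro n
    have h1 : ∑ p ∈ Finset.range (n + 1), D n p * σ p (n + 1) =
        (∑ k ∈ Finset.range (n + 1), A n k * x k) + A n n * x n := by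
      have : ∑ p ∈ Finset.range (n + 1), D n p * σ p (n + 1) =
          ∑ k ∈ Finset.range (n + 1), (∑ p ∈ Finset.range (k + 1), D n p) * x k := by
        simp only [hσ, Finset.mul_sum, Finset.sum_mul]
        rw [sum_range_triangle (n + 1) (fun k p => D n p * x k)]
      rw [this, Finset.sum_range_succ, hdiag, Finset.sum_range_succ (fun k => A n k * x k)]
      rw [Finset.sum_congr rfl (fun k hk => by rw [hoff n k (Finset.mem_range.1 hk)])]
      ring
    have h2 : ∀ p ∈ Finset.range (n + 1), D n p * (σ p (n + 1) ^ 2 - σ p n ^ 2) =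
        2 * x n * (D n p * σ p (n + 1)) - x n ^ 2 * D n p := by
      intro p hp
      have : σ p (n + 1) = σ p n + x n :=
        Finset.sum_Ico_succ_top (by simpa [Nat.lt_succ_iff] using hp) x
      rw [this]; ring
    rw [Finset.sum_congr rfl h2, Finset.sum_sub_distrib, ← Finset.mul_sum, ← Finset.mul_sum, h1,
      hdiag]
    ring
  have key : ∀ m, ∑ p ∈ Finset.range (m + 1), D m p * σ p (m + 1) ^ 2 ≤
      ∑ n ∈ Finset.range (m + 1), 2 * (x n * ∑ k ∈ Finset.range (n + 1), A n k * x k) := by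
    intro m
    induction m with
    | zero =>
      rw [Finset.sum_range_one, Finset.sum_range_one, row 0, Finset.sum_range_one]
      simp [hσ]
    | succ m ih =>
      rw [Finset.sum_range_succ (fun n => 2 * (x n * ∑ k ∈ Finset.range (n + 1), A n k * x k)) (m + 1),
        row (m + 1)]
      have hle : ∑ p ∈ Finset.range (m + 1), D (m + 1) p * σ p (m + 1) ^ 2 ≤
          ∑ p ∈ Finset.range (m + 1), D m p * σ p (m + 1) ^ 2 := by
        apply Finset.sum_le_sum
        intro p hp
        exact mul_le_mul_of_nonneg_right
          (hmono m p (by simpa [Nat.lt_succ_iff] using hp)) (sq_nonneg _)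
      have e : ∑ p ∈ Finset.range (m + 1 + 1), D (m + 1) p * σ p (m + 1) ^ 2 =
          ∑ p ∈ Finset.range (m + 1), D (m + 1) p * σ p (m + 1) ^ 2 := by
        rw [Finset.sum_range_succ]; simp [hσ]
      simp only [mul_sub, Finset.sum_sub_distrib]
      rw [e]
      linarith
  cases M with
  | zero => simp
  | succ m =>
    have h := key m
    rw [← Finset.mul_sum] at h
    have h0 : 0 ≤ ∑ p ∈ Finset.range (m + 1), D m p * σ p (m + 1) ^ 2 :=
      Finset.sum_nonneg fun p hp => mul_nonneg
        (hnn m p (by simpa [Nat.lt_succ_iff] using hp)) (sq_nonneg _)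
    linarith

/-- Positivity of the convolution quadratic form with weights `s`. -/
def PosType (s : ℕ → ℝ) : Prop :=
  ∀ (x : ℕ → ℝ) (M : ℕ), 0 ≤ ∑ n ∈ Finset.range M, x n * ∑ k ∈ Finset.range (n + 1), s (n - k) * x k

lemma PosType.add {s t : ℕ → ℝ} (hs : PosType s) (ht : PosType t) :
    PosType (fun k => s k + t k) := by
  intro x M
  have := add_nonneg (hs x M) (ht x M)
  rw [← Finset.sum_add_distrib] at this
  refine this.trans_eq (Finset.sum_congr rfl fun n _ => ?_)
  rw [← mul_add, ← Finset.sum_add_distrib]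
  congr 2; ext; ring

lemma PosType.const_mul {s : ℕ → ℝ} (hs : PosType s) {c : ℝ} (hc : 0 ≤ c) :
    PosType (fun k => c * s k) := by
  intro x M
  have := mul_nonneg hc (hs x M)
  rw [Finset.mul_sum] at this
  refine this.trans_eq (Finset.sum_congr rfl fun n _ => ?_)
  rw [Finset.mul_sum, Finset.mul_sum, Finset.mul_sum]
  congr 1; ext; ring

lemma PosType.zero : PosType (fun _ => 0) := by
  intro x M; simp

lemma PosType.sum {ι : Type*} (I : Finset ι) {s : ι → ℕ → ℝ} (hs : ∀ i, PosType (s i)) :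
    PosType (fun k => ∑ i ∈ I, s i k) := by
  classical
  induction I using Finset.induction_on with
  | empty => simpa using PosType.zero
  | insert i I hi ih =>
    simp only [Finset.sum_insert hi]
    exact (hs i).add ih

lemma posType_of_convex {s u : ℕ → ℝ} (hu0 : u 0 = 2 * s 0) (hu : ∀ k, 1 ≤ k → u k = s k)
    (hnn : ∀ k, 0 ≤ u k) (hanti : ∀ k, u (k + 1) ≤ u k)
    (hconv : ∀ k, u (k + 1) - u (k + 2) ≤ u k - u (k + 1)) : PosType s := by
  set D : ℕ → ℕ → ℝ := fun n p => if p = 0 then u n else u (n - p) - u (n - p + 1) with hD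
  have hsum : ∀ n k, k ≤ n → ∑ p ∈ Finset.range (k + 1), D n p = u (n - k) := by
    intro n k
    induction k with
    | zero => simp [hD]
    | succ k ih =>
      intro hk
      rw [Finset.sum_range_succ, ih (by omega)]
      simp only [hD, if_neg (Nat.succ_ne_zero k)]
      rw [show n - (k + 1) + 1 = n - k by omega]
      ring
  apply triangular_form_nonneg (A := fun n k => s (n - k)) (D := D)
  · intro n k hk
    rw [hsum n k hk.le, hu _ (by omega)]
  · intro n
    rw [hsum n n le_rfl, Nat.sub_self, hu0]
  · intro n p hp
    simp only [hD]
    split_ifs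
    · exact hnn n
    · linarith [hanti (n - p)]
  · intro n p hp
    simp only [hD]
    split_ifs
    · exact hanti n
    · rw [show n + 1 - p = n - p + 1 by omega]
      exact hconv _

lemma posType_of_partial_sums {s : ℕ → ℝ} (hs : ∀ k, 1 ≤ k → s k ≤ 0)
    (hsum : ∀ K, 0 ≤ ∑ k ∈ Finset.range (K + 1), s k) : PosType s := by
  intro x M
  have h1 : ∑ n ∈ Finset.range M, ∑ k ∈ Finset.range (n + 1),
      (s (n - k) * (x n ^ 2 / 2) + s (n - k) * (x k ^ 2 / 2)) ≤
      ∑ n ∈ Finset.range M, x n * ∑ k ∈ Finset.range (n + 1), s (n - k) * x k := by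
    apply Finset.sum_le_sum
    intro n _
    rw [Finset.mul_sum]
    apply Finset.sum_le_sum
    intro k hk
    rcases Nat.lt_or_ge k n with h | h
    · have := hs (n - k) (by omega)
      nlinarith [sq_nonneg (x n - x k)]
    · have : k = n := by have := Finset.mem_range.1 hk; omega
      subst this
      apply le_of_eq; ring
  refine le_trans ?_ h1
  simp only [Finset.sum_add_distrib]
  apply add_nonneg
  · apply Finset.sum_nonneg
    intro n _
    rw [← Finset.sum_mul]
    apply mul_nonneg _ (by positivity)
    have := Finset.sum_range_reflect s (n + 1)
    simp only [Nat.add_sub_cancel] at this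
    rw [this]
    exact hsum n
  · rw [sum_range_triangle M (fun n k => s (n - k) * (x k ^ 2 / 2))]
    apply Finset.sum_nonneg
    intro k hk
    rw [← Finset.sum_mul]
    apply mul_nonneg _ (by positivity)
    rw [Finset.sum_Ico_eq_sum_range]
    simp only [Nat.add_sub_cancel_left]
    have hk := Finset.mem_range.1 hk
    rw [show M - k = (M - k - 1) + 1 by omega]
    exact hsum _

/-! ### The forms of the scheme -/

/-- Convolution weights of the discretization of a Caputo derivative of order `1 < γ < 2`. -/
noncomputable def highKer (γ : ℝ) (k : ℕ) : ℝ :=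
  if k = 0 then aHigh γ 0 else aHigh γ k - aHigh γ (k - 1)

lemma sum_highKer (γ : ℝ) (K : ℕ) : ∑ k ∈ Finset.range (K + 1), highKer γ k = aHigh γ K := by
  induction K with
  | zero => simp [highKer]
  | succ K ih => rw [Finset.sum_range_succ, ih, highKer, if_neg (by omega)]; simp

lemma highKer_posType {γ : ℝ} (hγ : γ ∈ Ioo (1 : ℝ) 2) : PosType (highKer γ) := by
  apply posType_of_partial_sums
  · intro k hk
    rw [highKer, if_neg (by omega)]
    linarith [aHigh_antitone hγ hk]
  · intro K
    rw [sum_highKer]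
    exact aHigh_nonneg hγ K

lemma abs_highKer_le {γ : ℝ} (hγ : γ ∈ Ioo (1 : ℝ) 2) (k : ℕ) : |highKer γ k| ≤ 1 := by
  rw [highKer, abs_le]
  have := aHigh_nonneg hγ k
  have := aHigh_le_one hγ k
  have := aHigh_nonneg hγ (k - 1)
  have := aHigh_le_one hγ (k - 1)
  split_ifs with h
  · rw [aHigh_zero hγ]; constructor <;> linarith
  · constructor <;> linarith

lemma omegaLow_posType {α : ℝ} (hα : α ∈ Ioo (0 : ℝ) 1) : PosType (omegaLow α) := by
  have h0 := omegaLow_diff_zero hα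
  have h1 := omegaLow_succ_le hα (k := 1) le_rfl
  apply posType_of_convex (u := fun k => if k = 0 then 2 * omegaLow α 0 else omegaLow α k)
  · simp
  · intro k hk; rw [if_neg (by omega)]
  · intro k
    have := omegaLow_nonneg hα
    split_ifs
    · linarith [this 0]
    · exact this k
  · intro k
    rcases k with _ | k
    · simp; linarith
    · simpa using omegaLow_succ_le hα (k := k + 1) (by omega)
  · intro k
    rcases k with _ | k
    · simpa using h0
    · simpa using omegaLow_diff_antitone hα (k := k + 1) (by omega)

lemma omegaLow_le {α : ℝ} (hα : α ∈ Ioo (0 : ℝ) 1) (k : ℕ) : omegaLow α k ≤ 2 * omegaLow α 0 := by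
  have h0 := omegaLow_diff_zero hα
  have h1 := omegaLow_succ_le hα (k := 1) le_rfl
  induction k with
  | zero => linarith [omegaLow_nonneg hα 0]
  | succ k ih =>
    rcases k with _ | k
    · simp; linarith
    · exact (omegaLow_succ_le hα (k := k + 1) (by omega)).trans ih

lemma abs_omegaLow_le {α : ℝ} (hα : α ∈ Ioo (0 : ℝ) 1) (k : ℕ) :
    |omegaLow α k| ≤ 2 * omegaLow α 0 := by
  rw [abs_of_nonneg (omegaLow_nonneg hα k)]
  exact omegaLow_le hα k

lemma cLow_eq (α : ℝ) {n k : ℕ} (hk : k ≤ n) :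
    cLow α (n + 1) k = omegaLow α k - if k = n then bLow α (n + 1) else 0 := by
  rw [cLow, omegaLow]
  by_cases h0 : n = 0
  · subst h0
    obtain rfl : k = 0 := by omega
    simp
  · rw [if_neg (by omega)]
    by_cases hk0 : k = 0
    · subst hk0
      rw [if_pos rfl, if_pos rfl, if_neg (by omega), sub_zero]
    · rw [if_neg hk0, if_neg hk0]
      by_cases hkn : k = n
      · subst hkn
        simp; ring
      · rw [if_neg (by omega), if_neg hkn, sub_zero]

lemma cLow_form_nonneg {α : ℝ} (hα : α ∈ Ioo (0 : ℝ) 1) (x : ℕ → ℝ) (M : ℕ) :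
    0 ≤ ∑ n ∈ Finset.range M, x n * ∑ k ∈ Finset.range (n + 1), cLow α (n + 1) (n - k) * x k := by
  have h0 := omegaLow_diff_zero hα
  have h1 := aLow_one_sub_bLow_one_le hα
  have hω1 := omegaLow_succ_le hα (k := 1) le_rfl
  set e : ℕ → ℝ := fun m => if m = 0 then 2 * omegaLow α 0 - omegaLow α 1
    else omegaLow α m - omegaLow α (m + 1) with he
  have he_anti : ∀ m, e (m + 1) ≤ e m := by
    intro m
    rcases m with _ | m
    · simpa [he] using h0
    · simpa [he] using omegaLow_diff_antitone hα (k := m + 1) (by omega)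
  have he_nn : ∀ m, 0 ≤ e m := by
    intro m
    rcases m with _ | m
    · simp only [he, if_true]; linarith
    · simpa [he] using omegaLow_succ_le hα (k := m + 1) (by omega)
  set D : ℕ → ℕ → ℝ := fun n p =>
    if p = 0 then (if n = 0 then 2 * aLow α 0 else aLow α n - bLow α n)
    else e (n - p) + (if p = 1 then bLow α (n + 1) else 0) with hD
  have hab : ∀ n, 1 ≤ n → aLow α n - bLow α n = omegaLow α n - bLow α (n + 1) := by
    intro n hn
    rw [omegaLow, if_neg (by omega)]; ring
  have hsum : ∀ n k, 1 ≤ k → k ≤ n → ∑ p ∈ Finset.range (k + 1), D n p =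
      if k = n then 2 * omegaLow α 0 else omegaLow α (n - k) := by
    intro n k hk
    induction k, hk using Nat.le_induction with
    | base =>
      intro hn
      rw [Finset.sum_range_succ, Finset.sum_range_one]
      simp only [hD, if_true, if_neg (show n ≠ 0 by omega), if_neg one_ne_zero, hab n hn, he]
      by_cases h : n = 1
      · subst h; simp
      · rw [if_neg (by omega), if_neg (by omega), show n - 1 + 1 = n by omega]; ring
    | succ k hk ih =>
      intro hn
      rw [Finset.sum_range_succ, ih (by omega), if_neg (by omega)]
      simp only [hD, if_neg (Nat.succ_ne_zero k), if_neg (show k + 1 ≠ 1 by omega), he]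
      by_cases h : k + 1 = n
      · subst h; simp
      · rw [if_neg (by omega), if_neg (by omega), show n - (k + 1) + 1 = n - k by omega]; ring
  apply triangular_form_nonneg (A := fun n k => cLow α (n + 1) (n - k)) (D := D)
  · intro n k hk
    rw [cLow_eq α (Nat.sub_le n k)]
    rcases Nat.eq_zero_or_pos k with rfl | hk0
    · simp [hD, if_neg (show n ≠ 0 by omega), hab n hk]
    · rw [hsum n k hk0 hk.le, if_neg (by omega), if_neg (by omega), sub_zero]
  · intro n
    rw [cLow_eq α (Nat.sub_le n n)]
    rcases Nat.eq_zero_or_pos n with rfl | hn0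
    · simp [hD, omegaLow]
    · rw [hsum n n hn0 le_rfl, if_pos rfl, Nat.sub_self, if_neg (by omega), sub_zero]
  · intro n p hp
    simp only [hD]
    split_ifs with hp0 hn0 hp1
    · have := aLow_nonneg hα 0; linarith
    · exact aLow_sub_bLow_nonneg hα (by omega)
    · exact add_nonneg (he_nn _) (bLow_nonneg hα (by omega))
    · rw [add_zero]; exact he_nn _
  · intro n p hp
    by_cases hp0 : p = 0
    · subst hp0
      simp only [hD, if_true, if_neg (Nat.succ_ne_zero n)]
      split_ifs with hn0
      · subst hn0; simpa using h1
      · exact aLow_sub_bLow_antitone hα (by omega)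
    · simp only [hD, if_neg hp0]
      rw [show n + 1 - p = n - p + 1 by omega]
      apply add_le_add (he_anti _)
      split_ifs
      · exact bLow_antitone hα (by omega)
      · exact le_rfl

/-! ### Energy estimate for one mode -/

lemma energy_estimate {A : ℕ → ℕ → ℝ} {b τ μ : ℝ} (hb : 0 < b) (hτ : 0 < τ)
    (hA : ∀ (x : ℕ → ℝ) (M : ℕ), b * ∑ n ∈ Finset.range M, x n ^ 2 ≤
      ∑ n ∈ Finset.range M, x n * ∑ k ∈ Finset.range (n + 1), A n k * x k)
    {y F : ℕ → ℝ} {N : ℕ} (hy0 : y 0 = 0)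
    (heq : ∀ n < N, ∑ k ∈ Finset.range (n + 1), A n k * ((y (k + 1) - y k) / τ) +
      μ * ((y (n + 1) + y n) / 2) = F n) {M : ℕ} (hM : M ≤ N) :
    μ * y M ^ 2 ≤ 1 / (2 * b) * (τ * ∑ n ∈ Finset.range M, F n ^ 2) := by
  set x : ℕ → ℝ := fun k => (y (k + 1) - y k) / τ with hx
  have hxy : ∀ n, τ * x n = y (n + 1) - y n := by
    intro n; simp only [hx]; field_simp
  have h1 : ∑ n ∈ Finset.range M, x n * F n =
      ∑ n ∈ Finset.range M, x n * ∑ k ∈ Finset.range (n + 1), A n k * x k +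
        ∑ n ∈ Finset.range M, x n * (μ * ((y (n + 1) + y n) / 2)) := by
    rw [← Finset.sum_add_distrib]
    apply Finset.sum_congr rfl
    intro n hn
    rw [← heq n ((Finset.mem_range.1 hn).trans_le hM)]
    ring
  have h2 : τ * ∑ n ∈ Finset.range M, x n * (μ * ((y (n + 1) + y n) / 2)) = μ / 2 * y M ^ 2 := by
    have := Finset.sum_range_sub (fun n => μ / 2 * y n ^ 2) M
    rw [hy0] at this
    rw [Finset.mul_sum, show μ / 2 * y M ^ 2 = μ / 2 * y M ^ 2 - μ / 2 * 0 ^ 2 by ring, ← this]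
    apply Finset.sum_congr rfl
    intro n _
    calc _ = (τ * x n) * (μ * ((y (n + 1) + y n) / 2)) := by ring
      _ = _ := by rw [hxy]; ring
  have h3 : ∑ n ∈ Finset.range M, x n * F n ≤
      b * ∑ n ∈ Finset.range M, x n ^ 2 + 1 / (4 * b) * ∑ n ∈ Finset.range M, F n ^ 2 := by
    rw [Finset.mul_sum, Finset.mul_sum, ← Finset.sum_add_distrib]
    apply Finset.sum_le_sum
    intro n _
    have : b * x n ^ 2 + 1 / (4 * b) * F n ^ 2 - x n * F n = b * (x n - F n / (2 * b)) ^ 2 := by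
      field_simp; ring
    have : 0 ≤ b * (x n - F n / (2 * b)) ^ 2 := by positivity
    linarith
  have h4 : ∑ n ∈ Finset.range M, x n * (μ * ((y (n + 1) + y n) / 2)) ≤
      1 / (4 * b) * ∑ n ∈ Finset.range M, F n ^ 2 := by linarith [hA x M]
  have h5 := mul_le_mul_of_nonneg_left h4 hτ.le
  rw [h2] at h5
  have e : 1 / (2 * b) * (τ * ∑ n ∈ Finset.range M, F n ^ 2) =
      2 * (τ * (1 / (4 * b) * ∑ n ∈ Finset.range M, F n ^ 2)) := by field_simp; ring
  rw [e]; linarith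


/-! ### Generating functions -/

/-- The generating function of a real sequence. -/
noncomputable def gen (s : ℕ → ℝ) (ζ : ℂ) : ℂ := ∑' k, (s k : ℂ) * ζ ^ k

lemma summable_linear_mul_pow {r : ℝ} (hr0 : 0 ≤ r) (hr : r < 1) (C : ℝ) :
    Summable fun k : ℕ => C * ((k : ℝ) + 1) * r ^ k := by
  have h1 := summable_pow_mul_geometric_of_norm_lt_one 1
    (show ‖r‖ < 1 by rwa [Real.norm_eq_abs, abs_of_nonneg hr0])
  have h2 := summable_geometric_of_lt_one hr0 hr
  refine ((h1.add h2).mul_left C).congr fun k => ?_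
  rw [pow_one]; ring

lemma summable_gen {s : ℕ → ℝ} {C : ℝ} (hs : ∀ k, |s k| ≤ C * ((k : ℝ) + 1)) {ζ : ℂ}
    (hζ : ‖ζ‖ < 1) : Summable fun k => ‖(s k : ℂ) * ζ ^ k‖ := by
  refine Summable.of_nonneg_of_le (fun k => norm_nonneg _) (fun k => ?_)
    (summable_linear_mul_pow (norm_nonneg ζ) hζ C)
  rw [norm_mul, norm_pow, Complex.norm_real, Real.norm_eq_abs]
  exact mul_le_mul_of_nonneg_right (hs k) (by positivity)

lemma le_linear_of_bounded {s : ℕ → ℝ} {C : ℝ} (hs : ∀ k, |s k| ≤ C) (k : ℕ) :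
    |s k| ≤ C * ((k : ℝ) + 1) := by
  have h0 : 0 ≤ C := (abs_nonneg _).trans (hs 0)
  have : (0 : ℝ) ≤ k := by positivity
  nlinarith [hs k]

lemma gen_mul {s t : ℕ → ℝ} {C C' : ℝ} (hs : ∀ k, |s k| ≤ C * ((k : ℝ) + 1))
    (ht : ∀ k, |t k| ≤ C' * ((k : ℝ) + 1)) {ζ : ℂ} (hζ : ‖ζ‖ < 1) :
    gen s ζ * gen t ζ = gen (fun n => ∑ k ∈ Finset.range (n + 1), s k * t (n - k)) ζ := by
  rw [gen, gen, tsum_mul_tsum_eq_tsum_sum_range_of_summable_norm (summable_gen hs hζ)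
    (summable_gen ht hζ), gen]
  congr 1
  ext n
  push_cast
  rw [Finset.sum_mul]
  apply Finset.sum_congr rfl
  intro k hk
  have : k + (n - k) = n := by have := Finset.mem_range.1 hk; omega
  calc _ = (s k : ℂ) * t (n - k) * (ζ ^ k * ζ ^ (n - k)) := by ring
    _ = _ := by rw [← pow_add, this]

lemma PosType.re_gen_nonneg {t : ℕ → ℝ} (hp : PosType t) {C : ℝ} (ht : ∀ k, |t k| ≤ C) {ζ : ℂ}
    (hζ : ‖ζ‖ < 1) : 0 ≤ (gen t ζ).re := by
  have hq : ‖ζ‖ ^ 2 < 1 := by nlinarith [norm_nonneg ζ]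
  have hs1 := summable_gen (le_linear_of_bounded ht) hζ
  have hg : Summable fun k : ℕ => ‖(((‖ζ‖ ^ 2) ^ k : ℝ) : ℂ)‖ := by
    simp only [Complex.norm_real, norm_pow, norm_norm]
    exact summable_geometric_of_lt_one (by positivity) hq
  have hmul := tsum_mul_tsum_eq_tsum_sum_range_of_summable_norm hg hs1
  have hsum := (summable_norm_sum_mul_range_of_summable_norm hg hs1).of_norm
  have hre := hsum.hasSum
  rw [← hmul, Complex.hasSum_iff] at hre
  have h1 := hre.1
  have hgeo : (∑' k : ℕ, (((‖ζ‖ ^ 2) ^ k : ℝ) : ℂ)) = ((1 - ‖ζ‖ ^ 2)⁻¹ : ℝ) := by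
    rw [← Complex.ofReal_tsum, tsum_geometric_of_lt_one (by positivity) hq]
  rw [hgeo, Complex.re_ofReal_mul] at h1
  have hpos : ∀ M, 0 ≤ ∑ n ∈ Finset.range M, (∑ k ∈ Finset.range (n + 1),
      (((‖ζ‖ ^ 2) ^ k : ℝ) : ℂ) * ((t (n - k) : ℂ) * ζ ^ (n - k))).re := by
    intro M
    have h := add_nonneg (hp (fun k => (ζ ^ k).re) M) (hp (fun k => (ζ ^ k).im) M)
    rw [← Finset.sum_add_distrib] at h
    refine h.trans_eq (Finset.sum_congr rfl fun n _ => ?_)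
    rw [Complex.re_sum, Finset.mul_sum, Finset.mul_sum, ← Finset.sum_add_distrib]
    apply Finset.sum_congr rfl
    intro k hk
    have hkn : n = (n - k) + k := by have := Finset.mem_range.1 hk; omega
    have e : (ζ ^ n).re * (ζ ^ k).re + (ζ ^ n).im * (ζ ^ k).im =
        (‖ζ‖ ^ 2) ^ k * (ζ ^ (n - k)).re := by
      conv_lhs => rw [hkn, pow_add]
      have h2 : (‖ζ‖ ^ 2) ^ k = (ζ ^ k).re * (ζ ^ k).re + (ζ ^ k).im * (ζ ^ k).im := by
        rw [← pow_mul, mul_comm 2 k, pow_mul, ← norm_pow, ← Complex.normSq_eq_norm_sq,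
          Complex.normSq_apply]
      rw [h2, Complex.mul_re, Complex.mul_im]
      ring
    rw [Complex.re_ofReal_mul, Complex.re_ofReal_mul]
    linear_combination t (n - k) * e
  have h2 := ge_of_tendsto' h1.tendsto_sum_nat hpos
  have h3 : 0 < (1 - ‖ζ‖ ^ 2)⁻¹ := inv_pos.2 (by linarith)
  exact nonneg_of_mul_nonneg_right h2 h3

lemma norm_one_sub_pos {ζ : ℂ} (hζ : ‖ζ‖ < 1) : 0 < ‖1 - ζ‖ := by
  rw [norm_pos_iff, sub_ne_zero]
  rintro rfl
  simp at hζ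

/-- The symbol of the discretized Caputo derivative of order `γ` has real part at least of the
size of `|1 - ζ| ^ (γ - 1)`. -/
lemma exists_le_re_gen_highKer {γ : ℝ} (hγ : γ ∈ Ioo (1 : ℝ) 2) :
    ∃ c > 0, ∀ ζ : ℂ, ‖ζ‖ < 1 → c * ‖1 - ζ‖ ^ (γ - 1) ≤ (gen (highKer γ) ζ).re := by
  have hpδ : 0 < (2 - γ) * (γ - 1) := mul_pos (by linarith [hγ.2]) (by linarith [hγ.1])
  refine ⟨(2 - γ) * (γ - 1) * 2 ^ (-γ) * (1 / 2) * 6 ^ (1 - γ), by positivity, ?_⟩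
  intro ζ hζ
  set w := ‖1 - ζ‖ with hw
  have hw0 : 0 < w := norm_one_sub_pos hζ
  have hw2 : w ≤ 2 := by
    have := norm_sub_le (1 : ℂ) ζ
    rw [norm_one] at this
    linarith
  set M := ⌈4 / w⌉₊ with hM
  have hM1 : 4 / w ≤ M := Nat.le_ceil _
  have hM0 : 0 < M := Nat.ceil_pos.2 (by positivity)
  have hMR : (0 : ℝ) < M := by exact_mod_cast hM0
  have hM2 : (M : ℝ) ≤ 6 / w := by
    have h1 : (M : ℝ) < 4 / w + 1 := Nat.ceil_lt_add_one (by positivity)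
    have h2 : 1 ≤ 2 / w := by rw [le_div_iff₀ hw0]; linarith
    have : (6 : ℝ) / w = 4 / w + 2 / w := by ring
    linarith
  -- partial sums are bounded below by a block of terms
  have hpart : ∀ K, ∑ k ∈ Finset.range (K + 1), highKer γ k * (ζ ^ k).re =
      aHigh γ K + ∑ k ∈ Finset.Ico 1 (K + 1), (aHigh γ (k - 1) - aHigh γ k) * (1 - (ζ ^ k).re) := by
    intro K
    induction K with
    | zero => simp [highKer]
    | succ K ih =>
      rw [Finset.sum_range_succ, ih, Finset.sum_Ico_succ_top (show 1 ≤ K + 1 by omega), highKer,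
        if_neg (by omega)]
      simp only [Nat.add_sub_cancel]
      ring
  have hterm : ∀ k, 0 ≤ 1 - (ζ ^ k).re := by
    intro k
    have h1 := Complex.re_le_norm (ζ ^ k)
    rw [norm_pow] at h1
    have := pow_le_one₀ (norm_nonneg ζ) hζ.le (n := k)
    linarith
  have hblock : (2 - γ) * (γ - 1) * (2 * M : ℝ) ^ (-γ) * (M / 2) ≤
      ∑ k ∈ Finset.Ico M (2 * M), (aHigh γ (k - 1) - aHigh γ k) * (1 - (ζ ^ k).re) := by
    have h1 : (M : ℝ) / 2 ≤ ∑ k ∈ Finset.Ico M (2 * M), (1 - (ζ ^ k).re) := by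
      rw [Finset.sum_sub_distrib, ← Complex.re_sum, geom_sum_Ico (by rintro rfl; simp at hζ)
        (by omega)]
      have hre := Complex.re_le_norm ((ζ ^ (2 * M) - ζ ^ M) / (ζ - 1))
      have hn : ‖(ζ ^ (2 * M) - ζ ^ M) / (ζ - 1)‖ ≤ 2 / w := by
        rw [norm_div, norm_sub_rev ζ 1]
        apply div_le_div_of_nonneg_right _ hw0.le
        refine (norm_sub_le _ _).trans ?_
        rw [norm_pow, norm_pow]
        have h1 := pow_le_one₀ (norm_nonneg ζ) hζ.le (n := 2 * M)
        have h2 := pow_le_one₀ (norm_nonneg ζ) hζ.le (n := M)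
        linarith
      have h4 : (2 : ℝ) / w = 4 / w / 2 := by ring
      simp only [Finset.sum_const, Nat.card_Ico, nsmul_eq_mul, mul_one]
      rw [show 2 * M - M = M by omega]
      linarith
    calc _ ≤ (2 - γ) * (γ - 1) * (2 * M : ℝ) ^ (-γ) * ∑ k ∈ Finset.Ico M (2 * M), (1 - (ζ ^ k).re) :=
          mul_le_mul_of_nonneg_left h1 (by positivity)
      _ ≤ _ := by
          rw [Finset.mul_sum]
          apply Finset.sum_le_sum
          intro k hk
          rw [Finset.mem_Ico] at hk
          apply mul_le_mul_of_nonneg_right _ (hterm k)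
          refine le_trans ?_ (le_aHigh_sub hγ (k := k) (by omega))
          apply mul_le_mul_of_nonneg_left _ hpδ.le
          apply rpow_neg_le_of_le (by linarith [hγ.1]) (by positivity)
          have : k + 1 ≤ 2 * M := by omega
          exact_mod_cast this
  have hsummable := (summable_gen (le_linear_of_bounded (abs_highKer_le hγ)) hζ).of_norm
  have hre := (Complex.hasSum_iff _ _).1 hsummable.hasSum
  have h1 := hre.1
  simp only [Complex.re_ofReal_mul] at h1
  have hfin : (2 - γ) * (γ - 1) * (2 * M : ℝ) ^ (-γ) * (M / 2) ≤ (gen (highKer γ) ζ).re := by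
    apply ge_of_tendsto h1.tendsto_sum_nat
    filter_upwards [Filter.eventually_ge_atTop (2 * M)] with K hK
    obtain ⟨K, rfl⟩ : ∃ j, K = j + 1 := ⟨K - 1, by omega⟩
    rw [hpart K]
    have h2 : ∑ k ∈ Finset.Ico M (2 * M), (aHigh γ (k - 1) - aHigh γ k) * (1 - (ζ ^ k).re) ≤
        ∑ k ∈ Finset.Ico 1 (K + 1), (aHigh γ (k - 1) - aHigh γ k) * (1 - (ζ ^ k).re) := by
      apply Finset.sum_le_sum_of_subset_of_nonneg
      · exact Finset.Ico_subset_Ico hM0 hK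
      · intro k hk _
        exact mul_nonneg (by linarith [aHigh_antitone hγ (Finset.mem_Ico.1 hk).1]) (hterm k)
    linarith [aHigh_nonneg hγ K]
  refine le_trans ?_ hfin
  have e1 : (2 * M : ℝ) ^ (-γ) * (M / 2) = 2 ^ (-γ) * (1 / 2) * (M : ℝ) ^ (1 - γ) := by
    rw [Real.mul_rpow (by norm_num) hMR.le, show (1 - γ) = -γ + 1 by ring, Real.rpow_add hMR,
      Real.rpow_one]
    ring
  have e2 : (6 : ℝ) ^ (1 - γ) * w ^ (γ - 1) = (6 / w) ^ (1 - γ) := by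
    rw [Real.div_rpow (by norm_num) hw0.le, show (γ - 1) = -(1 - γ) by ring, Real.rpow_neg hw0.le]
    rfl
  have e3 : (6 / w) ^ (1 - γ) ≤ (M : ℝ) ^ (1 - γ) :=
    Real.rpow_le_rpow_of_nonpos hMR hM2 (by linarith [hγ.1])
  calc _ = (2 - γ) * (γ - 1) * (2 ^ (-γ) * (1 / 2)) * ((6 : ℝ) ^ (1 - γ) * w ^ (γ - 1)) := by ring
    _ ≤ (2 - γ) * (γ - 1) * (2 ^ (-γ) * (1 / 2)) * (M : ℝ) ^ (1 - γ) := by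
        rw [e2]; exact mul_le_mul_of_nonneg_left e3 (by positivity)
    _ = _ := by rw [mul_assoc _ _ ((M : ℝ) / 2), e1]; ring

/-! ### Coefficients from boundary values -/

lemma integral_exp_int_mul (m : ℤ) :
    ∫ θ in (-Real.pi)..Real.pi, Complex.exp ((m : ℂ) * Complex.I * θ) =
      if m = 0 then 2 * (Real.pi : ℂ) else 0 := by
  split_ifs with h
  · subst h
    simp
    ring
  · rw [integral_exp_mul_complex (mul_ne_zero (by exact_mod_cast h) Complex.I_ne_zero)]
    have : Complex.exp ((m : ℂ) * Complex.I * (Real.pi : ℝ)) =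
        Complex.exp ((m : ℂ) * Complex.I * ((-Real.pi : ℝ) : ℂ)) := by
      rw [Complex.exp_eq_exp_iff_exists_int]
      exact ⟨m, by push_cast; ring⟩
    rw [this, sub_self, zero_div]

lemma abs_coeff_mul_pow_le {κ : ℕ → ℝ} {C : ℝ} (hκ : ∀ k, |κ k| ≤ C * ((k : ℝ) + 1)) {r : ℝ}
    (hr0 : 0 < r) (hr : r < 1) {G : ℝ → ℝ}
    (hG : IntervalIntegrable G MeasureTheory.volume (-Real.pi) Real.pi)
    (hle : ∀ θ ∈ Icc (-Real.pi) Real.pi, ‖gen κ (r * Complex.exp (θ * Complex.I))‖ ≤ G θ) (n : ℕ) :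
    2 * Real.pi * (|κ n| * r ^ n) ≤ ∫ θ in (-Real.pi)..Real.pi, G θ := by
  have hpi := Real.pi_pos
  set ζ : ℝ → ℂ := fun θ => r * Complex.exp (θ * Complex.I) with hζ
  have hnorm : ∀ θ, ‖ζ θ‖ = r := by
    intro θ
    simp only [hζ]
    rw [norm_mul, Complex.norm_exp_ofReal_mul_I, mul_one, Complex.norm_real, Real.norm_eq_abs,
      abs_of_pos hr0]
  have hcont : Continuous ζ := by fun_prop
  set E : ℝ → ℂ := fun θ => Complex.exp (-(n : ℂ) * Complex.I * θ) with hE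
  have hEc : Continuous E := by fun_prop
  have hEn : ∀ θ, ‖E θ‖ = 1 := by
    intro θ
    simp only [hE]
    rw [show -(n : ℂ) * Complex.I * θ = ((-(n : ℝ) * θ : ℝ) : ℂ) * Complex.I by push_cast; ring,
      Complex.norm_exp_ofReal_mul_I]
  have hterm : ∀ k θ, (κ k : ℂ) * ζ θ ^ k * E θ =
      (κ k * r ^ k : ℂ) * Complex.exp ((((k : ℤ) - (n : ℤ) : ℤ) : ℂ) * Complex.I * θ) := by
    intro k θ
    simp only [hζ, hE]
    rw [mul_pow, ← Complex.exp_nat_mul]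
    rw [show (κ k : ℂ) * (r ^ k * Complex.exp (k * (θ * Complex.I))) *
      Complex.exp (-(n : ℂ) * Complex.I * θ) = (κ k * r ^ k : ℂ) *
        (Complex.exp (k * (θ * Complex.I)) * Complex.exp (-(n : ℂ) * Complex.I * θ)) by ring,
      ← Complex.exp_add]
    congr 2
    push_cast; ring
  have hS := intervalIntegral.hasSum_integral_of_dominated_convergence (a := -Real.pi)
    (b := Real.pi) (μ := MeasureTheory.volume)
    (F := fun (k : ℕ) (θ : ℝ) => (κ k : ℂ) * ζ θ ^ k * E θ) (f := fun θ => gen κ (ζ θ) * E θ)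
    (fun k _ => C * ((k : ℝ) + 1) * r ^ k)
    (fun k => (Continuous.aestronglyMeasurable (by fun_prop)))
    (fun k => Filter.Eventually.of_forall fun θ _ => by
      rw [norm_mul, norm_mul, hEn, mul_one, norm_pow, hnorm, Complex.norm_real, Real.norm_eq_abs]
      exact mul_le_mul_of_nonneg_right (hκ k) (by positivity))
    (Filter.Eventually.of_forall fun θ _ => summable_linear_mul_pow hr0.le hr C)
    intervalIntegrable_const
    (Filter.Eventually.of_forall fun θ _ =>
      ((summable_gen hκ (by rw [hnorm]; exact hr)).of_norm.hasSum).mul_right (E θ))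
  have hI : ∀ k : ℕ, ∫ θ in (-Real.pi)..Real.pi, (κ k : ℂ) * ζ θ ^ k * E θ =
      if k = n then (κ n * r ^ n : ℂ) * (2 * Real.pi) else 0 := by
    intro k
    simp_rw [hterm k]
    rw [intervalIntegral.integral_const_mul, integral_exp_int_mul]
    by_cases h : k = n
    · subst h; simp
    · rw [if_neg (by omega), if_neg h, mul_zero]
  simp_rw [hI] at hS
  have heq := hS.unique (hasSum_ite_eq n ((κ n * r ^ n : ℂ) * (2 * Real.pi)))
  have hn : ‖∫ θ in (-Real.pi)..Real.pi, gen κ (ζ θ) * E θ‖ ≤ ∫ θ in (-Real.pi)..Real.pi, G θ := by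
    apply intervalIntegral.norm_integral_le_of_norm_le (by linarith) _ hG
    refine Filter.Eventually.of_forall fun θ hθ => ?_
    rw [norm_mul, hEn, mul_one]
    exact hle θ ⟨hθ.1.le, hθ.2⟩
  rw [heq] at hn
  refine le_trans (le_of_eq ?_) hn
  rw [norm_mul, norm_mul, norm_pow, Complex.norm_real, Complex.norm_real, norm_mul,
    Complex.norm_real, Real.norm_eq_abs, Real.norm_eq_abs, Real.norm_eq_abs, abs_of_pos hr0,
    abs_of_pos hpi]
  norm_num
  ring

lemma le_norm_one_sub_circle {r θ : ℝ} (hr1 : 1 / 2 ≤ r)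
    (hθ : θ ∈ Icc (-Real.pi) Real.pi) :
    (1 - r + |θ| / 4) / 2 ≤ ‖1 - r * Complex.exp (θ * Complex.I)‖ := by
  have hpi := Real.pi_pos
  have hsq : ‖1 - r * Complex.exp (θ * Complex.I)‖ ^ 2 = (1 - r) ^ 2 + 4 * r * Real.sin (θ / 2) ^ 2 := by
    rw [← Complex.normSq_eq_norm_sq, Complex.exp_mul_I, Complex.normSq_apply]
    simp only [Complex.sub_re, Complex.sub_im, Complex.one_re, Complex.one_im, Complex.mul_re,
      Complex.mul_im, Complex.add_re, Complex.add_im, Complex.ofReal_re, Complex.ofReal_im,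
      Complex.I_re, Complex.I_im, Complex.cos_ofReal_re, Complex.cos_ofReal_im,
      Complex.sin_ofReal_re, Complex.sin_ofReal_im]
    have h1 := Real.sin_sq_add_cos_sq θ
    have h2 : Real.cos θ = 1 - 2 * Real.sin (θ / 2) ^ 2 := by
      have := Real.cos_two_mul' (θ / 2)
      rw [show 2 * (θ / 2) = θ by ring] at this
      have h3 := Real.sin_sq_add_cos_sq (θ / 2)
      linarith
    ring_nf
    ring_nf at h1 h2
    nlinarith
  have hsin : (|θ| / Real.pi) ^ 2 ≤ Real.sin (θ / 2) ^ 2 := by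
    have h1 : |Real.sin (θ / 2)| = Real.sin (|θ| / 2) := by
      rcases le_total 0 θ with h | h
      · rw [abs_of_nonneg h, abs_of_nonneg]
        exact Real.sin_nonneg_of_nonneg_of_le_pi (by linarith) (by linarith [hθ.2])
      · rw [abs_of_nonpos h, neg_div, Real.sin_neg, abs_of_nonpos]
        exact Real.sin_nonpos_of_nonpos_of_neg_pi_le (by linarith) (by linarith [hθ.1])
    have hab : |θ| ≤ Real.pi := abs_le.2 hθ
    have h2 := Real.mul_le_sin (x := |θ| / 2) (by positivity) (by linarith)
    rw [← sq_abs (Real.sin (θ / 2)), h1]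
    apply pow_le_pow_left₀ (by positivity)
    calc |θ| / Real.pi = 2 / Real.pi * (|θ| / 2) := by ring
      _ ≤ _ := h2
  have h4 : |θ| / 4 ≤ |θ| / Real.pi := by
    apply div_le_div_of_nonneg_left (abs_nonneg θ) hpi Real.pi_le_four
  have h5 : (|θ| / 4) ^ 2 ≤ (|θ| / Real.pi) ^ 2 := pow_le_pow_left₀ (by positivity) h4 2
  apply le_of_sq_le_sq _ (norm_nonneg _)
  rw [hsq]
  have h6 : Real.sin (θ / 2) ^ 2 ≤ 4 * r * Real.sin (θ / 2) ^ 2 := by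
    nlinarith [sq_nonneg (Real.sin (θ / 2))]
  nlinarith [sq_nonneg (1 - r - |θ| / 4)]

lemma integral_inv_rpow_le {γ η : ℝ} (hγ : 1 < γ) (hη : 0 < η) :
    IntervalIntegrable (fun θ : ℝ => ((η + |θ| / 4) / 2) ^ (-γ)) MeasureTheory.volume
      (-Real.pi) Real.pi ∧
    ∫ θ in (-Real.pi)..Real.pi, ((η + |θ| / 4) / 2) ^ (-γ) ≤
      2 ^ (γ + 3) / (γ - 1) * η ^ (1 - γ) := by
  have hcont : Continuous fun θ : ℝ => ((η + |θ| / 4) / 2) ^ (-γ) := by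
    apply Continuous.rpow_const (by fun_prop)
    intro θ
    left
    positivity
  refine ⟨hcont.intervalIntegrable _ _, ?_⟩
  have hpi := Real.pi_pos
  have hsplit := intervalIntegral.integral_add_adjacent_intervals (a := -Real.pi) (b := 0)
    (c := Real.pi) (hcont.intervalIntegrable (μ := MeasureTheory.volume) _ _)
    (hcont.intervalIntegrable _ _)
  have hneg := intervalIntegral.integral_comp_neg (a := 0) (b := Real.pi)
    (fun θ : ℝ => ((η + |θ| / 4) / 2) ^ (-γ))
  simp only [abs_neg, neg_zero] at hneg
  rw [← hsplit, ← hneg]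
  have hI : ∫ θ in (0 : ℝ)..Real.pi, ((η + |θ| / 4) / 2) ^ (-γ) =
      -(2 ^ (γ + 2) / (γ - 1)) * (η + Real.pi / 4) ^ (1 - γ) -
      -(2 ^ (γ + 2) / (γ - 1)) * (η + 0 / 4) ^ (1 - γ) := by
    apply intervalIntegral.integral_eq_sub_of_hasDerivAt
      (f := fun θ => -(2 ^ (γ + 2) / (γ - 1)) * (η + θ / 4) ^ (1 - γ))
    · intro θ hθ
      rw [uIcc_of_le hpi.le] at hθ
      have hp : 0 < η + θ / 4 := by linarith [hθ.1]
      have h1 : HasDerivAt (fun θ : ℝ => η + θ / 4) (1 / 4) θ :=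
        ((hasDerivAt_id θ).div_const 4).const_add η
      refine ((h1.rpow_const (p := 1 - γ) (Or.inl hp.ne')).const_mul _).congr_deriv ?_
      rw [abs_of_nonneg hθ.1, Real.div_rpow hp.le (by norm_num), Real.rpow_neg (by norm_num : (0:ℝ) ≤ 2),
        show 1 - γ - 1 = -γ by ring, Real.rpow_add (by norm_num : (0:ℝ) < 2)]
      have : γ - 1 ≠ 0 := by linarith
      norm_num
      field_simp
      ring
    · exact hcont.intervalIntegrable _ _
  rw [hI]
  have h1 : 0 ≤ 2 ^ (γ + 2) / (γ - 1) * (η + Real.pi / 4) ^ (1 - γ) :=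
    mul_nonneg (div_nonneg (by positivity) (by linarith)) (by positivity)
  have h2 : (2 : ℝ) ^ (γ + 3) = 2 * 2 ^ (γ + 2) := by
    rw [show γ + 3 = 1 + (γ + 2) by ring, Real.rpow_add (by norm_num), Real.rpow_one]
  rw [h2, zero_div, add_zero, mul_div_assoc]
  nlinarith


/-! ### Impulse response of the scheme -/

lemma coeff_mk_mul (f g : ℕ → ℝ) (n : ℕ) :
    PowerSeries.coeff n (PowerSeries.mk f * PowerSeries.mk g) =
      ∑ k ∈ Finset.range (n + 1), f k * g (n - k) := by
  rw [PowerSeries.coeff_mul]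
  simp only [PowerSeries.coeff_mk]
  exact Finset.Nat.sum_antidiagonal_eq_sum_range_succ (fun i j => f i * g j) n

lemma coeff_mk_mul' (f g : ℕ → ℝ) (n : ℕ) :
    PowerSeries.coeff n (PowerSeries.mk f * PowerSeries.mk g) =
      ∑ k ∈ Finset.range (n + 1), f (n - k) * g k := by
  rw [mul_comm, coeff_mk_mul]
  exact Finset.sum_congr rfl fun k _ => mul_comm _ _

lemma one_add_inv_pow_le {N n : ℕ} (hn : n ≤ N) : (1 + 1 / (N : ℝ)) ^ n ≤ 3 := by
  rcases Nat.eq_zero_or_pos N with rfl | hN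
  · obtain rfl : n = 0 := by omega
    norm_num
  have hN' : (0 : ℝ) < N := by exact_mod_cast hN
  calc (1 + 1 / (N : ℝ)) ^ n ≤ (1 + 1 / (N : ℝ)) ^ N :=
        pow_le_pow_right₀ (by have : 0 < 1 / (N : ℝ) := by positivity
                              linarith) hn
    _ ≤ (Real.exp (1 / N)) ^ N := by
        apply pow_le_pow_left₀ (by positivity)
        linarith [Real.add_one_le_exp (1 / (N : ℝ))]
    _ = Real.exp 1 := by
        rw [← Real.exp_nat_mul]
        congr 1; field_simp
    _ ≤ 3 := by linarith [Real.exp_one_lt_d9]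

/-- Partial sums of the solution of a convolution equation whose weights dominate those of the
discretized Caputo derivative are bounded by the `ℓ¹` norm of the source. -/
theorem impulse_bound {γ : ℝ} (hγ : γ ∈ Ioo (1 : ℝ) 2) :
    ∃ C > 0, ∀ (c₀ b B : ℝ) (t : ℕ → ℝ), 0 < c₀ → 0 < b → (∀ k, |t k| ≤ B) →
      (∀ (x : ℕ → ℝ) (M : ℕ), b * ∑ n ∈ Finset.range M, x n ^ 2 ≤
        ∑ n ∈ Finset.range M, x n * ∑ k ∈ Finset.range (n + 1), t (n - k) * x k) →
      ∀ (x : ℕ → ℝ) (n N : ℕ), n < N →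
        |∑ k ∈ Finset.range (n + 1), x k| ≤ C / c₀ * (N : ℝ) ^ (γ - 1) *
          ∑ k ∈ Finset.range (n + 1),
            |∑ j ∈ Finset.range (k + 1), (c₀ * highKer γ (k - j) + t (k - j)) * x j| := by
  obtain ⟨c, hc0, hc⟩ := exists_le_re_gen_highKer hγ
  have hγ1 : 0 < γ - 1 := by linarith [hγ.1]
  refine ⟨2 ^ (γ + 3) / (γ - 1) / c * 2 ^ (γ - 1) * 3, by positivity, ?_⟩
  intro c₀ b B t hc₀ hb htB hcoer x n N hnN
  have htpos : PosType t := fun x M => le_trans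
    (mul_nonneg hb.le (Finset.sum_nonneg fun _ _ => sq_nonneg _)) (hcoer x M)
  set s : ℕ → ℝ := fun k => c₀ * highKer γ k + t k with hs
  have hsB : ∀ k, |s k| ≤ c₀ + B := by
    intro k
    refine (abs_add_le _ _).trans (add_le_add ?_ (htB k))
    rw [abs_mul, abs_of_pos hc₀]
    have := abs_highKer_le hγ k
    nlinarith
  have hscoer : ∀ (x : ℕ → ℝ) (M : ℕ), b * ∑ n ∈ Finset.range M, x n ^ 2 ≤
      ∑ n ∈ Finset.range M, x n * ∑ k ∈ Finset.range (n + 1), s (n - k) * x k := by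
    intro x M
    have h1 := ((highKer_posType hγ).const_mul hc₀.le) x M
    have h2 := add_le_add h1 (hcoer x M)
    rw [zero_add] at h2
    refine h2.trans_eq ?_
    rw [← Finset.sum_add_distrib]
    apply Finset.sum_congr rfl
    intro n _
    rw [← mul_add, ← Finset.sum_add_distrib]
    congr 2
    ext k
    simp only [hs]; ring
  have hs0 : 0 < s 0 := by
    have := hscoer (fun _ => 1) 1
    simp at this
    linarith
  have hcc : PowerSeries.constantCoeff (PowerSeries.mk s) ≠ 0 := by
    simpa using hs0.ne'
  have hinv := PowerSeries.mul_inv_cancel _ hcc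
  obtain ⟨K, hK⟩ : ∃ K : ℕ → ℝ, (PowerSeries.mk s)⁻¹ = PowerSeries.mk K :=
    ⟨fun n => PowerSeries.coeff n (PowerSeries.mk s)⁻¹, by ext n; simp⟩
  rw [hK] at hinv
  have hKs : ∀ n, ∑ k ∈ Finset.range (n + 1), s (n - k) * K k = if n = 0 then 1 else 0 := by
    intro n
    rw [← coeff_mk_mul', hinv, PowerSeries.coeff_one]
  -- the impulse response is bounded
  have hKsq : ∀ n, b * K n ^ 2 ≤ |K 0| := by
    intro n
    have h1 := hscoer K (n + 1)
    simp_rw [hKs] at h1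
    have h2 : ∑ m ∈ Finset.range (n + 1), K m * (if m = 0 then (1 : ℝ) else 0) = K 0 := by
      simp
    rw [h2] at h1
    have h3 : K n ^ 2 ≤ ∑ m ∈ Finset.range (n + 1), K m ^ 2 :=
      Finset.single_le_sum (f := fun m => K m ^ 2) (fun _ _ => sq_nonneg _) (by simp)
    have := mul_le_mul_of_nonneg_left h3 hb.le
    linarith [le_abs_self (K 0)]
  have hKB : ∀ n, |K n| ≤ |K 0| / b + 1 := by
    intro n
    have h1 : K n ^ 2 ≤ |K 0| / b := by rw [le_div_iff₀ hb]; linarith [hKsq n]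
    rw [← sq_abs] at h1
    nlinarith [sq_nonneg (|K n| - 1), abs_nonneg (K n)]
  set κ : ℕ → ℝ := fun n => ∑ k ∈ Finset.range (n + 1), K k with hκ
  have hκB : ∀ n, |κ n| ≤ (|K 0| / b + 1) * ((n : ℝ) + 1) := by
    intro n
    refine (Finset.abs_sum_le_sum_abs _ _).trans ((Finset.sum_le_sum fun k _ => hKB k).trans_eq ?_)
    simp; ring
  have hκser : PowerSeries.mk κ = PowerSeries.mk K * PowerSeries.mk (fun _ => (1 : ℝ)) := by
    ext n
    rw [coeff_mk_mul, PowerSeries.coeff_mk]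
    simp [hκ]
  -- generating function of the summed impulse response
  have hgenκ : ∀ ζ : ℂ, ‖ζ‖ < 1 → ‖gen κ ζ‖ ≤ 1 / (c₀ * c) * ‖1 - ζ‖ ^ (-γ) := by
    intro ζ hζ
    have hw := norm_one_sub_pos hζ
    have h1 : gen K ζ * gen s ζ = 1 := by
      rw [gen_mul (le_linear_of_bounded hKB) (le_linear_of_bounded hsB) hζ]
      have : (fun n => ∑ k ∈ Finset.range (n + 1), K k * s (n - k)) =
          fun n => if n = 0 then (1 : ℝ) else 0 := by
        ext n
        rw [← hKs n]
        exact Finset.sum_congr rfl fun k _ => mul_comm _ _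
      rw [this, gen, tsum_eq_single 0 (by intro k hk; simp [hk])]
      simp
    have h2 : gen κ ζ = gen K ζ * (1 - ζ)⁻¹ := by
      have hone : gen (fun _ => (1 : ℝ)) ζ = (1 - ζ)⁻¹ := by
        simp only [gen, Complex.ofReal_one, one_mul]
        exact tsum_geometric_of_norm_lt_one hζ
      rw [← hone, gen_mul (t := fun _ => (1 : ℝ)) (C' := 1) (le_linear_of_bounded hKB)
        (le_linear_of_bounded (by simp)) hζ]
      congr 1
      ext n
      simp [hκ]
    have h3 : c₀ * (c * ‖1 - ζ‖ ^ (γ - 1)) ≤ ‖gen s ζ‖ := by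
      refine le_trans ?_ (Complex.re_le_norm _)
      have e : gen s ζ = c₀ * gen (highKer γ) ζ + gen t ζ := by
        simp only [gen, hs]
        rw [← tsum_mul_left, ← Summable.tsum_add]
        · congr 1; ext k; push_cast; ring
        · exact ((summable_gen (le_linear_of_bounded (abs_highKer_le hγ)) hζ).of_norm).mul_left _
        · exact (summable_gen (le_linear_of_bounded htB) hζ).of_norm
      rw [e, Complex.add_re, Complex.re_ofReal_mul]
      have := htpos.re_gen_nonneg htB hζ
      have := mul_le_mul_of_nonneg_left (hc ζ hζ) hc₀.le
      linarith
    have hpw : 0 < ‖1 - ζ‖ ^ (γ - 1) := Real.rpow_pos_of_pos hw _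
    have hgs : 0 < ‖gen s ζ‖ := lt_of_lt_of_le (by positivity) h3
    have h4 : ‖gen K ζ‖ = 1 / ‖gen s ζ‖ := by
      rw [eq_div_iff hgs.ne', ← norm_mul, h1, norm_one]
    rw [h2, norm_mul, norm_inv, h4, show -γ = -(γ - 1) + -1 by ring, Real.rpow_add hw,
      Real.rpow_neg hw.le, Real.rpow_neg_one, ← mul_assoc]
    apply mul_le_mul_of_nonneg_right _ (by positivity)
    calc 1 / ‖gen s ζ‖ ≤ 1 / (c₀ * (c * ‖1 - ζ‖ ^ (γ - 1))) :=
          one_div_le_one_div_of_le (by positivity) h3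
      _ = _ := by field_simp
  have hN0 : 0 < N := by omega
  have hNR : (0 : ℝ) < N := by exact_mod_cast hN0
  have hN1 : (1 : ℝ) ≤ N := by exact_mod_cast hN0
  have hκfin : ∀ m ≤ n, |κ m| ≤ 2 ^ (γ + 3) / (γ - 1) / c * 2 ^ (γ - 1) * 3 / c₀ *
      (N : ℝ) ^ (γ - 1) := by
    intro m hm
    set r : ℝ := N / (N + 1) with hr
    have hr0 : 0 < r := by positivity
    have hr1 : r < 1 := by rw [hr, div_lt_one (by positivity)]; linarith
    have hrh : 1 / 2 ≤ r := by rw [hr, div_le_div_iff₀ (by norm_num) (by positivity)]; linarith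
    have hη : 1 - r = 1 / (N + 1) := by rw [hr]; field_simp; ring
    have hη0 : 0 < 1 - r := by linarith
    obtain ⟨hint, hle⟩ := integral_inv_rpow_le hγ.1 hη0
    have hco := abs_coeff_mul_pow_le hκB hr0 hr1
      (G := fun θ => 1 / (c₀ * c) * ((1 - r + |θ| / 4) / 2) ^ (-γ)) (hint.const_mul _) (by
        intro θ hθ
        have hn : ‖(r : ℂ) * Complex.exp (θ * Complex.I)‖ < 1 := by
          rw [norm_mul, Complex.norm_exp_ofReal_mul_I, mul_one, Complex.norm_real,
            Real.norm_eq_abs, abs_of_pos hr0]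
          exact hr1
        refine (hgenκ _ hn).trans ?_
        apply mul_le_mul_of_nonneg_left _ (by positivity)
        exact rpow_neg_le_of_le (by linarith) (by positivity) (le_norm_one_sub_circle hrh hθ)) m
    rw [intervalIntegral.integral_const_mul] at hco
    have hηpow : (1 - r) ^ (1 - γ) ≤ 2 ^ (γ - 1) * (N : ℝ) ^ (γ - 1) := by
      rw [hη, one_div, Real.inv_rpow (by positivity), ← Real.rpow_neg (by positivity), neg_sub,
        ← Real.mul_rpow (by norm_num) hNR.le]
      exact Real.rpow_le_rpow (by positivity) (by linarith) hγ1.le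
    have hrpow : 1 ≤ 3 * r ^ m := by
      have h1 := one_add_inv_pow_le (N := N) (n := m) (by omega)
      have h2 : (1 + 1 / (N : ℝ)) ^ m * r ^ m = 1 := by
        rw [← mul_pow, hr]
        have : (1 + 1 / (N : ℝ)) * (N / (N + 1)) = 1 := by field_simp
        rw [this, one_pow]
      rw [← h2]
      exact mul_le_mul_of_nonneg_right h1 (by positivity)
    have hpi : (1 : ℝ) ≤ 2 * Real.pi := by linarith [Real.pi_gt_three]
    calc |κ m| ≤ |κ m| * (3 * r ^ m) := le_mul_of_one_le_right (abs_nonneg _) hrpow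
      _ = 3 * (|κ m| * r ^ m) := by ring
      _ ≤ 3 * (2 * Real.pi * (|κ m| * r ^ m)) := by
          apply mul_le_mul_of_nonneg_left _ (by norm_num)
          exact le_mul_of_one_le_left (by positivity) hpi
      _ ≤ 3 * (1 / (c₀ * c) * (2 ^ (γ + 3) / (γ - 1) * (2 ^ (γ - 1) * (N : ℝ) ^ (γ - 1)))) := by
          apply mul_le_mul_of_nonneg_left _ (by norm_num)
          refine hco.trans (mul_le_mul_of_nonneg_left (hle.trans ?_) (by positivity))
          exact mul_le_mul_of_nonneg_left hηpow (by positivity)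
      _ = _ := by field_simp
  -- representation of the partial sums
  set F : ℕ → ℝ := fun k => ∑ j ∈ Finset.range (k + 1), s (k - j) * x j with hF
  have hFser : PowerSeries.mk F = PowerSeries.mk s * PowerSeries.mk x := by
    ext k
    rw [coeff_mk_mul', PowerSeries.coeff_mk]
  have hrep : ∑ k ∈ Finset.range (n + 1), x k = ∑ k ∈ Finset.range (n + 1), κ (n - k) * F k := by
    rw [← coeff_mk_mul', hFser, hκser]
    have : PowerSeries.mk K * PowerSeries.mk (fun _ => (1 : ℝ)) *
        (PowerSeries.mk s * PowerSeries.mk x) =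
        (PowerSeries.mk s * PowerSeries.mk K) *
          (PowerSeries.mk x * PowerSeries.mk (fun _ => (1 : ℝ))) := by ring
    rw [this, hinv, one_mul, coeff_mk_mul]
    simp
  rw [hrep, Finset.mul_sum]
  refine (Finset.abs_sum_le_sum_abs _ _).trans (Finset.sum_le_sum fun k _ => ?_)
  rw [abs_mul]
  exact mul_le_mul_of_nonneg_right (hκfin _ (Nat.sub_le _ _)) (abs_nonneg _)


lemma bLow_le_rpow_sub {α : ℝ} (hα : α ∈ Ioo (0 : ℝ) 1) {k : ℕ} (hk : 1 ≤ k) :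
    bLow α k ≤ 1 / 2 * (((k : ℝ) - 1 / 2) ^ (-α) - ((k : ℝ) + 1 / 2) ^ (-α)) := by
  have hk1 : (1 : ℝ) ≤ k := by exact_mod_cast hk
  have h := integral_affine_rpow hα 0 (-1) hk
  set d : ℝ := ((k : ℝ) - 1 / 2) ^ (-α) - ((k : ℝ) + 1 / 2) ^ (-α) with hd
  have hd0 : 0 ≤ d := by
    have := rpow_neg_le_of_le (α := α) (x := (k : ℝ) - 1 / 2) (y := k + 1 / 2) hα.1
      (by linarith) (by linarith)
    linarith
  have hle : (∫ y in (-(1 / 2) : ℝ)..(1 / 2), (0 + -1 * y) * ((k : ℝ) + y) ^ (-α)) ≤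
      ∫ y in (-(1 / 2) : ℝ)..(1 / 2), (1 / 2 * d + (0 + -1 * y) * (k : ℝ) ^ (-α)) := by
    apply intervalIntegral.integral_mono_on (by norm_num)
      (intervalIntegrable_affine_rpow α 0 (-1) hk) (Continuous.intervalIntegrable (by fun_prop) _ _)
    intro y hy
    have hy2 := half_le_add hk hy
    have h1 := rpow_neg_le_of_le (α := α) (x := (k : ℝ) - 1 / 2) (y := k + y) hα.1
      (by linarith) (by linarith [hy.1])
    have h2 := rpow_neg_le_of_le (α := α) (x := (k : ℝ) + y) (y := k + 1 / 2) hα.1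
      (by linarith) (by linarith [hy.2])
    have h3 := rpow_neg_le_of_le (α := α) (x := (k : ℝ) - 1 / 2) (y := k) hα.1
      (by linarith) (by linarith)
    have h4 := rpow_neg_le_of_le (α := α) (x := (k : ℝ)) (y := k + 1 / 2) hα.1
      (by linarith) (by linarith)
    have h5 : |(-y) * (((k : ℝ) + y) ^ (-α) - (k : ℝ) ^ (-α))| ≤ 1 / 2 * d := by
      rw [abs_mul, abs_neg]
      apply mul_le_mul (abs_le.2 hy) (abs_le.2 ⟨by linarith, by linarith⟩) (abs_nonneg _) (by norm_num)
    have := (abs_le.1 h5).2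
    nlinarith
  have e : (∫ y in (-(1 / 2) : ℝ)..(1 / 2), (1 / 2 * d + (0 + -1 * y) * (k : ℝ) ^ (-α))) =
      1 / 2 * d := by
    rw [intervalIntegral.integral_add (by simp) (Continuous.intervalIntegrable (by fun_prop) _ _),
      intervalIntegral.integral_const, intervalIntegral.integral_mul_const, integral_neg_half]
    norm_num
  rw [e] at hle
  have h1 : bLow α k = (1 - α) *
      ∫ y in (-(1 / 2) : ℝ)..(1 / 2), (0 + -1 * y) * ((k : ℝ) + y) ^ (-α) := by rw [h]; ring
  rw [h1]
  have h2 := mul_le_mul_of_nonneg_left hle (show 0 ≤ 1 - α by linarith [hα.2])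
  nlinarith [hα.1]

lemma sum_bLow_le {α : ℝ} (hα : α ∈ Ioo (0 : ℝ) 1) (n : ℕ) :
    ∑ k ∈ Finset.range n, bLow α (k + 1) ≤ aLow α 0 := by
  have e0 : aLow α 0 = 1 / 2 * (1 / 2 : ℝ) ^ (-α) := by
    simp only [aLow, if_true]
    rw [show 1 - α = 1 + -α by ring, Real.rpow_add (by norm_num), Real.rpow_one]
  have h : ∀ n : ℕ, ∑ k ∈ Finset.range n, bLow α (k + 1) ≤
      1 / 2 * ((1 / 2 : ℝ) ^ (-α) - ((n : ℝ) + 1 / 2) ^ (-α)) := by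
    intro n
    induction n with
    | zero => simp
    | succ n ih =>
      rw [Finset.sum_range_succ]
      have := bLow_le_rpow_sub hα (k := n + 1) (by omega)
      push_cast at this ⊢
      rw [show (n : ℝ) + 1 - 1 / 2 = n + 1 / 2 by ring] at this
      linarith
  have : 0 ≤ ((n : ℝ) + 1 / 2) ^ (-α) := by positivity
  rw [e0]
  linarith [h n]

/-! ### Stability for one eigenvalue of the discrete Laplacian -/

variable {p q s : ℕ}

/-- Scaled coefficients of the terms of order between one and two. -/
noncomputable def Data.wHigh (P : Data p q s) (τ : ℝ) (l : Fin p) : ℝ :=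
  P.a l * (τ ^ (1 - P.γ l) / Real.Gamma (3 - P.γ l))

/-- Scaled coefficients of the terms of order between zero and one. -/
noncomputable def Data.wLow (P : Data p q s) (τ : ℝ) (m : Fin q) : ℝ :=
  P.c m * (τ ^ (1 - P.α m) / Real.Gamma (2 - P.α m))

/-- Scaled coefficients of the fractional derivatives of the Laplacian. -/
noncomputable def Data.wLap (P : Data p q s) (τ : ℝ) (r : Fin s) : ℝ :=
  P.d r * (τ ^ (1 - P.β r) / Real.Gamma (2 - P.β r))

/-- Weights of the difference quotients in the part of the scheme without Laplacian; levels are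
counted from zero. -/
noncomputable def timeKer (P : Data p q s) (τ : ℝ) (n k : ℕ) : ℝ :=
  (∑ l, P.wHigh τ l * highKer (P.γ l) (n - k)) + (if n - k = 0 then P.b₁ else 0) +
    ∑ m, P.wLow τ m * cLow (P.α m) (n + 1) (n - k)

/-- Weights of the difference quotients of the negative Laplacian; levels are counted from
zero. -/
noncomputable def lapKer (P : Data p q s) (τ : ℝ) (n k : ℕ) : ℝ :=
  ∑ r, P.wLap τ r * cLow (P.β r) (n + 1) (n - k)

section Mode

variable {P : Data p q s} (hP : P.Admissible)
include hP

lemma wHigh_pos {τ : ℝ} (hτ : 0 < τ) (l : Fin p) : 0 < P.wHigh τ l :=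
  mul_pos (hP.a_pos l) (div_pos (Real.rpow_pos_of_pos hτ _)
    (Real.Gamma_pos_of_pos (by linarith [(hP.γ_mem l).2])))

lemma wLow_pos {τ : ℝ} (hτ : 0 < τ) (m : Fin q) : 0 < P.wLow τ m :=
  mul_pos (hP.c_pos m) (div_pos (Real.rpow_pos_of_pos hτ _)
    (Real.Gamma_pos_of_pos (by linarith [(hP.α_mem m).2])))

lemma wLap_pos {τ : ℝ} (hτ : 0 < τ) (r : Fin s) : 0 < P.wLap τ r :=
  mul_pos (hP.d_pos r) (div_pos (Real.rpow_pos_of_pos hτ _)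
    (Real.Gamma_pos_of_pos (by linarith [(hP.β_mem r).2])))

omit hP in
lemma sum_form_add (A B : ℕ → ℕ → ℝ) (x : ℕ → ℝ) (M : ℕ) :
    ∑ n ∈ Finset.range M, x n * ∑ k ∈ Finset.range (n + 1), (A n k + B n k) * x k =
      (∑ n ∈ Finset.range M, x n * ∑ k ∈ Finset.range (n + 1), A n k * x k) +
        ∑ n ∈ Finset.range M, x n * ∑ k ∈ Finset.range (n + 1), B n k * x k := by
  rw [← Finset.sum_add_distrib]
  refine Finset.sum_congr rfl fun n _ => ?_
  rw [← mul_add, ← Finset.sum_add_distrib]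
  congr 2; ext; ring

omit hP in
lemma sum_form_mul (c : ℝ) (A : ℕ → ℕ → ℝ) (x : ℕ → ℝ) (M : ℕ) :
    ∑ n ∈ Finset.range M, x n * ∑ k ∈ Finset.range (n + 1), (c * A n k) * x k =
      c * ∑ n ∈ Finset.range M, x n * ∑ k ∈ Finset.range (n + 1), A n k * x k := by
  rw [Finset.mul_sum]
  refine Finset.sum_congr rfl fun n _ => ?_
  rw [Finset.mul_sum, Finset.mul_sum, Finset.mul_sum]
  congr 1; ext; ring

omit hP in
lemma sum_form_sum {ι : Type*} (I : Finset ι) (A : ι → ℕ → ℕ → ℝ) (x : ℕ → ℝ) (M : ℕ) :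
    ∑ n ∈ Finset.range M, x n * ∑ k ∈ Finset.range (n + 1), (∑ i ∈ I, A i n k) * x k =
      ∑ i ∈ I, ∑ n ∈ Finset.range M, x n * ∑ k ∈ Finset.range (n + 1), A i n k * x k := by
  rw [Finset.sum_comm]
  refine Finset.sum_congr rfl fun n _ => ?_
  rw [← Finset.mul_sum, Finset.sum_comm]
  congr 2; ext; rw [Finset.sum_mul]

omit hP in
lemma sum_form_delta (b : ℝ) (x : ℕ → ℝ) (M : ℕ) :
    ∑ n ∈ Finset.range M, x n * ∑ k ∈ Finset.range (n + 1), (if n - k = 0 then b else 0) * x k =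
      b * ∑ n ∈ Finset.range M, x n ^ 2 := by
  rw [Finset.mul_sum]
  refine Finset.sum_congr rfl fun n _ => ?_
  rw [Finset.sum_range_succ, Finset.sum_eq_zero]
  · simp; ring
  · intro k hk
    have := Finset.mem_range.1 hk
    rw [if_neg (by omega), zero_mul]

lemma modeKer_coercive {τ : ℝ} (hτ : 0 < τ) {lam : ℝ} (hlam : 0 ≤ lam) (x : ℕ → ℝ) (M : ℕ) :
    P.b₁ * ∑ n ∈ Finset.range M, x n ^ 2 ≤
      ∑ n ∈ Finset.range M, x n * ∑ k ∈ Finset.range (n + 1),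
        (timeKer P τ n k + lam * lapKer P τ n k) * x k := by
  simp only [timeKer, lapKer]
  rw [sum_form_add, sum_form_add, sum_form_add, sum_form_delta, sum_form_mul, sum_form_sum,
    sum_form_sum, sum_form_sum]
  simp_rw [sum_form_mul]
  have h1 : 0 ≤ ∑ l, P.wHigh τ l * ∑ n ∈ Finset.range M, x n * ∑ k ∈ Finset.range (n + 1),
      highKer (P.γ l) (n - k) * x k :=
    Finset.sum_nonneg fun l _ => mul_nonneg (wHigh_pos hP hτ l).le (highKer_posType (hP.γ_mem l) x M)
  have h2 : 0 ≤ ∑ m, P.wLow τ m * ∑ n ∈ Finset.range M, x n * ∑ k ∈ Finset.range (n + 1),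
      cLow (P.α m) (n + 1) (n - k) * x k :=
    Finset.sum_nonneg fun m _ => mul_nonneg (wLow_pos hP hτ m).le (cLow_form_nonneg (hP.α_mem m) x M)
  have h3 : 0 ≤ ∑ r, P.wLap τ r * ∑ n ∈ Finset.range M, x n * ∑ k ∈ Finset.range (n + 1),
      cLow (P.β r) (n + 1) (n - k) * x k :=
    Finset.sum_nonneg fun r _ => mul_nonneg (wLap_pos hP hτ r).le (cLow_form_nonneg (hP.β_mem r) x M)
  have := mul_nonneg hlam h3
  linarith

omit hP in
/-- The weights expressing the mean of two consecutive levels through difference quotients. -/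
lemma mean_posType : PosType (fun k => if k = 0 then (1 / 2 : ℝ) else 1) := by
  apply posType_of_convex (u := fun _ => 1) <;> norm_num
  intro k hk
  omega

omit hP in
lemma mean_eq_sum {τ : ℝ} (hτ : τ ≠ 0) {y : ℕ → ℝ} (hy0 : y 0 = 0) (n : ℕ) :
    (y (n + 1) + y n) / 2 = ∑ k ∈ Finset.range (n + 1),
      τ * (if n - k = 0 then (1 / 2 : ℝ) else 1) * ((y (k + 1) - y k) / τ) := by
  rw [Finset.sum_range_succ]
  have : ∑ k ∈ Finset.range n, τ * (if n - k = 0 then (1 / 2 : ℝ) else 1) * ((y (k + 1) - y k) / τ)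
      = ∑ k ∈ Finset.range n, (y (k + 1) - y k) := by
    refine Finset.sum_congr rfl fun k hk => ?_
    have := Finset.mem_range.1 hk
    rw [if_neg (by omega)]
    field_simp
  rw [this, Finset.sum_range_sub, hy0, Nat.sub_self, if_pos rfl]
  field_simp
  ring

omit hP in
lemma sum_diff_quot {τ : ℝ} (hτ : τ ≠ 0) {y : ℕ → ℝ} (hy0 : y 0 = 0) (n : ℕ) :
    y n = τ * ∑ k ∈ Finset.range n, (y (k + 1) - y k) / τ := by
  rw [Finset.mul_sum]
  have : ∀ k, τ * ((y (k + 1) - y k) / τ) = y (k + 1) - y k := fun k => by field_simp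
  simp_rw [this]
  rw [Finset.sum_range_sub, hy0, sub_zero]

/-- `ℓ¹` in time stability, uniformly in the eigenvalue `lam`. -/
theorem mode_impulse_estimate :
    ∃ C > 0, ∀ (N : ℕ) (lam : ℝ), 0 < N → 0 ≤ lam → ∀ y F : ℕ → ℝ, y 0 = 0 →
      (∀ n < N, ∑ k ∈ Finset.range (n + 1),
        (timeKer P (P.T / N) n k + lam * lapKer P (P.T / N) n k) * ((y (k + 1) - y k) / (P.T / N)) +
          (P.b₂ + lam * P.b₃) * ((y (n + 1) + y n) / 2) = F n) →
      ∀ M ≤ N, |y M| ≤ C * ((P.T / N) * ∑ n ∈ Finset.range M, |F n|) := by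
  set l₀ : Fin p := ⟨0, hP.p_pos⟩ with hl₀
  have hγ := hP.γ_mem l₀
  obtain ⟨C, hC0, hC⟩ := impulse_bound hγ
  have hT := hP.T_pos
  have ha := hP.a_pos l₀
  have hΓ : 0 < Real.Gamma (3 - P.γ l₀) := Real.Gamma_pos_of_pos (by linarith [hγ.2])
  refine ⟨2 * (C * Real.Gamma (3 - P.γ l₀) * P.T ^ (P.γ l₀ - 1) / P.a l₀), by positivity, ?_⟩
  intro N lam hN hlam y F hy0 heq M hMN
  rcases Nat.eq_zero_or_pos M with rfl | hM0
  · simp [hy0]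
  obtain ⟨n, rfl⟩ : ∃ n, M = n + 1 := ⟨M - 1, by omega⟩
  have hNR : (0 : ℝ) < N := by exact_mod_cast hN
  set τ := P.T / N with hτdef
  have hτ : 0 < τ := by positivity
  set x : ℕ → ℝ := fun k => (y (k + 1) - y k) / τ with hx
  set μ := P.b₂ + lam * P.b₃ with hμdef
  have hμ : 0 ≤ μ := add_nonneg hP.b₂_pos.le (mul_nonneg hlam hP.b₃_pos.le)
  set t : ℕ → ℝ := fun k => ((∑ l ∈ Finset.univ.erase l₀, P.wHigh τ l * highKer (P.γ l) k) +
    (if k = 0 then P.b₁ else 0) + (∑ m, P.wLow τ m * omegaLow (P.α m) k)) +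
    lam * (∑ r, P.wLap τ r * omegaLow (P.β r) k) + μ * τ * (if k = 0 then (1 / 2 : ℝ) else 1) with ht
  set corr : ℕ → ℝ := fun n => (∑ m, P.wLow τ m * bLow (P.α m) (n + 1)) +
    lam * (∑ r, P.wLap τ r * bLow (P.β r) (n + 1)) with hcorr
  set a0 : ℝ := (∑ m, P.wLow τ m * aLow (P.α m) 0) + lam * (∑ r, P.wLap τ r * aLow (P.β r) 0) with ha0
  have hker : ∀ n k, k ≤ n → timeKer P τ n k + lam * lapKer P τ n k +
      μ * (τ * (if n - k = 0 then (1 / 2 : ℝ) else 1)) =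
      (P.wHigh τ l₀ * highKer (P.γ l₀) (n - k) + t (n - k)) - if k = 0 then corr n else 0 := by
    intro n k hk
    have hcl : ∀ α, cLow α (n + 1) (n - k) = omegaLow α (n - k) - if k = 0 then bLow α (n + 1) else 0 := by
      intro α
      rw [cLow_eq α (Nat.sub_le n k)]
      congr 1
      by_cases h : k = 0
      · rw [if_pos h, if_pos (by omega)]
      · rw [if_neg h, if_neg (by omega)]
    simp only [timeKer, lapKer, ht, hcl]
    rw [← Finset.add_sum_erase _ _ (Finset.mem_univ l₀)]
    by_cases h : k = 0
    · simp only [h, if_true, hcorr, mul_sub, Finset.sum_sub_distrib]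
      ring
    · simp only [h, if_false, sub_zero]
      ring
  have hconv : ∀ n < N, ∑ k ∈ Finset.range (n + 1),
      (P.wHigh τ l₀ * highKer (P.γ l₀) (n - k) + t (n - k)) * x k = F n + corr n * x 0 := by
    intro n hn
    have h1 := heq n hn
    rw [mean_eq_sum hτ.ne' hy0 n, Finset.mul_sum, ← Finset.sum_add_distrib] at h1
    have h2 : ∀ k ∈ Finset.range (n + 1),
        (timeKer P τ n k + lam * lapKer P τ n k) * ((y (k + 1) - y k) / τ) +
          μ * (τ * (if n - k = 0 then (1 / 2 : ℝ) else 1) * ((y (k + 1) - y k) / τ)) =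
        (P.wHigh τ l₀ * highKer (P.γ l₀) (n - k) + t (n - k)) * x k -
          (if k = 0 then corr n else 0) * x k := by
      intro k hk
      have := hker n k (by simpa [Nat.lt_succ_iff] using hk)
      rw [← sub_mul, ← this]
      ring
    rw [Finset.sum_congr rfl h2, Finset.sum_sub_distrib] at h1
    have h3 : ∑ k ∈ Finset.range (n + 1), (if k = 0 then corr n else 0) * x k = corr n * x 0 := by
      simp [ite_mul]
    rw [h3] at h1
    linarith
  -- the first step
  have hnn : ∀ k, 0 ≤ corr k := fun k => add_nonneg
    (Finset.sum_nonneg fun m _ => mul_nonneg (wLow_pos hP hτ m).le (bLow_nonneg (hP.α_mem m) (by omega)))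
    (mul_nonneg hlam (Finset.sum_nonneg fun r _ => mul_nonneg (wLap_pos hP hτ r).le
      (bLow_nonneg (hP.β_mem r) (by omega))))
  have hx0 : a0 * |x 0| ≤ |F 0| := by
    have h1 := hconv 0 hN
    rw [zero_add, Finset.sum_range_one, Nat.sub_self] at h1
    have h2 : P.wHigh τ l₀ * highKer (P.γ l₀) 0 + t 0 - corr 0 =
        (∑ l, P.wHigh τ l * highKer (P.γ l) 0) + P.b₁ + a0 + μ * τ * (1 / 2) := by
      rw [← Finset.add_sum_erase _ _ (Finset.mem_univ l₀)]
      simp only [ht, hcorr, ha0, omegaLow, if_true, mul_add, Finset.sum_add_distrib]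
      ring
    have h3 : 0 ≤ ∑ l, P.wHigh τ l * highKer (P.γ l) 0 :=
      Finset.sum_nonneg fun l _ => mul_nonneg (wHigh_pos hP hτ l).le
        (by rw [highKer, if_pos rfl, aHigh_zero (hP.γ_mem l)]; norm_num)
    have h4 : F 0 = (P.wHigh τ l₀ * highKer (P.γ l₀) 0 + t 0 - corr 0) * x 0 := by linarith
    have h5 : 0 ≤ μ * τ * (1 / 2) := by positivity
    have ha00 : 0 ≤ a0 := add_nonneg
      (Finset.sum_nonneg fun m _ => mul_nonneg (wLow_pos hP hτ m).le (aLow_nonneg (hP.α_mem m) 0))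
      (mul_nonneg hlam (Finset.sum_nonneg fun r _ => mul_nonneg (wLap_pos hP hτ r).le
        (aLow_nonneg (hP.β_mem r) 0)))
    have hb1 := hP.b₁_pos
    rw [h4, abs_mul]
    apply mul_le_mul_of_nonneg_right _ (abs_nonneg _)
    rw [h2, abs_of_nonneg (by linarith)]
    linarith
  have hsumcorr : ∑ k ∈ Finset.range (n + 1), corr k ≤ a0 := by
    simp only [hcorr]
    rw [Finset.sum_add_distrib, ← Finset.mul_sum, Finset.sum_comm,
      Finset.sum_comm (s := Finset.range (n + 1)) (t := (Finset.univ : Finset (Fin s)))]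
    apply add_le_add
    · apply Finset.sum_le_sum
      intro m _
      rw [← Finset.mul_sum]
      exact mul_le_mul_of_nonneg_left (sum_bLow_le (hP.α_mem m) _) (wLow_pos hP hτ m).le
    · apply mul_le_mul_of_nonneg_left _ hlam
      apply Finset.sum_le_sum
      intro r _
      rw [← Finset.mul_sum]
      exact mul_le_mul_of_nonneg_left (sum_bLow_le (hP.β_mem r) _) (wLap_pos hP hτ r).le
  have hG : ∑ k ∈ Finset.range (n + 1), |F k + corr k * x 0| ≤
      2 * ∑ k ∈ Finset.range (n + 1), |F k| := by
    have h1 : ∑ k ∈ Finset.range (n + 1), |F k + corr k * x 0| ≤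
        (∑ k ∈ Finset.range (n + 1), |F k|) + (∑ k ∈ Finset.range (n + 1), corr k) * |x 0| := by
      rw [Finset.sum_mul, ← Finset.sum_add_distrib]
      apply Finset.sum_le_sum
      intro k _
      refine (abs_add_le _ _).trans_eq ?_
      rw [abs_mul, abs_of_nonneg (hnn k)]
    have h2 := mul_le_mul_of_nonneg_right hsumcorr (abs_nonneg (x 0))
    have h3 : |F 0| ≤ ∑ k ∈ Finset.range (n + 1), |F k| :=
      Finset.single_le_sum (f := fun k => |F k|) (fun _ _ => abs_nonneg _) (by simp)
    linarith
  -- boundedness and coercivity of the remaining weights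
  have htB : ∃ B, ∀ k, |t k| ≤ B := by
    refine ⟨((∑ l ∈ Finset.univ.erase l₀, P.wHigh τ l * 1) + P.b₁ +
      (∑ m, P.wLow τ m * (2 * omegaLow (P.α m) 0))) +
      lam * (∑ r, P.wLap τ r * (2 * omegaLow (P.β r) 0)) + μ * τ * 1, fun k => ?_⟩
    have hs : ∀ {ι : Type} (I : Finset ι) (w g : ι → ℝ) (G : ι → ℝ), (∀ i, 0 < w i) →
        (∀ i, |g i| ≤ G i) → |∑ i ∈ I, w i * g i| ≤ ∑ i ∈ I, w i * G i := by
      intro ι I w g G hw hg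
      refine (Finset.abs_sum_le_sum_abs _ _).trans (Finset.sum_le_sum fun i _ => ?_)
      rw [abs_mul, abs_of_pos (hw i)]
      exact mul_le_mul_of_nonneg_left (hg i) (hw i).le
    refine (abs_add_le _ _).trans (add_le_add ((abs_add_le _ _).trans (add_le_add
      ((abs_add_le _ _).trans (add_le_add ((abs_add_le _ _).trans (add_le_add ?_ ?_)) ?_)) ?_)) ?_)
    · exact hs _ _ _ _ (wHigh_pos hP hτ) fun l => abs_highKer_le (hP.γ_mem l) k
    · have := hP.b₁_pos
      split_ifs
      · exact (abs_of_pos this).le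
      · rw [abs_zero]; exact this.le
    · exact hs _ _ _ _ (wLow_pos hP hτ) fun l => abs_omegaLow_le (hP.α_mem l) k
    · rw [abs_mul, abs_of_nonneg hlam]
      exact mul_le_mul_of_nonneg_left
        (hs _ _ _ _ (wLap_pos hP hτ) fun l => abs_omegaLow_le (hP.β_mem l) k) hlam
    · rw [abs_mul, abs_of_nonneg (by positivity)]
      apply mul_le_mul_of_nonneg_left _ (by positivity)
      split_ifs <;> norm_num
  obtain ⟨B, hB⟩ := htB
  have hcoer : ∀ (x : ℕ → ℝ) (M : ℕ), P.b₁ * ∑ n ∈ Finset.range M, x n ^ 2 ≤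
      ∑ n ∈ Finset.range M, x n * ∑ k ∈ Finset.range (n + 1), t (n - k) * x k := by
    intro x M
    simp only [ht]
    rw [sum_form_add (fun n k => _ + lam * _) (fun n k => μ * τ * _), sum_form_add,
      sum_form_add (fun n k => _ + (if n - k = 0 then P.b₁ else 0)), sum_form_add, sum_form_delta]
    have h1 := (PosType.sum (Finset.univ.erase l₀) fun l =>
      (highKer_posType (hP.γ_mem l)).const_mul (wHigh_pos hP hτ l).le) x M
    have h2 := (PosType.sum Finset.univ fun m =>
      (omegaLow_posType (hP.α_mem m)).const_mul (wLow_pos hP hτ m).le) x M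
    have h3 := ((PosType.sum Finset.univ fun r =>
      (omegaLow_posType (hP.β_mem r)).const_mul (wLap_pos hP hτ r).le).const_mul hlam) x M
    have h4 := (mean_posType.const_mul (mul_nonneg hμ hτ.le)) x M
    linarith
  have hfin := hC (P.wHigh τ l₀) P.b₁ B t (wHigh_pos hP hτ l₀) hP.b₁_pos hB hcoer x n N (by omega)
  have hsrc : ∑ k ∈ Finset.range (n + 1), |∑ j ∈ Finset.range (k + 1),
      (P.wHigh τ l₀ * highKer (P.γ l₀) (k - j) + t (k - j)) * x j| =
      ∑ k ∈ Finset.range (n + 1), |F k + corr k * x 0| :=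
    Finset.sum_congr rfl fun k hk => by
      rw [hconv k (by have := Finset.mem_range.1 hk; omega)]
  rw [hsrc] at hfin
  rw [sum_diff_quot hτ.ne' hy0 (n + 1), abs_mul, abs_of_pos hτ]
  have hconst : C / P.wHigh τ l₀ * (N : ℝ) ^ (P.γ l₀ - 1) =
      C * Real.Gamma (3 - P.γ l₀) * P.T ^ (P.γ l₀ - 1) / P.a l₀ := by
    have h1 : P.T ^ (P.γ l₀ - 1) = τ ^ (P.γ l₀ - 1) * (N : ℝ) ^ (P.γ l₀ - 1) := by
      rw [← Real.mul_rpow hτ.le hNR.le, hτdef]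
      congr 1; field_simp
    have h2 : τ ^ (1 - P.γ l₀) = (τ ^ (P.γ l₀ - 1))⁻¹ := by
      rw [← Real.rpow_neg hτ.le, neg_sub]
    have h3 : 0 < τ ^ (P.γ l₀ - 1) := Real.rpow_pos_of_pos hτ _
    rw [Data.wHigh, h1, h2]
    field_simp
  rw [hconst] at hfin
  set D := C * Real.Gamma (3 - P.γ l₀) * P.T ^ (P.γ l₀ - 1) / P.a l₀ with hD
  have hD0 : 0 ≤ D := by positivity
  calc _ ≤ τ * (D * (2 * ∑ k ∈ Finset.range (n + 1), |F k|)) :=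
        mul_le_mul_of_nonneg_left (hfin.trans (mul_le_mul_of_nonneg_left hG hD0)) hτ.le
    _ = _ := by ring

end Mode

/-! ### Solvability and the combined estimate -/

/-- Forward substitution for a lower triangular system. -/
noncomputable def forwardSubst (L : ℕ → ℕ → ℝ) (F : ℕ → ℝ) (n : ℕ) : ℝ :=
  (F n - ∑ k : Fin n, L n k * forwardSubst L F k) / L n n
termination_by n
decreasing_by exact k.2

lemma sum_forwardSubst {L : ℕ → ℕ → ℝ} (hL : ∀ n, L n n ≠ 0) (F : ℕ → ℝ) (n : ℕ) :
    ∑ k ∈ Finset.range (n + 1), L n k * forwardSubst L F k = F n := by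
  rw [Finset.sum_range_succ, Finset.sum_range (fun k => L n k * forwardSubst L F k)]
  conv_lhs => rw [forwardSubst.eq_1 L F n]
  have := hL n
  field_simp
  ring

theorem mode_estimate {P : Data p q s} (hP : P.Admissible) :
    ∃ C > 0, ∀ (N : ℕ) (lam : ℝ), 0 < N → 0 ≤ lam → ∀ y A B : ℕ → ℝ, y 0 = 0 →
      (∀ n < N, ∑ k ∈ Finset.range (n + 1),
        (timeKer P (P.T / N) n k + lam * lapKer P (P.T / N) n k) * ((y (k + 1) - y k) / (P.T / N)) +
          (P.b₂ + lam * P.b₃) * ((y (n + 1) + y n) / 2) = A n + B n) →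
      ∀ M ≤ N, (P.b₂ + lam * P.b₃) * y M ^ 2 ≤
        C * ((P.T / N) * ∑ n ∈ Finset.range M, A n ^ 2) +
          C * (P.b₂ + lam * P.b₃) * ((P.T / N) * ∑ n ∈ Finset.range M, |B n|) ^ 2 := by
  obtain ⟨C, hC0, hC⟩ := mode_impulse_estimate hP
  have hb := hP.b₁_pos
  refine ⟨2 * C ^ 2 + 1 / P.b₁, by positivity, ?_⟩
  intro N lam hN hlam y A B hy0 heq M hM
  have hT := hP.T_pos
  have hNR : (0 : ℝ) < N := by exact_mod_cast hN
  set τ := P.T / N with hτdef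
  have hτ : 0 < τ := by positivity
  set μ := P.b₂ + lam * P.b₃ with hμdef
  have hμ : 0 < μ := add_pos_of_pos_of_nonneg hP.b₂_pos (mul_nonneg hlam hP.b₃_pos.le)
  set L : ℕ → ℕ → ℝ := fun n k => timeKer P τ n k + lam * lapKer P τ n k +
    μ * (τ * (if n - k = 0 then (1 / 2 : ℝ) else 1)) with hL
  have hLpos : ∀ n, L n n ≠ 0 := by
    intro n
    have h1 := modeKer_coercive hP hτ hlam (fun k => if k = n then 1 else 0) (n + 1)
    have h2 : ∀ f : ℕ → ℝ, ∑ m ∈ Finset.range (n + 1), f m * (if m = n then (1 : ℝ) else 0) = f n := by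
      intro f; simp
    have h3 : ∑ m ∈ Finset.range (n + 1), (if m = n then (1 : ℝ) else 0) *
        ∑ k ∈ Finset.range (m + 1), (timeKer P τ m k + lam * lapKer P τ m k) *
          (if k = n then (1 : ℝ) else 0) = timeKer P τ n n + lam * lapKer P τ n n := by
      rw [Finset.sum_congr rfl fun m _ => mul_comm _ _, h2, h2]
    rw [h3] at h1
    simp at h1
    have : 0 < L n n := by
      simp only [hL, Nat.sub_self, if_true]
      have : 0 < μ * (τ * (1 / 2)) := by positivity
      linarith
    exact this.ne'
  set x := forwardSubst L A with hx
  set z : ℕ → ℝ := fun n => τ * ∑ k ∈ Finset.range n, x k with hz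
  have hz0 : z 0 = 0 := by simp [hz]
  have hzx : ∀ k, (z (k + 1) - z k) / τ = x k := by
    intro k
    simp only [hz]
    rw [Finset.sum_range_succ]
    field_simp
    ring
  have hzeq : ∀ n, ∑ k ∈ Finset.range (n + 1),
      (timeKer P τ n k + lam * lapKer P τ n k) * ((z (k + 1) - z k) / τ) +
        μ * ((z (n + 1) + z n) / 2) = A n := by
    intro n
    rw [mean_eq_sum hτ.ne' hz0 n, ← sum_forwardSubst hLpos A n, Finset.mul_sum,
      ← Finset.sum_add_distrib]
    refine Finset.sum_congr rfl fun k _ => ?_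
    rw [hzx]
    simp only [hL]
    ring
  have h1 := energy_estimate (A := fun n k => timeKer P τ n k + lam * lapKer P τ n k) hb hτ
    (modeKer_coercive hP hτ hlam) hz0 (N := N) (F := A) (μ := μ) (fun n _ => hzeq n) hM
  have h2 := hC N lam hN hlam (fun n => y n - z n) B (by rw [hy0, hz0, sub_zero]) (by
    intro n hn
    have e1 := heq n hn
    have e2 := hzeq n
    have e3 : ∑ k ∈ Finset.range (n + 1), (timeKer P τ n k + lam * lapKer P τ n k) *
        ((y (k + 1) - z (k + 1) - (y k - z k)) / τ) =
        ∑ k ∈ Finset.range (n + 1), (timeKer P τ n k + lam * lapKer P τ n k) * ((y (k + 1) - y k) / τ)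
        - ∑ k ∈ Finset.range (n + 1), (timeKer P τ n k + lam * lapKer P τ n k) *
          ((z (k + 1) - z k) / τ) := by
      rw [← Finset.sum_sub_distrib]
      refine Finset.sum_congr rfl fun k _ => ?_
      ring
    rw [e3]
    linarith) M hM
  have h3 : (y M - z M) ^ 2 ≤ (C * (τ * ∑ n ∈ Finset.range M, |B n|)) ^ 2 := by
    rw [← sq_abs]
    exact pow_le_pow_left₀ (abs_nonneg _) h2 2
  have h4 : y M ^ 2 ≤ 2 * z M ^ 2 + 2 * (y M - z M) ^ 2 := by
    nlinarith [sq_nonneg (2 * z M - y M)]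
  have hSA : 0 ≤ τ * ∑ n ∈ Finset.range M, A n ^ 2 :=
    mul_nonneg hτ.le (Finset.sum_nonneg fun _ _ => sq_nonneg _)
  have hSB : 0 ≤ μ * (τ * ∑ n ∈ Finset.range M, |B n|) ^ 2 := by positivity
  have h5 := mul_le_mul_of_nonneg_left h4 hμ.le
  have h6 := mul_le_mul_of_nonneg_left h3 hμ.le
  have h7 : 1 / (2 * P.b₁) * (τ * ∑ n ∈ Finset.range M, A n ^ 2) * 2 =
      1 / P.b₁ * (τ * ∑ n ∈ Finset.range M, A n ^ 2) := by field_simp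
  have h8 : 0 ≤ 1 / P.b₁ * (μ * (τ * ∑ n ∈ Finset.range M, |B n|) ^ 2) := by positivity
  have h9 : 0 ≤ C ^ 2 * (τ * ∑ n ∈ Finset.range M, A n ^ 2) := by positivity
  nlinarith


open scoped InnerProductSpace in
/-- Stability of the scheme for a positive symmetric operator on a finite-dimensional Hilbert
space, with a source that is `ℓ²` in time plus one that is `ℓ¹` in time along a fixed vector. -/
theorem hilbert_estimate {p q s : ℕ} {P : Data p q s} (hP : P.Admissible) :
    ∃ C > 0, ∀ (V : Type) [NormedAddCommGroup V] [InnerProductSpace ℝ V] [FiniteDimensional ℝ V]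
      (A : V →ₗ[ℝ] V), A.IsSymmetric → (∀ v, 0 ≤ ⟪A v, v⟫_ℝ) →
      ∀ (N : ℕ), 0 < N → ∀ (e R : ℕ → V) (g : V) (ρ : ℕ → ℝ), e 0 = 0 →
      (∀ n < N, (∑ k ∈ Finset.range (n + 1),
          (timeKer P (P.T / N) n k • ((P.T / N)⁻¹ • (e (k + 1) - e k)) +
            lapKer P (P.T / N) n k • A ((P.T / N)⁻¹ • (e (k + 1) - e k)))) +
          (1 / 2 : ℝ) • (P.b₂ • (e (n + 1) + e n) + P.b₃ • A (e (n + 1) + e n)) =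
        R n + ρ n • g) →
      ∀ M ≤ N, P.b₂ * ‖e M‖ ^ 2 + P.b₃ * ⟪A (e M), e M⟫_ℝ ≤
        C * ((P.T / N) * ∑ n ∈ Finset.range M, ‖R n‖ ^ 2) +
          C * (P.b₂ * ‖g‖ ^ 2 + P.b₃ * ⟪A g, g⟫_ℝ) *
            ((P.T / N) * ∑ n ∈ Finset.range M, |ρ n|) ^ 2 := by
  obtain ⟨C, hC0, hC⟩ := mode_estimate hP
  refine ⟨C, hC0, ?_⟩
  intro V _ _ _ A hA hpos N hN e R g ρ he0 heq M hM
  set b := hA.eigenvectorBasis rfl with hb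
  set lam : Fin (Module.finrank ℝ V) → ℝ := hA.eigenvalues rfl with hlam
  have hAb : ∀ i, A (b i) = lam i • b i := fun i => hA.apply_eigenvectorBasis rfl i
  have hAin : ∀ i v, ⟪b i, A v⟫_ℝ = lam i * ⟪b i, v⟫_ℝ := by
    intro i v
    rw [← hA, hAb, inner_smul_left]
    rfl
  have hlam0 : ∀ i, 0 ≤ lam i := by
    intro i
    have h := hpos (b i)
    rw [hAb, inner_smul_left, real_inner_self_eq_norm_sq, b.norm_eq_one i] at h
    simpa using h
  have hpars : ∀ v : V, ‖v‖ ^ 2 = ∑ i, ⟪b i, v⟫_ℝ ^ 2 := by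
    intro v
    rw [← b.sum_sq_norm_inner_right v]
    exact Finset.sum_congr rfl fun i _ => by rw [Real.norm_eq_abs, sq_abs]
  have hApars : ∀ v : V, ⟪A v, v⟫_ℝ = ∑ i, lam i * ⟪b i, v⟫_ℝ ^ 2 := by
    intro v
    rw [← b.sum_inner_mul_inner (A v) v]
    refine Finset.sum_congr rfl fun i _ => ?_
    rw [real_inner_comm, hAin]
    ring
  have hH1 : ∀ v : V, P.b₂ * ‖v‖ ^ 2 + P.b₃ * ⟪A v, v⟫_ℝ =
      ∑ i, (P.b₂ + lam i * P.b₃) * ⟪b i, v⟫_ℝ ^ 2 := by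
    intro v
    rw [hpars, hApars, Finset.mul_sum, Finset.mul_sum, ← Finset.sum_add_distrib]
    exact Finset.sum_congr rfl fun i _ => by ring
  have hmode : ∀ i, (P.b₂ + lam i * P.b₃) * ⟪b i, e M⟫_ℝ ^ 2 ≤
      C * ((P.T / N) * ∑ n ∈ Finset.range M, ⟪b i, R n⟫_ℝ ^ 2) +
        C * (P.b₂ + lam i * P.b₃) *
          ((P.T / N) * ∑ n ∈ Finset.range M, |ρ n * ⟪b i, g⟫_ℝ|) ^ 2 := by
    intro i
    apply hC N (lam i) hN (hlam0 i) (fun n => ⟪b i, e n⟫_ℝ) (fun n => ⟪b i, R n⟫_ℝ)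
      (fun n => ρ n * ⟪b i, g⟫_ℝ) (by simp [he0]) _ M hM
    intro n hn
    have h := congrArg (fun v => ⟪b i, v⟫_ℝ) (heq n hn)
    simp only [inner_add_right, inner_sum, inner_smul_right, hAin, inner_sub_right] at h
    rw [← h]
    congr 1
    · refine Finset.sum_congr rfl fun k _ => ?_
      ring
    · ring
  rw [hH1, hH1]
  refine (Finset.sum_le_sum fun i _ => hmode i).trans_eq ?_
  rw [Finset.sum_add_distrib]
  congr 1
  · simp_rw [hpars]
    rw [Finset.sum_comm, ← Finset.mul_sum, ← Finset.mul_sum]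
  · rw [Finset.mul_sum, Finset.sum_mul]
    refine Finset.sum_congr rfl fun i _ => ?_
    simp_rw [abs_mul]
    rw [← Finset.sum_mul, ← mul_assoc, mul_pow, sq_abs]
    ring

/-! ### The scheme at a fixed node -/

variable {p q s : ℕ}

/-- Discrete Caputo derivative of order `1 < γ < 2` (up to scaling) of a function with difference
quotients `x k`, `k ≥ 1`, and initial velocity `v₀`. -/
noncomputable def highForm (γ : ℝ) (x : ℕ → ℝ) (v₀ : ℝ) (n : ℕ) : ℝ :=
  aHigh γ 0 * x n - (∑ k ∈ Finset.Icc 1 (n - 1), (aHigh γ (n - k - 1) - aHigh γ (n - k)) * x k) -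
    aHigh γ (n - 1) * v₀

/-- Discrete Caputo derivative of order `0 < α < 1` (up to scaling) of a function with difference
quotients `x k`, `k ≥ 1`. -/
noncomputable def lowForm (α : ℝ) (x : ℕ → ℝ) (n : ℕ) : ℝ :=
  ∑ k ∈ Finset.Icc 1 n, cLow α n (n - k) * x k

/-- Backward difference quotient of a sequence. -/
noncomputable def diffQuot (τ : ℝ) (v : ℕ → ℝ) (n : ℕ) : ℝ := (v n - v (n - 1)) / τ

/-- The scheme operator at a fixed node, for nodal values `v` and nodal values `z` of the discrete
Laplacian. -/
noncomputable def schemeOp (P : Data p q s) (τ : ℝ) (v z : ℕ → ℝ) (v₀ : ℝ) (n : ℕ) : ℝ :=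
  (∑ l, P.wHigh τ l * highForm (P.γ l) (diffQuot τ v) v₀ n) + P.b₁ * diffQuot τ v n +
    (∑ m, P.wLow τ m * lowForm (P.α m) (diffQuot τ v) n) + P.b₂ * ((v n + v (n - 1)) / 2) -
    P.b₃ * ((z n + z (n - 1)) / 2) - ∑ r, P.wLap τ r * lowForm (P.β r) (diffQuot τ z) n

lemma diffQuot_sub (τ : ℝ) (v w : ℕ → ℝ) :
    diffQuot τ (fun n => v n - w n) = fun n => diffQuot τ v n - diffQuot τ w n := by
  ext n; simp only [diffQuot]; ring

lemma highForm_sub (γ : ℝ) (x y : ℕ → ℝ) (a b : ℝ) (n : ℕ) :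
    highForm γ (fun n => x n - y n) (a - b) n = highForm γ x a n - highForm γ y b n := by
  simp only [highForm, mul_sub, Finset.sum_sub_distrib]
  ring

lemma lowForm_sub (α : ℝ) (x y : ℕ → ℝ) (n : ℕ) :
    lowForm α (fun n => x n - y n) n = lowForm α x n - lowForm α y n := by
  simp only [lowForm, mul_sub, Finset.sum_sub_distrib]

lemma schemeOp_sub (P : Data p q s) (τ : ℝ) (v z v' z' : ℕ → ℝ) (a b : ℝ) (n : ℕ) :
    schemeOp P τ (fun n => v n - v' n) (fun n => z n - z' n) (a - b) n =
      schemeOp P τ v z a n - schemeOp P τ v' z' b n := by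
  simp only [schemeOp, diffQuot_sub, highForm_sub, lowForm_sub, mul_sub, Finset.sum_sub_distrib]
  ring

lemma sum_Icc_one_eq_range (f : ℕ → ℝ) (n : ℕ) :
    ∑ k ∈ Finset.Icc 1 n, f k = ∑ k ∈ Finset.range n, f (k + 1) := by
  rw [Finset.range_eq_Ico, Finset.sum_Ico_add' f 0 n 1]
  rfl

lemma highForm_eq (γ : ℝ) (x : ℕ → ℝ) (n : ℕ) :
    highForm γ x 0 (n + 1) = ∑ k ∈ Finset.range (n + 1), highKer γ (n - k) * x (k + 1) := by
  rw [Finset.sum_range_succ, highForm, sum_Icc_one_eq_range]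
  simp only [Nat.add_sub_cancel, Nat.sub_self, highKer, if_true, mul_zero, sub_zero]
  have : ∀ k ∈ Finset.range n, (if n - k = 0 then aHigh γ 0 else
      aHigh γ (n - k) - aHigh γ (n - k - 1)) * x (k + 1) =
      -((aHigh γ (n + 1 - (k + 1) - 1) - aHigh γ (n + 1 - (k + 1))) * x (k + 1)) := by
    intro k hk
    have := Finset.mem_range.1 hk
    rw [if_neg (by omega), show n + 1 - (k + 1) = n - k by omega]
    ring
  rw [Finset.sum_congr rfl this, Finset.sum_neg_distrib]
  ring

lemma lowForm_eq (α : ℝ) (x : ℕ → ℝ) (n : ℕ) :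
    lowForm α x (n + 1) = ∑ k ∈ Finset.range (n + 1), cLow α (n + 1) (n - k) * x (k + 1) := by
  rw [lowForm, sum_Icc_one_eq_range]
  refine Finset.sum_congr rfl fun k _ => ?_
  rw [show n + 1 - (k + 1) = n - k by omega]

lemma schemeOp_eq (P : Data p q s) (τ : ℝ) (v z : ℕ → ℝ) (n : ℕ) :
    schemeOp P τ v z 0 (n + 1) =
      (∑ k ∈ Finset.range (n + 1), (timeKer P τ n k * (τ⁻¹ * (v (k + 1) - v k)) +
        lapKer P τ n k * (τ⁻¹ * (-z (k + 1) - -z k)))) +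
        1 / 2 * (P.b₂ * (v (n + 1) + v n) + P.b₃ * (-z (n + 1) + -z n)) := by
  have hq : ∀ (w : ℕ → ℝ) k, diffQuot τ w (k + 1) = τ⁻¹ * (w (k + 1) - w k) := by
    intro w k
    simp only [diffQuot, Nat.add_sub_cancel]
    rw [div_eq_inv_mul]
  have hdelta : ∑ k ∈ Finset.range (n + 1), (if n - k = 0 then P.b₁ else 0) *
      (τ⁻¹ * (v (k + 1) - v k)) = P.b₁ * (τ⁻¹ * (v (n + 1) - v n)) := by
    rw [Finset.sum_range_succ, Finset.sum_eq_zero]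
    · simp
    · intro k hk
      have := Finset.mem_range.1 hk
      rw [if_neg (by omega), zero_mul]
  simp only [schemeOp, highForm_eq, lowForm_eq, hq, Nat.add_sub_cancel]
  simp only [timeKer, lapKer, add_mul, Finset.sum_add_distrib, hdelta, Finset.sum_mul]
  rw [Finset.sum_comm (s := Finset.range (n + 1)), Finset.sum_comm (s := Finset.range (n + 1)),
    Finset.sum_comm (s := Finset.range (n + 1))]
  simp only [Finset.mul_sum, mul_assoc]
  have h3 : ∑ r, ∑ k ∈ Finset.range (n + 1), P.wLap τ r * (cLow (P.β r) (n + 1) (n - k) *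
      (τ⁻¹ * (-z (k + 1) - -z k))) = -∑ r, ∑ k ∈ Finset.range (n + 1),
        P.wLap τ r * (cLow (P.β r) (n + 1) (n - k) * (τ⁻¹ * (z (k + 1) - z k))) := by
    rw [← Finset.sum_neg_distrib]
    refine Finset.sum_congr rfl fun r _ => ?_
    rw [← Finset.sum_neg_distrib]
    refine Finset.sum_congr rfl fun k _ => ?_
    ring
  rw [h3]
  ring

/-! ### Summation by parts -/

lemma sum_mul_second_diff (a b : ℕ → ℝ) {M : ℕ} (hM : 1 ≤ M) :
    ∑ i ∈ Finset.Icc 1 M, (a i - a (i - 1)) * (b i - b (i - 1)) =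
      (a M - a (M - 1)) * b M - (a 1 - a 0) * b 0 -
        ∑ i ∈ Finset.Icc 1 (M - 1), (a (i - 1) - 2 * a i + a (i + 1)) * b i := by
  induction M, hM using Nat.le_induction with
  | base => simp; ring
  | succ M hM ih =>
    rw [Finset.sum_Icc_succ_top (by omega), ih]
    obtain ⟨m, rfl⟩ : ∃ m, M = m + 1 := ⟨M - 1, by omega⟩
    simp only [Nat.add_sub_cancel]
    rw [Finset.sum_Icc_succ_top (by omega)]
    simp only [Nat.add_sub_cancel]
    ring

/-- The grid function vanishes on the boundary of the grid. -/
def BoundaryZero (Mx My : ℕ) (v : ℕ → ℕ → ℝ) : Prop :=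
  ∀ i ≤ Mx, ∀ j ≤ My, (i = 0 ∨ i = Mx ∨ j = 0 ∨ j = My) → v i j = 0

lemma sum_Icc_drop_last {f : ℕ → ℝ} {M : ℕ} (hM : 1 ≤ M) (hf : f M = 0) :
    ∑ i ∈ Finset.Icc 1 M, f i = ∑ i ∈ Finset.Icc 1 (M - 1), f i := by
  obtain ⟨m, rfl⟩ : ∃ m, M = m + 1 := ⟨M - 1, by omega⟩
  rw [Finset.sum_Icc_succ_top (by omega), hf, add_zero, Nat.add_sub_cancel]

lemma sum_neg_discLaplacian_mul {hx hy : ℝ} {Mx My : ℕ} (hMx : 1 ≤ Mx)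
    (hMy : 1 ≤ My) {v w : ℕ → ℕ → ℝ} (hv : BoundaryZero Mx My v) (hw : BoundaryZero Mx My w) :
    ∑ i ∈ Finset.Icc 1 (Mx - 1), ∑ j ∈ Finset.Icc 1 (My - 1), -discLaplacian hx hy v i j * w i j =
      ∑ i ∈ Finset.Icc 1 Mx, ∑ j ∈ Finset.Icc 1 My,
        (dx hx v i j * dx hx w i j + dy hy v i j * dy hy w i j) := by
  have hxpart : ∑ i ∈ Finset.Icc 1 Mx, ∑ j ∈ Finset.Icc 1 My, dx hx v i j * dx hx w i j =
      ∑ i ∈ Finset.Icc 1 (Mx - 1), ∑ j ∈ Finset.Icc 1 (My - 1),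
        -((v (i - 1) j - 2 * v i j + v (i + 1) j) / hx ^ 2) * w i j := by
    rw [Finset.sum_comm, sum_Icc_drop_last hMy, Finset.sum_comm (s := Finset.Icc 1 (Mx - 1))]
    · refine Finset.sum_congr rfl fun j hj => ?_
      have hj := Finset.mem_Icc.1 hj
      have h := sum_mul_second_diff (fun i => v i j) (fun i => w i j) hMx
      rw [hw 0 (by omega) j (by omega) (by simp), hw Mx le_rfl j (by omega) (by simp)] at h
      have e1 : ∀ i, dx hx v i j * dx hx w i j =
          1 / hx ^ 2 * ((v i j - v (i - 1) j) * (w i j - w (i - 1) j)) := by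
        intro i; simp only [dx]; ring
      simp_rw [e1]
      rw [← Finset.mul_sum, h, mul_zero, mul_zero, sub_zero, zero_sub, mul_neg, Finset.mul_sum,
        ← Finset.sum_neg_distrib]
      exact Finset.sum_congr rfl fun i _ => by ring
    · refine Finset.sum_eq_zero fun i hi => ?_
      have hi := Finset.mem_Icc.1 hi
      simp only [dx]
      rw [hv i hi.2 My le_rfl (by simp), hv (i - 1) (by omega) My le_rfl (by simp)]
      simp
  have hypart : ∑ i ∈ Finset.Icc 1 Mx, ∑ j ∈ Finset.Icc 1 My, dy hy v i j * dy hy w i j =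
      ∑ i ∈ Finset.Icc 1 (Mx - 1), ∑ j ∈ Finset.Icc 1 (My - 1),
        -((v i (j - 1) - 2 * v i j + v i (j + 1)) / hy ^ 2) * w i j := by
    rw [sum_Icc_drop_last hMx]
    · refine Finset.sum_congr rfl fun i hi => ?_
      have hi := Finset.mem_Icc.1 hi
      have h := sum_mul_second_diff (fun j => v i j) (fun j => w i j) hMy
      rw [hw i (by omega) 0 (by omega) (by simp), hw i (by omega) My le_rfl (by simp)] at h
      have e1 : ∀ j, dy hy v i j * dy hy w i j =
          1 / hy ^ 2 * ((v i j - v i (j - 1)) * (w i j - w i (j - 1))) := by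
        intro j; simp only [dy]; ring
      simp_rw [e1]
      rw [← Finset.mul_sum, h, mul_zero, mul_zero, sub_zero, zero_sub, mul_neg, Finset.mul_sum,
        ← Finset.sum_neg_distrib]
      exact Finset.sum_congr rfl fun i _ => by ring
    · refine Finset.sum_eq_zero fun j hj => ?_
      have hj := Finset.mem_Icc.1 hj
      simp only [dy]
      rw [hv Mx le_rfl j hj.2 (by simp), hv Mx le_rfl (j - 1) (by omega) (by simp)]
      simp
  simp only [Finset.sum_add_distrib]
  rw [hxpart, hypart, ← Finset.sum_add_distrib]
  refine Finset.sum_congr rfl fun i _ => ?_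
  rw [← Finset.sum_add_distrib]
  refine Finset.sum_congr rfl fun j _ => ?_
  simp only [discLaplacian]
  ring


/-! ### Grid functions as a Hilbert space -/

/-- The interior nodes of the grid. -/
abbrev Node (Mx My : ℕ) : Type :=
  {z : ℕ × ℕ // z ∈ Finset.Icc 1 (Mx - 1) ×ˢ Finset.Icc 1 (My - 1)}

/-- Extension by zero of a function on the interior nodes. -/
noncomputable def extendZero {Mx My : ℕ} (v : EuclideanSpace ℝ (Node Mx My)) (i j : ℕ) : ℝ :=
  if h : (i, j) ∈ Finset.Icc 1 (Mx - 1) ×ˢ Finset.Icc 1 (My - 1) then v ⟨(i, j), h⟩ else 0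

/-- Restriction of a grid function to the interior nodes. -/
noncomputable def restrictInt (Mx My : ℕ) (w : ℕ → ℕ → ℝ) : EuclideanSpace ℝ (Node Mx My) :=
  WithLp.toLp 2 fun z => w z.1.1 z.1.2

lemma restrictInt_apply {Mx My : ℕ} (w : ℕ → ℕ → ℝ) (z : Node Mx My) :
    restrictInt Mx My w z = w z.1.1 z.1.2 := rfl

lemma extendZero_boundary {Mx My : ℕ} (v : EuclideanSpace ℝ (Node Mx My)) :
    BoundaryZero Mx My (extendZero v) := by
  intro i hi j hj h
  rw [extendZero, dif_neg]
  rw [Finset.mem_product, Finset.mem_Icc, Finset.mem_Icc]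
  simp only
  omega

lemma extendZero_restrictInt {Mx My : ℕ} {w : ℕ → ℕ → ℝ} (hw : BoundaryZero Mx My w) {i j : ℕ}
    (hi : i ≤ Mx) (hj : j ≤ My) : extendZero (restrictInt Mx My w) i j = w i j := by
  rw [extendZero]
  split_ifs with h
  · rfl
  · rw [Finset.mem_product, Finset.mem_Icc, Finset.mem_Icc] at h
    simp only at h
    exact (hw i hi j hj (by omega)).symm

lemma discLaplacian_congr {hx hy : ℝ} {Mx My : ℕ} {v w : ℕ → ℕ → ℝ}
    (h : ∀ i ≤ Mx, ∀ j ≤ My, v i j = w i j) {i j : ℕ} (hi : i ∈ Finset.Icc 1 (Mx - 1))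
    (hj : j ∈ Finset.Icc 1 (My - 1)) : discLaplacian hx hy v i j = discLaplacian hx hy w i j := by
  rw [Finset.mem_Icc] at hi hj
  simp only [discLaplacian]
  rw [h (i - 1) (by omega) j (by omega), h i (by omega) j (by omega),
    h (i + 1) (by omega) j (by omega), h i (by omega) (j - 1) (by omega),
    h i (by omega) (j + 1) (by omega)]

/-- The negative discrete Laplacian with zero boundary values. -/
noncomputable def negLap (hx hy : ℝ) (Mx My : ℕ) :
    EuclideanSpace ℝ (Node Mx My) →ₗ[ℝ] EuclideanSpace ℝ (Node Mx My) where
  toFun v := restrictInt Mx My fun i j => -discLaplacian hx hy (extendZero v) i j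
  map_add' v w := by
    have h : ∀ i j, extendZero (v + w) i j = extendZero v i j + extendZero w i j := by
      intro i j
      simp only [extendZero]
      split_ifs <;> simp
    ext z
    simp only [restrictInt_apply, PiLp.add_apply, discLaplacian, h]
    ring
  map_smul' c v := by
    have h : ∀ i j, extendZero (c • v) i j = c * extendZero v i j := by
      intro i j
      simp only [extendZero]
      split_ifs <;> simp
    ext z
    simp only [restrictInt_apply, PiLp.smul_apply, discLaplacian, h, smul_eq_mul, RingHom.id_apply]
    ring

lemma negLap_apply {hx hy : ℝ} {Mx My : ℕ} (v : EuclideanSpace ℝ (Node Mx My)) (z : Node Mx My) :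
    negLap hx hy Mx My v z = -discLaplacian hx hy (extendZero v) z.1.1 z.1.2 := rfl

open scoped InnerProductSpace

lemma sum_node {Mx My : ℕ} (f : ℕ → ℕ → ℝ) :
    ∑ z : Node Mx My, f z.1.1 z.1.2 =
      ∑ i ∈ Finset.Icc 1 (Mx - 1), ∑ j ∈ Finset.Icc 1 (My - 1), f i j := by
  rw [← Finset.sum_product (s := Finset.Icc 1 (Mx - 1)) (t := Finset.Icc 1 (My - 1))
    (f := fun z => f z.1 z.2)]
  exact Finset.sum_coe_sort (Finset.Icc 1 (Mx - 1) ×ˢ Finset.Icc 1 (My - 1)) (fun z => f z.1 z.2)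

lemma inner_restrictInt {Mx My : ℕ} (v w : ℕ → ℕ → ℝ) :
    ⟪restrictInt Mx My v, restrictInt Mx My w⟫_ℝ =
      ∑ i ∈ Finset.Icc 1 (Mx - 1), ∑ j ∈ Finset.Icc 1 (My - 1), v i j * w i j := by
  rw [PiLp.inner_apply, ← sum_node]
  refine Finset.sum_congr rfl fun z _ => ?_
  simp only [restrictInt_apply, RCLike.inner_apply, conj_trivial]
  ring

lemma restrictInt_extendZero {Mx My : ℕ} (v : EuclideanSpace ℝ (Node Mx My)) :
    restrictInt Mx My (extendZero v) = v := by
  ext z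
  rw [restrictInt_apply, extendZero, dif_pos z.2]

lemma inner_negLap {hx hy : ℝ} {Mx My : ℕ} (hMx : 1 ≤ Mx) (hMy : 1 ≤ My)
    (v w : EuclideanSpace ℝ (Node Mx My)) :
    ⟪negLap hx hy Mx My v, w⟫_ℝ = ∑ i ∈ Finset.Icc 1 Mx, ∑ j ∈ Finset.Icc 1 My,
      (dx hx (extendZero v) i j * dx hx (extendZero w) i j +
        dy hy (extendZero v) i j * dy hy (extendZero w) i j) := by
  rw [← sum_neg_discLaplacian_mul hMx hMy (extendZero_boundary v) (extendZero_boundary w),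
    ← inner_restrictInt, restrictInt_extendZero]
  rfl

lemma negLap_isSymmetric {hx hy : ℝ} {Mx My : ℕ} (hMx : 1 ≤ Mx) (hMy : 1 ≤ My) :
    (negLap hx hy Mx My).IsSymmetric := by
  intro v w
  rw [← real_inner_comm, real_inner_comm (negLap hx hy Mx My w) v, inner_negLap hMx hMy,
    real_inner_comm, inner_negLap hMx hMy]
  refine Finset.sum_congr rfl fun i _ => Finset.sum_congr rfl fun j _ => ?_
  ring

lemma inner_negLap_nonneg {hx hy : ℝ} {Mx My : ℕ} (hMx : 1 ≤ Mx) (hMy : 1 ≤ My)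
    (v : EuclideanSpace ℝ (Node Mx My)) : 0 ≤ ⟪negLap hx hy Mx My v, v⟫_ℝ := by
  rw [inner_negLap hMx hMy]
  refine Finset.sum_nonneg fun i _ => Finset.sum_nonneg fun j _ => ?_
  exact add_nonneg (mul_self_nonneg _) (mul_self_nonneg _)

lemma norm_restrictInt_sq (hx hy : ℝ) (Mx My : ℕ) (w : ℕ → ℕ → ℝ) :
    hx * hy * ‖restrictInt Mx My w‖ ^ 2 = normZeroSq hx hy Mx My w := by
  rw [← real_inner_self_eq_norm_sq, inner_restrictInt, normZeroSq]
  simp_rw [pow_two]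

lemma inner_negLap_restrictInt {hx hy : ℝ} {Mx My : ℕ} (hMx : 1 ≤ Mx) (hMy : 1 ≤ My)
    {w : ℕ → ℕ → ℝ} (hw : BoundaryZero Mx My w) :
    hx * hy * ⟪negLap hx hy Mx My (restrictInt Mx My w), restrictInt Mx My w⟫_ℝ =
      seminormGradSq hx hy Mx My w := by
  rw [inner_negLap hMx hMy, seminormGradSq]
  congr 1
  refine Finset.sum_congr rfl fun i hi => Finset.sum_congr rfl fun j hj => ?_
  rw [Finset.mem_Icc] at hi hj
  simp only [dx, dy]
  rw [extendZero_restrictInt hw (by omega) (by omega), extendZero_restrictInt hw (by omega) (by omega),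
    extendZero_restrictInt hw (by omega) (by omega)]
  ring

/-- Stability of the scheme in the discrete `H¹` norm. -/
theorem grid_estimate {p q s : ℕ} {P : Data p q s} (hP : P.Admissible) :
    ∃ C > 0, ∀ Mx My N : ℕ, 0 < Mx → 0 < My → 0 < N →
      ∀ (e R : ℕ → ℕ → ℕ → ℝ) (g : ℕ → ℕ → ℝ) (ρ : ℕ → ℝ) (η : ℝ),
      (∀ n ≤ N, BoundaryZero Mx My (e n)) → (∀ i ≤ Mx, ∀ j ≤ My, e 0 i j = 0) →
      BoundaryZero Mx My g →
      (∀ n ∈ Finset.Icc 1 N, ∀ i ∈ Finset.Icc 1 (Mx - 1), ∀ j ∈ Finset.Icc 1 (My - 1),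
        |R n i j| ≤ η) →
      (∀ n ∈ Finset.Icc 1 N, ∀ i ∈ Finset.Icc 1 (Mx - 1), ∀ j ∈ Finset.Icc 1 (My - 1),
        schemeOp P (P.T / N) (fun n => e n i j)
          (fun n => discLaplacian (P.Lx / Mx) (P.Ly / My) (e n) i j) 0 n =
            R n i j + ρ n * g i j) →
      ∀ n ≤ N, P.b₂ * normZeroSq (P.Lx / Mx) (P.Ly / My) Mx My (e n) +
          P.b₃ * seminormGradSq (P.Lx / Mx) (P.Ly / My) Mx My (e n) ≤
        C * (P.T * P.Lx * P.Ly * η ^ 2) +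
          C * (P.b₂ * normZeroSq (P.Lx / Mx) (P.Ly / My) Mx My g +
            P.b₃ * seminormGradSq (P.Lx / Mx) (P.Ly / My) Mx My g) *
              ((P.T / N) * ∑ n ∈ Finset.Icc 1 N, |ρ n|) ^ 2 := by
  obtain ⟨C, hC0, hC⟩ := hilbert_estimate hP
  refine ⟨C, hC0, ?_⟩
  intro Mx My N hMx hMy hN e R g ρ η heb he0 hg hR heq M hM
  have hT := hP.T_pos
  have hLx := hP.Lx_pos
  have hLy := hP.Ly_pos
  have hMxR : (0 : ℝ) < Mx := by exact_mod_cast hMx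
  have hMyR : (0 : ℝ) < My := by exact_mod_cast hMy
  have hNR : (0 : ℝ) < N := by exact_mod_cast hN
  set hx := P.Lx / Mx with hhx
  set hy := P.Ly / My with hhy
  set τ := P.T / N with hτdef
  have hx0 : 0 < hx := by positivity
  have hy0 : 0 < hy := by positivity
  have hτ : 0 < τ := by positivity
  have hlap : ∀ n ≤ N, ∀ z : Node Mx My, negLap hx hy Mx My (restrictInt Mx My (e n)) z =
      -discLaplacian hx hy (e n) z.1.1 z.1.2 := by
    intro n hn z
    have hz := Finset.mem_product.1 z.2
    rw [negLap_apply, discLaplacian_congr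
      (fun i hi j hj => extendZero_restrictInt (heb n hn) hi hj) hz.1 hz.2]
  have h := hC (EuclideanSpace ℝ (Node Mx My)) (negLap hx hy Mx My) (negLap_isSymmetric hMx hMy)
    (inner_negLap_nonneg hMx hMy) N hN (fun n => restrictInt Mx My (e n))
    (fun n => restrictInt Mx My (R (n + 1))) (restrictInt Mx My g) (fun n => ρ (n + 1))
    (by
      ext z
      have hz := Finset.mem_product.1 z.2
      have h1 := Finset.mem_Icc.1 hz.1
      have h2 := Finset.mem_Icc.1 hz.2
      rw [restrictInt_apply, he0 _ (by omega) _ (by omega)]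
      rfl)
    (by
      intro n hn
      ext z
      have hz := Finset.mem_product.1 z.2
      have h1 := heq (n + 1) (Finset.mem_Icc.2 ⟨by omega, hn⟩) _ hz.1 _ hz.2
      rw [schemeOp_eq] at h1
      rw [PiLp.add_apply, PiLp.add_apply, PiLp.smul_apply, PiLp.smul_apply, restrictInt_apply,
        restrictInt_apply, smul_eq_mul, smul_eq_mul, ← h1]
      congr 1
      · rw [WithLp.ofLp_sum, Finset.sum_apply]
        refine Finset.sum_congr rfl fun k hk => ?_
        have hk := Finset.mem_range.1 hk
        simp only [map_smul, map_sub, PiLp.add_apply, PiLp.smul_apply, PiLp.sub_apply, smul_eq_mul,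
          hlap (k + 1) (by omega), hlap k (by omega), restrictInt_apply, ← hτdef]
      · simp only [map_add, PiLp.add_apply, PiLp.smul_apply, smul_eq_mul,
          hlap (n + 1) (by omega), hlap n (by omega), restrictInt_apply]) M hM
  have h' := mul_le_mul_of_nonneg_left h (mul_pos hx0 hy0).le
  have hl : hx * hy * (P.b₂ * ‖restrictInt Mx My (e M)‖ ^ 2 +
      P.b₃ * ⟪negLap hx hy Mx My (restrictInt Mx My (e M)), restrictInt Mx My (e M)⟫_ℝ) =
      P.b₂ * normZeroSq hx hy Mx My (e M) + P.b₃ * seminormGradSq hx hy Mx My (e M) := by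
    rw [← norm_restrictInt_sq, ← inner_negLap_restrictInt hMx hMy (heb M hM)]
    ring
  rw [hl] at h'
  refine h'.trans ?_
  rw [mul_add]
  apply add_le_add
  · have hRn : ∀ n < N, hx * hy * ‖restrictInt Mx My (R (n + 1))‖ ^ 2 ≤ P.Lx * P.Ly * η ^ 2 := by
      intro n hn
      rw [norm_restrictInt_sq, normZeroSq]
      have h1 : ∑ i ∈ Finset.Icc 1 (Mx - 1), ∑ j ∈ Finset.Icc 1 (My - 1), R (n + 1) i j ^ 2 ≤
          ∑ i ∈ Finset.Icc 1 (Mx - 1), ∑ j ∈ Finset.Icc 1 (My - 1), η ^ 2 := by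
        refine Finset.sum_le_sum fun i hi => Finset.sum_le_sum fun j hj => ?_
        have := hR (n + 1) (Finset.mem_Icc.2 ⟨by omega, hn⟩) i hi j hj
        rw [← sq_abs (R (n + 1) i j)]
        exact pow_le_pow_left₀ (abs_nonneg _) this 2
      simp only [Finset.sum_const, Nat.card_Icc, nsmul_eq_mul] at h1
      have hm1 : ((Mx - 1 + 1 - 1 : ℕ) : ℝ) ≤ Mx := by exact_mod_cast (by omega : Mx - 1 + 1 - 1 ≤ Mx)
      have hm2 : ((My - 1 + 1 - 1 : ℕ) : ℝ) ≤ My := by exact_mod_cast (by omega : My - 1 + 1 - 1 ≤ My)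
      calc _ ≤ hx * hy * (((Mx - 1 + 1 - 1 : ℕ) : ℝ) * (((My - 1 + 1 - 1 : ℕ) : ℝ) * η ^ 2)) :=
            mul_le_mul_of_nonneg_left h1 (by positivity)
        _ ≤ hx * hy * (Mx * (My * η ^ 2)) := by gcongr
        _ = _ := by rw [hhx, hhy]; field_simp
    have h2 : ∑ n ∈ Finset.range M, hx * hy * ‖restrictInt Mx My (R (n + 1))‖ ^ 2 ≤
        N * (P.Lx * P.Ly * η ^ 2) := by
      refine (Finset.sum_le_sum fun n hn => hRn n ((Finset.mem_range.1 hn).trans_le hM)).trans ?_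
      rw [Finset.sum_const, Finset.card_range, nsmul_eq_mul]
      have : (M : ℝ) ≤ N := by exact_mod_cast hM
      gcongr
    rw [← Finset.mul_sum] at h2
    calc _ = C * (τ * (hx * hy * ∑ n ∈ Finset.range M, ‖restrictInt Mx My (R (n + 1))‖ ^ 2)) := by ring
      _ ≤ C * (τ * (N * (P.Lx * P.Ly * η ^ 2))) := by gcongr
      _ = _ := by rw [hτdef]; field_simp
  · have hgl : hx * hy * (P.b₂ * ‖restrictInt Mx My g‖ ^ 2 +
        P.b₃ * ⟪negLap hx hy Mx My (restrictInt Mx My g), restrictInt Mx My g⟫_ℝ) =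
        P.b₂ * normZeroSq hx hy Mx My g + P.b₃ * seminormGradSq hx hy Mx My g := by
      rw [← norm_restrictInt_sq, ← inner_negLap_restrictInt hMx hMy hg]
      ring
    have hg0 : 0 ≤ P.b₂ * normZeroSq hx hy Mx My g + P.b₃ * seminormGradSq hx hy Mx My g := by
      rw [← hgl]
      have h1 := inner_negLap_nonneg (hx := hx) (hy := hy) hMx hMy (restrictInt Mx My g)
      have := hP.b₂_pos
      have := hP.b₃_pos
      positivity
    rw [← hgl] at hg0
    rw [← hgl, sum_Icc_one_eq_range]
    have h3 : ∑ n ∈ Finset.range M, |ρ (n + 1)| ≤ ∑ n ∈ Finset.range N, |ρ (n + 1)| :=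
      Finset.sum_le_sum_of_subset_of_nonneg (Finset.range_subset_range.2 hM) fun _ _ _ => abs_nonneg _
    have h4 : 0 ≤ ∑ n ∈ Finset.range M, |ρ (n + 1)| := Finset.sum_nonneg fun _ _ => abs_nonneg _
    have h5 : (τ * ∑ n ∈ Finset.range M, |ρ (n + 1)|) ^ 2 ≤ (τ * ∑ n ∈ Finset.range N, |ρ (n + 1)|) ^ 2 :=
      pow_le_pow_left₀ (by positivity) (mul_le_mul_of_nonneg_left h3 hτ.le) 2
    calc _ = C * (hx * hy * (P.b₂ * ‖restrictInt Mx My g‖ ^ 2 +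
        P.b₃ * ⟪negLap hx hy Mx My (restrictInt Mx My g), restrictInt Mx My g⟫_ℝ)) *
          (τ * ∑ n ∈ Finset.range M, |ρ (n + 1)|) ^ 2 := by ring
      _ ≤ _ := mul_le_mul_of_nonneg_left h5 (mul_nonneg hC0.le hg0)


/-! ### Taylor estimates in time -/

/-- `v₁` and `v₂` are the first two derivatives of `v` on `[0,T]`, and `v₂` is bounded by `M` and
Lipschitz with constant `M`. -/
structure TimeRegular (T M : ℝ) (v v₁ v₂ : ℝ → ℝ) : Prop where
  deriv₁ : ∀ t ∈ Icc 0 T, HasDerivWithinAt v (v₁ t) (Icc 0 T) t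
  deriv₂ : ∀ t ∈ Icc 0 T, HasDerivWithinAt v₁ (v₂ t) (Icc 0 T) t
  bound : ∀ t ∈ Icc 0 T, |v₂ t| ≤ M
  lipschitz : ∀ a ∈ Icc 0 T, ∀ b ∈ Icc 0 T, |v₂ b - v₂ a| ≤ M * |b - a|

lemma abs_sub_le_of_deriv_bound {T : ℝ} {f f' : ℝ → ℝ}
    (hf : ∀ t ∈ Icc 0 T, HasDerivWithinAt f (f' t) (Icc 0 T) t) {a b C : ℝ} (ha : a ∈ Icc 0 T)
    (hb : b ∈ Icc 0 T) (hC : ∀ x ∈ Icc 0 T, |x - a| ≤ |b - a| → |f' x| ≤ C) :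
    |f b - f a| ≤ C * |b - a| := by
  have hsub : uIcc a b ⊆ Icc 0 T := uIcc_subset_Icc ha hb
  have := (convex_uIcc a b).norm_image_sub_le_of_norm_hasDerivWithin_le (f := f) (f' := f') (C := C)
    (fun x hx => (hf x (hsub hx)).mono hsub)
    (fun x hx => hC x (hsub hx) (abs_sub_left_of_mem_uIcc hx)) left_mem_uIcc right_mem_uIcc
  exact this

section Taylor

variable {T M : ℝ} {v v₁ v₂ : ℝ → ℝ} (h : TimeRegular T M v v₁ v₂)
include h

lemma TimeRegular.continuousOn₁ : ContinuousOn v₁ (Icc 0 T) :=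
  fun t ht => (h.deriv₂ t ht).continuousWithinAt

lemma TimeRegular.continuousOn₂ : ContinuousOn v₂ (Icc 0 T) := by
  apply LipschitzOnWith.continuousOn (K := Real.toNNReal M)
  apply LipschitzOnWith.of_dist_le_mul
  intro a ha b hb
  rw [Real.dist_eq, Real.dist_eq]
  refine (h.lipschitz b hb a ha).trans ?_
  exact mul_le_mul_of_nonneg_right (Real.le_coe_toNNReal M) (abs_nonneg _)

lemma TimeRegular.bound_nonneg (hT : 0 ≤ T) : 0 ≤ M :=
  (abs_nonneg _).trans (h.bound 0 ⟨le_rfl, hT⟩)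

lemma TimeRegular.deriv_sub_le {a b : ℝ} (ha : a ∈ Icc 0 T) (hb : b ∈ Icc 0 T) :
    |v₁ b - v₁ a| ≤ M * |b - a| :=
  abs_sub_le_of_deriv_bound h.deriv₂ ha hb fun x hx _ => h.bound x hx

lemma TimeRegular.deriv_taylor {a b : ℝ} (ha : a ∈ Icc 0 T) (hb : b ∈ Icc 0 T) :
    |v₁ b - v₁ a - v₂ a * (b - a)| ≤ M * |b - a| ^ 2 := by
  have hM := h.bound_nonneg (ha.1.trans ha.2)
  have := abs_sub_le_of_deriv_bound (f := fun x => v₁ x - v₂ a * x) (f' := fun x => v₂ x - v₂ a)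
    (C := M * |b - a|) (fun t ht =>
      ((h.deriv₂ t ht).sub ((hasDerivWithinAt_id t _).const_mul (v₂ a))).congr_deriv
        (by rw [mul_one])) ha hb
    (fun x hx hxa => (h.lipschitz a ha x hx).trans (mul_le_mul_of_nonneg_left hxa hM))
  rw [show v₁ b - v₁ a - v₂ a * (b - a) = v₁ b - v₂ a * b - (v₁ a - v₂ a * a) by ring]
  refine this.trans_eq (by ring)

lemma TimeRegular.taylor_one {a b : ℝ} (ha : a ∈ Icc 0 T) (hb : b ∈ Icc 0 T) :
    |v b - v a - v₁ a * (b - a)| ≤ M * |b - a| ^ 2 := by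
  have hM := h.bound_nonneg (ha.1.trans ha.2)
  have := abs_sub_le_of_deriv_bound (f := fun x => v x - v₁ a * x) (f' := fun x => v₁ x - v₁ a)
    (C := M * |b - a|) (fun t ht =>
      ((h.deriv₁ t ht).sub ((hasDerivWithinAt_id t _).const_mul (v₁ a))).congr_deriv
        (by rw [mul_one])) ha hb
    (fun x hx hxa => (h.deriv_sub_le ha hx).trans (mul_le_mul_of_nonneg_left hxa hM))
  rw [show v b - v a - v₁ a * (b - a) = v b - v₁ a * b - (v a - v₁ a * a) by ring]
  refine this.trans_eq (by ring)

lemma TimeRegular.taylor_two {a b : ℝ} (ha : a ∈ Icc 0 T) (hb : b ∈ Icc 0 T) :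
    |v b - v a - v₁ a * (b - a) - v₂ a * (b - a) ^ 2 / 2| ≤ M * |b - a| ^ 3 := by
  have hM := h.bound_nonneg (ha.1.trans ha.2)
  have := abs_sub_le_of_deriv_bound (f := fun x => v x - v₁ a * x - v₂ a * (x - a) ^ 2 / 2)
    (f' := fun x => v₁ x - v₁ a - v₂ a * (x - a))
    (C := M * |b - a| ^ 2) (fun t ht => by
      have h1 := (((hasDerivWithinAt_id t (Icc 0 T)).sub_const a).pow 2).const_mul (v₂ a)
      refine (((h.deriv₁ t ht).sub ((hasDerivWithinAt_id t _).const_mul (v₁ a))).sub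
        (h1.div_const 2)).congr_deriv ?_
      simp only [id]
      push_cast
      ring) ha hb
    (fun x hx hxa => (h.deriv_taylor ha hx).trans
      (mul_le_mul_of_nonneg_left (pow_le_pow_left₀ (abs_nonneg _) hxa 2) hM))
  rw [show v b - v a - v₁ a * (b - a) - v₂ a * (b - a) ^ 2 / 2 =
    v b - v₁ a * b - v₂ a * (b - a) ^ 2 / 2 - (v a - v₁ a * a - v₂ a * (a - a) ^ 2 / 2) by ring]
  refine this.trans_eq (by ring)

variable {τ : ℝ} (hτ : 0 < τ) {n : ℕ} (hn : 1 ≤ n) (hnT : (n : ℝ) * τ ≤ T)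
include hτ hn hnT

omit h in
lemma mem_Icc_levels : ((n : ℝ) - 1 / 2) * τ ∈ Icc 0 T ∧ (n : ℝ) * τ ∈ Icc 0 T ∧
    ((n - 1 : ℕ) : ℝ) * τ ∈ Icc 0 T := by
  have hn1 : (1 : ℝ) ≤ n := by exact_mod_cast hn
  rw [Nat.cast_sub hn, Nat.cast_one]
  refine ⟨⟨?_, ?_⟩, ⟨?_, hnT⟩, ⟨?_, ?_⟩⟩ <;> nlinarith

lemma TimeRegular.diffQuot_le :
    |diffQuot τ (fun k => v (k * τ)) n - v₁ (((n : ℝ) - 1 / 2) * τ)| ≤ M * τ ^ 2 := by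
  obtain ⟨h0, h1, h2⟩ := mem_Icc_levels hτ hn hnT
  have e1 := h.taylor_two h0 h1
  have e2 := h.taylor_two h0 h2
  have hM := h.bound_nonneg (h0.1.trans h0.2)
  simp only [diffQuot]
  have hc : ((n - 1 : ℕ) : ℝ) = (n : ℝ) - 1 := by rw [Nat.cast_sub hn, Nat.cast_one]
  rw [hc] at e2 ⊢
  set c := ((n : ℝ) - 1 / 2) * τ with hcdef
  rw [show (n : ℝ) * τ - c = τ / 2 by rw [hcdef]; ring, abs_of_pos (half_pos hτ)] at e1
  rw [show ((n : ℝ) - 1) * τ - c = -(τ / 2) by rw [hcdef]; ring, abs_neg,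
    abs_of_pos (half_pos hτ)] at e2
  have e3 : (v (n * τ) - v (((n : ℝ) - 1) * τ)) / τ - v₁ c =
      ((v (n * τ) - v c - v₁ c * (τ / 2) - v₂ c * (τ / 2) ^ 2 / 2) -
        (v (((n : ℝ) - 1) * τ) - v c - v₁ c * -(τ / 2) - v₂ c * (-(τ / 2)) ^ 2 / 2)) / τ := by
    field_simp
    ring
  rw [e3, abs_div, abs_of_pos hτ, div_le_iff₀ hτ]
  refine (abs_sub _ _).trans ((add_le_add e1 e2).trans ?_)
  have : 0 ≤ M * τ ^ 3 := by positivity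
  nlinarith

lemma TimeRegular.mean_le :
    |(v (n * τ) + v ((n - 1 : ℕ) * τ)) / 2 - v (((n : ℝ) - 1 / 2) * τ)| ≤ M * τ ^ 2 := by
  obtain ⟨h0, h1, h2⟩ := mem_Icc_levels hτ hn hnT
  have e1 := h.taylor_one h0 h1
  have e2 := h.taylor_one h0 h2
  have hM := h.bound_nonneg (h0.1.trans h0.2)
  have hc : ((n - 1 : ℕ) : ℝ) = (n : ℝ) - 1 := by rw [Nat.cast_sub hn, Nat.cast_one]
  rw [hc] at e2 ⊢
  set c := ((n : ℝ) - 1 / 2) * τ with hcdef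
  rw [show (n : ℝ) * τ - c = τ / 2 by rw [hcdef]; ring, abs_of_pos (half_pos hτ)] at e1
  rw [show ((n : ℝ) - 1) * τ - c = -(τ / 2) by rw [hcdef]; ring, abs_neg,
    abs_of_pos (half_pos hτ)] at e2
  have e3 : (v (n * τ) + v (((n : ℝ) - 1) * τ)) / 2 - v c =
      ((v (n * τ) - v c - v₁ c * (τ / 2)) +
        (v (((n : ℝ) - 1) * τ) - v c - v₁ c * -(τ / 2))) / 2 := by ring
  rw [e3, abs_div, abs_two, div_le_iff₀ two_pos]
  refine (abs_add_le _ _).trans ((add_le_add e1 e2).trans ?_)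
  have : 0 ≤ M * τ ^ 2 := by positivity
  nlinarith

end Taylor

/-! ### Weakly singular integrals -/

lemma intervalIntegrable_rpow_mul {α a b : ℝ} (hα : α < 1) {g : ℝ → ℝ}
    (hg : ContinuousOn g (uIcc a b)) :
    IntervalIntegrable (fun x => x ^ (-α) * g x) MeasureTheory.volume a b :=
  (intervalIntegral.intervalIntegrable_rpow' (by linarith)).mul_continuousOn hg

lemma integral_rpow_neg {α a b : ℝ} (hα : α < 1) :
    (1 - α) * ∫ x in a..b, x ^ (-α) = b ^ (1 - α) - a ^ (1 - α) := by
  rw [integral_rpow (Or.inl (by linarith)), show -α + 1 = 1 - α by ring]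
  have : 1 - α ≠ 0 := by linarith
  field_simp

lemma abs_integral_rpow_sub_le {α a b ε : ℝ} (hα : α < 1) (ha : 0 ≤ a) (hab : a ≤ b)
    {g k : ℝ → ℝ} (hg : ContinuousOn g (Icc a b)) (hk : ContinuousOn k (Icc a b))
    (hle : ∀ x ∈ Icc a b, |g x - k x| ≤ ε) :
    |(1 - α) * (∫ x in a..b, x ^ (-α) * g x) - (1 - α) * ∫ x in a..b, x ^ (-α) * k x| ≤
      ε * (b ^ (1 - α) - a ^ (1 - α)) := by
  rw [← uIcc_of_le hab] at hg hk
  rw [← mul_sub, ← intervalIntegral.integral_sub (intervalIntegrable_rpow_mul hα hg)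
    (intervalIntegrable_rpow_mul hα hk), abs_mul, abs_of_pos (by linarith : 0 < 1 - α)]
  rw [← integral_rpow_neg hα]
  have : |∫ x in a..b, (x ^ (-α) * g x - x ^ (-α) * k x)| ≤ ∫ x in a..b, ε * x ^ (-α) := by
    rw [← Real.norm_eq_abs]
    apply intervalIntegral.norm_integral_le_of_norm_le hab
    · refine Filter.Eventually.of_forall fun x hx => ?_
      have hx0 : 0 ≤ x := ha.trans hx.1.le
      rw [← mul_sub, norm_mul, Real.norm_eq_abs, Real.norm_eq_abs,
        abs_of_nonneg (Real.rpow_nonneg hx0 _), mul_comm]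
      exact mul_le_mul_of_nonneg_right (hle x ⟨hx.1.le, hx.2⟩) (Real.rpow_nonneg hx0 _)
    · exact (intervalIntegral.intervalIntegrable_rpow' (by linarith)).const_mul ε
  rw [intervalIntegral.integral_const_mul] at this
  calc _ ≤ (1 - α) * (ε * ∫ x in a..b, x ^ (-α)) :=
        mul_le_mul_of_nonneg_left this (by linarith)
    _ = _ := by ring

/-- Rescaling of the Caputo integral to the time step. -/
lemma integral_caputo_scale {α τ m : ℝ} (hτ : 0 < τ) (hm : 0 ≤ m) (f : ℝ → ℝ) :
    ∫ s in (0 : ℝ)..(m * τ), (m * τ - s) ^ (-α) * f s =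
      τ ^ (1 - α) * ∫ x in (0 : ℝ)..m, x ^ (-α) * f (m * τ - τ * x) := by
  have h := intervalIntegral.integral_comp_sub_mul (a := 0) (b := m)
    (fun s => (m * τ - s) ^ (-α) * f s) hτ.ne' (m * τ)
  rw [show m * τ - τ * m = 0 by ring, mul_zero, sub_zero, smul_eq_mul] at h
  have h1 : ∫ x in (0 : ℝ)..m, (m * τ - (m * τ - τ * x)) ^ (-α) * f (m * τ - τ * x) =
      τ ^ (-α) * ∫ x in (0 : ℝ)..m, x ^ (-α) * f (m * τ - τ * x) := by
    rw [← intervalIntegral.integral_const_mul]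
    apply intervalIntegral.integral_congr
    intro x hx
    rw [uIcc_of_le hm] at hx
    simp only
    rw [sub_sub_cancel, Real.mul_rpow hτ.le hx.1]
    ring
  rw [h1] at h
  rw [show 1 - α = 1 + -α by ring, Real.rpow_add hτ, Real.rpow_one, mul_assoc, h]
  field_simp

/-! ### Truncation error of the discretization of order between zero and one -/

lemma lowForm_eq_sum (α : ℝ) (x : ℕ → ℝ) (n : ℕ) :
    lowForm α x (n + 1) = aLow α 0 * x (n + 1) + ∑ m ∈ Finset.range n,
      (aLow α (m + 1) * x (n - m) + bLow α (m + 1) * (x (n + 1 - m) - x (n - m))) := by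
  have h1 : ∀ (z : ℕ → ℝ) n, ∑ m ∈ Finset.range (n + 1), cLow α (n + 1) m * z m =
      aLow α 0 * z 0 + ∑ m ∈ Finset.range n,
        (aLow α (m + 1) * z (m + 1) + bLow α (m + 1) * (z m - z (m + 1))) := by
    intro z n
    have h2 : ∑ m ∈ Finset.range (n + 1), cLow α (n + 1) m * z m =
        ∑ m ∈ Finset.range (n + 1), omegaLow α m * z m - bLow α (n + 1) * z n := by
      rw [Finset.sum_range_succ, Finset.sum_range_succ, cLow_eq α le_rfl, if_pos rfl]
      have : ∑ m ∈ Finset.range n, cLow α (n + 1) m * z m = ∑ m ∈ Finset.range n, omegaLow α m * z m := by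
        refine Finset.sum_congr rfl fun m hm => ?_
        have hm := Finset.mem_range.1 hm
        rw [cLow_eq α hm.le, if_neg (by omega), sub_zero]
      rw [this]; ring
    rw [h2]
    clear h2
    induction n with
    | zero => simp [omegaLow]; ring
    | succ n ih =>
      rw [Finset.sum_range_succ, Finset.sum_range_succ (fun m => aLow α (m + 1) * z (m + 1) + _)]
      have h3 : ∑ m ∈ Finset.range (n + 1), omegaLow α m * z m = bLow α (n + 1) * z n +
          (aLow α 0 * z 0 + ∑ m ∈ Finset.range n,
            (aLow α (m + 1) * z (m + 1) + bLow α (m + 1) * (z m - z (m + 1)))) := by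
        linarith
      rw [h3, omegaLow, if_neg (by omega)]
      ring
  rw [lowForm_eq, ← Finset.sum_range_reflect]
  have h4 := h1 (fun m => x (n + 1 - m)) n
  simp only [Nat.sub_zero] at h4
  rw [show aLow α 0 * x (n + 1) + ∑ m ∈ Finset.range n,
      (aLow α (m + 1) * x (n - m) + bLow α (m + 1) * (x (n + 1 - m) - x (n - m))) =
      aLow α 0 * x (n + 1) + ∑ m ∈ Finset.range n, (aLow α (m + 1) * x (n + 1 - (m + 1)) +
        bLow α (m + 1) * (x (n + 1 - m) - x (n + 1 - (m + 1)))) by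
    congr 1
    refine Finset.sum_congr rfl fun m _ => ?_
    rw [show n + 1 - (m + 1) = n - m by omega], ← h4]
  refine Finset.sum_congr rfl fun m hm => ?_
  have hm := Finset.mem_range.1 hm
  rw [show n - (n + 1 - 1 - m) = m by omega, show n + 1 - 1 - m + 1 = n + 1 - m by omega]

lemma abs_integral_piece_le {α : ℝ} (hα : α ∈ Ioo (0 : ℝ) 1) {k : ℕ} (hk : 1 ≤ k) {g : ℝ → ℝ}
    (hg : ContinuousOn g (Icc ((k : ℝ) - 1 / 2) (k + 1 / 2))) {A B ε : ℝ}
    (hle : ∀ y ∈ Icc (-(1 / 2) : ℝ) (1 / 2), |g (k + y) - (A + B * y)| ≤ ε) :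
    |(1 - α) * (∫ x in ((k : ℝ) - 1 / 2)..(k + 1 / 2), x ^ (-α) * g x) -
      (A * aLow α k - B * bLow α k)| ≤
      ε * (((k : ℝ) + 1 / 2) ^ (1 - α) - ((k : ℝ) - 1 / 2) ^ (1 - α)) := by
  have hk1 : (1 : ℝ) ≤ k := by exact_mod_cast hk
  have e : A * aLow α k - B * bLow α k =
      (1 - α) * ∫ x in ((k : ℝ) - 1 / 2)..(k + 1 / 2), x ^ (-α) * (A + B * (x - k)) := by
    rw [← integral_affine_rpow hα A B hk]
    congr 1
    have := intervalIntegral.integral_comp_add_left (a := -(1 / 2)) (b := 1 / 2)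
      (fun x : ℝ => x ^ (-α) * (A + B * (x - k))) (k : ℝ)
    rw [show (k : ℝ) + -(1 / 2) = k - 1 / 2 by ring] at this
    rw [← this]
    apply intervalIntegral.integral_congr
    intro y _
    simp only [add_sub_cancel_left]
    ring
  rw [e]
  apply abs_integral_rpow_sub_le hα.2 (by linarith) (by linarith) hg (by fun_prop)
  intro x hx
  have := hle (x - k) ⟨by linarith [hx.1], by linarith [hx.2]⟩
  rwa [add_sub_cancel] at this

lemma abs_integral_sub_lowForm_le {α : ℝ} (hα : α ∈ Ioo (0 : ℝ) 1) {ε₁ ε₂ : ℝ} (hε₁ : 0 ≤ ε₁)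
    (hε₂ : 0 ≤ ε₂)
    {g : ℝ → ℝ} {x : ℕ → ℝ} {n : ℕ} (hg : ContinuousOn g (Icc 0 ((n : ℝ) + 1 / 2)))
    (h0 : ∀ y ∈ Icc (0 : ℝ) (1 / 2), |g y - x (n + 1)| ≤ ε₁)
    (hm : ∀ m < n, ∀ y ∈ Icc (-(1 / 2) : ℝ) (1 / 2),
      |g ((m : ℝ) + 1 + y) - (x (n - m) - (x (n + 1 - m) - x (n - m)) * y)| ≤ ε₂) :
    |(1 - α) * (∫ y in (0 : ℝ)..((n : ℝ) + 1 / 2), y ^ (-α) * g y) - lowForm α x (n + 1)| ≤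
      ε₁ + ε₂ * ((n : ℝ) + 1 / 2) ^ (1 - α) := by
  have hα1 := hα.2
  have key : ∀ j ≤ n, |(1 - α) * (∫ y in (0 : ℝ)..((j : ℝ) + 1 / 2), y ^ (-α) * g y) -
      (aLow α 0 * x (n + 1) + ∑ m ∈ Finset.range j,
      (aLow α (m + 1) * x (n - m) + bLow α (m + 1) * (x (n + 1 - m) - x (n - m))))| ≤
      ε₁ + ε₂ * ((j : ℝ) + 1 / 2) ^ (1 - α) := by
    intro j
    induction j with
    | zero =>
      intro _
      have hn0 : (0 : ℝ) ≤ n := by positivity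
      have h1 := abs_integral_rpow_sub_le (α := α) (a := 0) (b := 1 / 2) (ε := ε₁) hα1 le_rfl
        (by norm_num) (g := g) (k := fun _ => x (n + 1))
        (hg.mono (Icc_subset_Icc le_rfl (by linarith))) (by fun_prop) h0
      rw [intervalIntegral.integral_mul_const, ← mul_assoc, integral_rpow_neg hα1,
        Real.zero_rpow (by linarith : 1 - α ≠ 0), sub_zero] at h1
      simp only [Nat.cast_zero, zero_add, Finset.range_zero, Finset.sum_empty, add_zero, aLow,
        if_true]
      have h2 : (1 / 2 : ℝ) ^ (1 - α) ≤ 1 :=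
        Real.rpow_le_one (by norm_num) (by norm_num) (by linarith)
      have h3 : (0 : ℝ) ≤ (1 / 2) ^ (1 - α) := by positivity
      nlinarith
    | succ j ih =>
      intro hj
      have ih := ih (by omega)
      have hjn : (j : ℝ) + 1 ≤ n := by exact_mod_cast hj
      have hj0 : (0 : ℝ) ≤ j := by positivity
      have h1 := abs_integral_piece_le hα (k := j + 1) (by omega) (g := g) (A := x (n - j))
        (B := -(x (n + 1 - j) - x (n - j))) (ε := ε₂)
        (hg.mono (Icc_subset_Icc (by push_cast; linarith) (by push_cast; linarith))) (by
          intro y hy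
          have := hm j (by omega) y hy
          push_cast
          rwa [neg_mul, ← sub_eq_add_neg])
      have hsplit := intervalIntegral.integral_add_adjacent_intervals (μ := MeasureTheory.volume)
        (a := 0) (b := (j : ℝ) + 1 / 2) (c := (j : ℝ) + 1 + 1 / 2) (f := fun y => y ^ (-α) * g y)
        (intervalIntegrable_rpow_mul hα1 (hg.mono (by
          rw [uIcc_of_le (by linarith)]
          exact Icc_subset_Icc le_rfl (by linarith))))
        (intervalIntegrable_rpow_mul hα1 (hg.mono (by
          rw [uIcc_of_le (by linarith)]
          exact Icc_subset_Icc (by linarith) (by linarith))))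
      push_cast at h1 ⊢
      rw [show (j : ℝ) + 1 - 1 / 2 = j + 1 / 2 by ring] at h1
      rw [← hsplit, Finset.sum_range_succ]
      rw [abs_le] at ih h1 ⊢
      constructor <;> nlinarith [ih.1, ih.2, h1.1, h1.2]
  rw [lowForm_eq_sum]
  exact key n le_rfl

/-- Truncation error of the discretization of `caputo₁` at the midpoint of a time step. -/
theorem low_truncation {T M α : ℝ} (hα : α ∈ Ioo (0 : ℝ) 1) {v v₁ v₂ : ℝ → ℝ}
    (h : TimeRegular T M v v₁ v₂) {τ : ℝ} (hτ : 0 < τ) {n : ℕ} (hn : 1 ≤ n)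
    (hnT : (n : ℝ) * τ ≤ T) :
    |τ ^ (1 - α) / Real.Gamma (2 - α) * lowForm α (diffQuot τ fun k => v (k * τ)) n -
      caputo₁ T α v (((n : ℝ) - 1 / 2) * τ)| ≤
      (1 + 4 * T) / Real.Gamma (2 - α) * M * τ ^ (2 - α) := by
  obtain ⟨j, rfl⟩ : ∃ j, n = j + 1 := ⟨n - 1, by omega⟩
  have hj0 : (0 : ℝ) ≤ j := by positivity
  push_cast at hnT
  rw [show (((j + 1 : ℕ) : ℝ) - 1 / 2) = (j : ℝ) + 1 / 2 by push_cast; ring]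
  set t := ((j : ℝ) + 1 / 2) * τ with ht
  have htT : t ≤ T := by nlinarith
  have ht0 : 0 < t := by positivity
  have hT : 0 < T := by linarith
  have hτT : τ ≤ T := by nlinarith
  have hM := h.bound_nonneg hT.le
  have hmem : ∀ y ∈ Icc (0 : ℝ) ((j : ℝ) + 1 / 2), t - τ * y ∈ Icc 0 T := by
    intro y hy
    constructor
    · have := mul_le_mul_of_nonneg_left hy.2 hτ.le
      rw [ht]; linarith
    · have := mul_nonneg hτ.le hy.1
      linarith
  have hcap : caputo₁ T α v t = τ ^ (1 - α) / Real.Gamma (2 - α) *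
      ((1 - α) * ∫ y in (0 : ℝ)..((j : ℝ) + 1 / 2), y ^ (-α) * v₁ (t - τ * y)) := by
    rw [caputo₁, ht, integral_caputo_scale hτ (by positivity)]
    have hG : Real.Gamma (2 - α) = (1 - α) * Real.Gamma (1 - α) := by
      rw [← Real.Gamma_add_one (by linarith [hα.2] : 1 - α ≠ 0)]
      congr 1; ring
    have hG0 : 0 < Real.Gamma (1 - α) := Real.Gamma_pos_of_pos (by linarith [hα.2])
    have hα0 : 1 - α ≠ 0 := by linarith [hα.2]
    have hI : ∫ x in (0 : ℝ)..((j : ℝ) + 1 / 2), x ^ (-α) *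
        derivWithin v (Icc 0 T) (((j : ℝ) + 1 / 2) * τ - τ * x) =
        ∫ y in (0 : ℝ)..((j : ℝ) + 1 / 2), y ^ (-α) * v₁ (((j : ℝ) + 1 / 2) * τ - τ * y) := by
      apply intervalIntegral.integral_congr
      intro y hy
      rw [uIcc_of_le (by positivity)] at hy
      have hy' := hmem y hy
      simp only
      rw [(h.deriv₁ _ hy').derivWithin (uniqueDiffOn_Icc hT _ hy')]
    rw [hI, hG]
    field_simp
  rw [hcap, ← mul_sub, abs_mul, abs_of_pos (div_pos (Real.rpow_pos_of_pos hτ _)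
    (Real.Gamma_pos_of_pos (by linarith [hα.2])))]
  set x := diffQuot τ fun k => v (k * τ) with hx
  have hdq : ∀ k, 1 ≤ k → k ≤ j + 1 → |x k - v₁ (((k : ℝ) - 1 / 2) * τ)| ≤ M * τ ^ 2 := by
    intro k hk1 hk2
    apply h.diffQuot_le hτ hk1
    have : (k : ℝ) ≤ j + 1 := by exact_mod_cast hk2
    nlinarith
  have hmain := abs_integral_sub_lowForm_le hα (ε₁ := M * (1 + T) * τ) (ε₂ := 3 * M * τ ^ 2)
    (by positivity) (by positivity)
    (g := fun y => v₁ (t - τ * y)) (x := x) (n := j)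
    (h.continuousOn₁.comp (by fun_prop) hmem)
    (by
      intro y hy
      have h1 := hdq (j + 1) (by omega) le_rfl
      rw [show (((j + 1 : ℕ) : ℝ) - 1 / 2) = (j : ℝ) + 1 / 2 by push_cast; ring, ← ht] at h1
      have h2 := h.deriv_sub_le (a := t) (b := t - τ * y) ⟨ht0.le, htT⟩
        (hmem y ⟨hy.1, by linarith [hy.2]⟩)
      rw [sub_sub_cancel_left, abs_neg, abs_of_nonneg (mul_nonneg hτ.le hy.1)] at h2
      have h3 : M * (τ * y) ≤ M * τ := by
        apply mul_le_mul_of_nonneg_left _ hM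
        nlinarith [hy.2]
      have h4 : M * τ ^ 2 ≤ M * T * τ := by
        rw [pow_two, ← mul_assoc]
        exact mul_le_mul_of_nonneg_right (mul_le_mul_of_nonneg_left hτT hM) hτ.le
      rw [abs_le] at h1 h2 ⊢
      constructor <;> linarith [h1.1, h1.2, h2.1, h2.2])
    (by
      intro m hm y hy
      have hmj : (m : ℝ) + 1 ≤ j := by exact_mod_cast hm
      have hm0 : (0 : ℝ) ≤ m := by positivity
      have hcast : ((j - m : ℕ) : ℝ) = (j : ℝ) - m := by rw [Nat.cast_sub hm.le]
      have hcast' : ((j + 1 - m : ℕ) : ℝ) = (j : ℝ) + 1 - m := by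
        rw [Nat.cast_sub (by omega)]; push_cast; ring
      have h1 := hdq (j - m) (by omega) (by omega)
      have h2 := hdq (j + 1 - m) (by omega) (by omega)
      rw [hcast] at h1
      rw [hcast'] at h2
      set c := ((j : ℝ) - m - 1 / 2) * τ with hc
      rw [show ((j : ℝ) + 1 - m - 1 / 2) * τ = c + τ by rw [hc]; ring] at h2
      have hcm : c ∈ Icc 0 T := by
        constructor
        · rw [hc]; exact mul_nonneg (by linarith) hτ.le
        · rw [hc]; nlinarith
      have hcm' : c + τ ∈ Icc 0 T := by
        constructor
        · linarith [hcm.1]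
        · rw [hc]; nlinarith
      have hpt : t - τ * ((m : ℝ) + 1 + y) = c - τ * y := by rw [ht, hc]; ring
      have hcy : c - τ * y ∈ Icc 0 T := by
        rw [← hpt]
        exact hmem _ ⟨by linarith [hy.1], by linarith [hy.2]⟩
      have h3 := h.deriv_taylor hcm hcy
      have h4 := h.deriv_taylor hcm hcm'
      rw [sub_sub_cancel_left, abs_neg, abs_mul, abs_of_pos hτ] at h3
      rw [add_sub_cancel_left, abs_of_pos hτ] at h4
      rw [hpt]
      have hyabs : |y| ≤ 1 / 2 := abs_le.2 hy
      have h5 : M * (τ * |y|) ^ 2 ≤ M * τ ^ 2 / 4 := by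
        have : |y| ^ 2 ≤ 1 / 4 := by nlinarith [abs_nonneg y]
        have h6 : 0 ≤ M * τ ^ 2 := by positivity
        calc M * (τ * |y|) ^ 2 = M * τ ^ 2 * |y| ^ 2 := by ring
          _ ≤ M * τ ^ 2 * (1 / 4) := mul_le_mul_of_nonneg_left this h6
          _ = _ := by ring
      have h6 : |(x (j + 1 - m) - x (j - m) - v₂ c * τ) * y| ≤ 3 * (M * τ ^ 2) * (1 / 2) := by
        rw [abs_mul]
        apply mul_le_mul _ hyabs (abs_nonneg _) (by positivity)
        rw [abs_le] at h1 h2 h4 ⊢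
        constructor <;> linarith [h1.1, h1.2, h2.1, h2.2, h4.1, h4.2]
      have e : v₁ (c - τ * y) - (x (j - m) - (x (j + 1 - m) - x (j - m)) * y) =
          (v₁ (c - τ * y) - v₁ c - v₂ c * -(τ * y)) - (x (j - m) - v₁ c) +
          (x (j + 1 - m) - x (j - m) - v₂ c * τ) * y := by ring
      rw [e]
      have hnn : 0 ≤ M * τ ^ 2 := by positivity
      rw [abs_le] at h1 h3 h6 ⊢
      constructor <;> linarith [h1.1, h1.2, h3.1, h3.2, h6.1, h6.2])
  rw [abs_sub_comm]
  have hG0 : 0 < Real.Gamma (2 - α) := Real.Gamma_pos_of_pos (by linarith [hα.2])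
  have hα1 : 0 < 1 - α := by linarith [hα.2]
  have hp1 : τ ^ (1 - α) * ((j : ℝ) + 1 / 2) ^ (1 - α) ≤ T ^ (1 - α) := by
    rw [← Real.mul_rpow hτ.le (by positivity)]
    apply Real.rpow_le_rpow (by positivity) _ hα1.le
    rw [mul_comm]; exact htT
  have hp2 : τ ^ (1 - α) * τ = τ ^ (2 - α) := by
    rw [show 2 - α = (1 - α) + 1 by ring, Real.rpow_add hτ, Real.rpow_one]
  have hp3 : T ^ (1 - α) * τ ^ 2 ≤ T * τ ^ (2 - α) := by
    have h1 : τ ^ 2 = τ ^ (2 - α) * τ ^ α := by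
      rw [← Real.rpow_add hτ, show 2 - α + α = (2 : ℕ) by push_cast; ring, Real.rpow_natCast]
    have h2 : τ ^ α ≤ T ^ α := Real.rpow_le_rpow hτ.le hτT hα.1.le
    have h3 : T = T ^ (1 - α) * T ^ α := by
      rw [← Real.rpow_add hT]; simp
    rw [h1]
    calc _ ≤ T ^ (1 - α) * (τ ^ (2 - α) * T ^ α) := by gcongr
      _ = T ^ (1 - α) * T ^ α * τ ^ (2 - α) := by ring
      _ = _ := by rw [← h3]
  calc _ ≤ τ ^ (1 - α) / Real.Gamma (2 - α) *
        (M * (1 + T) * τ + 3 * M * τ ^ 2 * ((j : ℝ) + 1 / 2) ^ (1 - α)) :=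
        mul_le_mul_of_nonneg_left hmain (by positivity)
    _ = (M * (1 + T) * (τ ^ (1 - α) * τ) +
        3 * M * τ ^ 2 * (τ ^ (1 - α) * ((j : ℝ) + 1 / 2) ^ (1 - α))) / Real.Gamma (2 - α) := by
        field_simp
    _ ≤ (M * (1 + T) * τ ^ (2 - α) + 3 * M * (T * τ ^ (2 - α))) / Real.Gamma (2 - α) := by
        rw [hp2]
        apply div_le_div_of_nonneg_right _ hG0.le
        apply add_le_add le_rfl
        calc _ ≤ 3 * M * τ ^ 2 * T ^ (1 - α) := by gcongr
          _ = 3 * M * (T ^ (1 - α) * τ ^ 2) := by ring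
          _ ≤ _ := by gcongr
    _ = _ := by field_simp; ring


/-! ### Truncation error of the discretization of order between one and two -/

section

variable {γ : ℝ}

lemma aHigh_succ_le (hγ : γ ∈ Ioo (1 : ℝ) 2) (m : ℕ) :
    aHigh γ (m + 1) ≤ (2 - γ) * ((m : ℝ) + 1) ^ (1 - γ) := by
  have hp : 0 < 2 - γ := by linarith [hγ.2]
  have hm : (0 : ℝ) ≤ m := by positivity
  obtain ⟨ξ, hξ, e⟩ := exists_hasDerivAt_eq_slope (fun x : ℝ => x ^ (2 - γ))
    (fun x => (2 - γ) * x ^ (1 - γ)) (a := (m : ℝ) + 1) (b := m + 1 + 1) (by linarith)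
    (fun x hx => (Real.continuousAt_rpow_const _ _ (Or.inr hp.le)).continuousWithinAt)
    (fun x hx => by
      have := Real.hasDerivAt_rpow_const (p := 2 - γ) (x := x) (Or.inl (by linarith [hx.1]))
      rwa [show 2 - γ - 1 = 1 - γ by ring] at this)
  simp only [aHigh]
  push_cast
  have h1 : ξ ^ (1 - γ) ≤ ((m : ℝ) + 1) ^ (1 - γ) :=
    Real.rpow_le_rpow_of_nonpos (by linarith) hξ.1.le (by linarith [hγ.1])
  have h2 := mul_le_mul_of_nonneg_left h1 hp.le
  rw [e, add_sub_cancel_left, div_one] at h2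
  exact h2

lemma rpow_sub_rpow_midpoint (hγ : γ ∈ Ioo (1 : ℝ) 2) {x : ℝ} (hx : 0 ≤ x) :
    (x + 1) ^ (2 - γ) - (x + 1 / 2) ^ (2 - γ) ≤ (x + 1 / 2) ^ (2 - γ) - x ^ (2 - γ) := by
  have hc := Real.concaveOn_rpow (p := 2 - γ) (by linarith [hγ.2]) (by linarith [hγ.1])
  have hx1 : x + 1 ∈ Ici (0 : ℝ) := by simp only [mem_Ici]; linarith
  have hc' := hc.2
  have := hc' (show x ∈ Ici (0 : ℝ) from hx) hx1 (a := 1 / 2) (b := 1 / 2) (by norm_num)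
    (by norm_num) (by norm_num)
  simp only [smul_eq_mul] at this
  rw [show 1 / 2 * x + 1 / 2 * (x + 1) = x + 1 / 2 by ring] at this
  linarith

/-- The weight of the initial second derivative in the truncation error. -/
noncomputable def initialWeight (γ : ℝ) (n : ℕ) : ℝ :=
  aHigh γ (n - 1) / 2 - (((n : ℝ) - 1 / 2) ^ (2 - γ) - ((n : ℝ) - 1) ^ (2 - γ))

lemma abs_initialWeight_le (hγ : γ ∈ Ioo (1 : ℝ) 2) (n : ℕ) :
    |initialWeight γ (n + 1)| ≤
      ((((n : ℝ) + 1 / 2) ^ (2 - γ) - (n : ℝ) ^ (2 - γ)) -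
        (((n : ℝ) + 1 + 1 / 2) ^ (2 - γ) - ((n : ℝ) + 1) ^ (2 - γ))) / 2 := by
  have hn : (0 : ℝ) ≤ n := by positivity
  have h1 := rpow_sub_rpow_midpoint hγ hn
  have h2 := rpow_sub_rpow_midpoint hγ (x := (n : ℝ) + 1 / 2) (by linarith)
  rw [show (n : ℝ) + 1 / 2 + 1 = n + 1 + 1 / 2 by ring,
    show (n : ℝ) + 1 / 2 + 1 / 2 = n + 1 by ring] at h2
  simp only [initialWeight, aHigh, Nat.add_sub_cancel]
  push_cast
  rw [show (n : ℝ) + 1 - 1 / 2 = n + 1 / 2 by ring, show (n : ℝ) + 1 - 1 = n by ring, abs_le]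
  constructor <;> linarith

lemma sum_abs_initialWeight_le (hγ : γ ∈ Ioo (1 : ℝ) 2) (N : ℕ) :
    ∑ n ∈ Finset.Icc 1 N, |initialWeight γ n| ≤ 1 / 2 := by
  rw [sum_Icc_one_eq_range]
  have h : ∑ n ∈ Finset.range N, |initialWeight γ (n + 1)| ≤
      ((1 / 2 : ℝ) ^ (2 - γ) - (((N : ℝ) + 1 / 2) ^ (2 - γ) - (N : ℝ) ^ (2 - γ))) / 2 := by
    induction N with
    | zero =>
      have : (0 : ℝ) ^ (2 - γ) = 0 := Real.zero_rpow (by linarith [hγ.2])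
      simp [this]
    | succ N ih =>
      rw [Finset.sum_range_succ]
      have := abs_initialWeight_le hγ N
      push_cast
      linarith
  have h1 : (1 / 2 : ℝ) ^ (2 - γ) ≤ 1 :=
    Real.rpow_le_one (by norm_num) (by norm_num) (by linarith [hγ.2])
  have h2 : (N : ℝ) ^ (2 - γ) ≤ ((N : ℝ) + 1 / 2) ^ (2 - γ) :=
    Real.rpow_le_rpow (by positivity) (by linarith) (by linarith [hγ.2])
  linarith

lemma abs_integral_sub_mean_le (hγ : γ ∈ Ioo (1 : ℝ) 2) {m : ℕ} {g : ℝ → ℝ} {G ε : ℝ}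
    (hg : ContinuousOn g (Icc (m : ℝ) (m + 1))) (hG : ∫ y in (m : ℝ)..(m + 1), g y = G)
    (hle : ∀ y ∈ Icc (m : ℝ) (m + 1), |g y - G| ≤ ε) :
    |(2 - γ) * (∫ y in (m : ℝ)..(m + 1), y ^ (1 - γ) * g y) - aHigh γ m * G| ≤
      ε * (aHigh γ m - (2 - γ) * ((m : ℝ) + 1) ^ (1 - γ)) := by
  have hm : (0 : ℝ) ≤ m := by positivity
  have hab : (m : ℝ) ≤ m + 1 := by linarith
  have hp : 0 < 2 - γ := by linarith [hγ.2]
  set c := ((m : ℝ) + 1) ^ (1 - γ) with hc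
  have ha : aHigh γ m = (2 - γ) * ∫ y in (m : ℝ)..(m + 1), y ^ (1 - γ) := by
    have := integral_rpow_neg (α := γ - 1) (a := m) (b := m + 1) (by linarith [hγ.2])
    rw [show 1 - (γ - 1) = 2 - γ by ring, neg_sub] at this
    rw [this, aHigh]
  have hg' : ContinuousOn g (uIcc (m : ℝ) (m + 1)) := by rwa [uIcc_of_le hab]
  have hi1 : IntervalIntegrable (fun y => y ^ (1 - γ) * g y) MeasureTheory.volume m (m + 1) := by
    have := intervalIntegrable_rpow_mul (α := γ - 1) (by linarith [hγ.2]) hg'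
    rwa [neg_sub] at this
  have hi2 : IntervalIntegrable (fun y : ℝ => y ^ (1 - γ)) MeasureTheory.volume m (m + 1) :=
    intervalIntegral.intervalIntegrable_rpow' (by linarith [hγ.2])
  have hi3 : IntervalIntegrable g MeasureTheory.volume m (m + 1) := hg'.intervalIntegrable
  have hi4 : IntervalIntegrable (fun y : ℝ => y ^ (1 - γ) - c) MeasureTheory.volume m (m + 1) :=
    hi2.sub intervalIntegrable_const
  have e : (∫ y in (m : ℝ)..(m + 1), y ^ (1 - γ) * g y) -
      (∫ y in (m : ℝ)..(m + 1), y ^ (1 - γ)) * G =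
      ∫ y in (m : ℝ)..(m + 1), (y ^ (1 - γ) - c) * (g y - G) := by
    have : ∫ y in (m : ℝ)..(m + 1), (y ^ (1 - γ) - c) * (g y - G) =
        ∫ y in (m : ℝ)..(m + 1), ((y ^ (1 - γ) * g y - y ^ (1 - γ) * G) - (c * g y - c * G)) := by
      congr 1
      ext y
      ring
    rw [this, intervalIntegral.integral_sub (hi1.sub (hi2.mul_const _))
      ((hi3.const_mul _).sub intervalIntegrable_const),
      intervalIntegral.integral_sub hi1 (hi2.mul_const _),
      intervalIntegral.integral_sub (hi3.const_mul _) intervalIntegrable_const,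
      intervalIntegral.integral_mul_const, intervalIntegral.integral_const_mul, hG,
      intervalIntegral.integral_const]
    simp
  have hbound : |∫ y in (m : ℝ)..(m + 1), (y ^ (1 - γ) - c) * (g y - G)| ≤
      ∫ y in (m : ℝ)..(m + 1), ε * (y ^ (1 - γ) - c) := by
    rw [← Real.norm_eq_abs]
    apply intervalIntegral.norm_integral_le_of_norm_le hab
    · refine Filter.Eventually.of_forall fun y hy => ?_
      have h0 : 0 ≤ y ^ (1 - γ) - c := sub_nonneg.2
        (Real.rpow_le_rpow_of_nonpos (by linarith [hy.1]) hy.2 (by linarith [hγ.1]))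
      rw [norm_mul, Real.norm_eq_abs, Real.norm_eq_abs, abs_of_nonneg h0, mul_comm]
      exact mul_le_mul_of_nonneg_right (hle y ⟨hy.1.le, hy.2⟩) h0
    · exact hi4.const_mul ε
  rw [intervalIntegral.integral_const_mul,
    intervalIntegral.integral_sub hi2 intervalIntegrable_const,
    intervalIntegral.integral_const, add_sub_cancel_left, one_smul] at hbound
  rw [ha, mul_assoc, ← mul_sub, e, abs_mul, abs_of_pos hp]
  calc _ ≤ (2 - γ) * (ε * ((∫ y in (m : ℝ)..(m + 1), y ^ (1 - γ)) - c)) :=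
        mul_le_mul_of_nonneg_left hbound hp.le
    _ = _ := by ring

lemma abs_integral_sub_sum_le (hγ : γ ∈ Ioo (1 : ℝ) 2) {ε : ℝ} (hε : 0 ≤ ε) {g : ℝ → ℝ} {n : ℕ}
    {G : ℕ → ℝ} (hg : ContinuousOn g (Icc 0 (n : ℝ)))
    (hG : ∀ m < n, ∫ y in (m : ℝ)..(m + 1), g y = G m)
    (hle : ∀ m < n, ∀ y ∈ Icc (m : ℝ) (m + 1), |g y - G m| ≤ ε) :
    |(2 - γ) * (∫ y in (0 : ℝ)..n, y ^ (1 - γ) * g y) -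
      ∑ m ∈ Finset.range n, aHigh γ m * G m| ≤ ε * (1 - aHigh γ n) := by
  induction n with
  | zero => simp [aHigh_zero hγ]
  | succ n ih =>
    have hn0 : (0 : ℝ) ≤ n := by positivity
    push_cast at hg ⊢
    have ih := ih (hg.mono (Icc_subset_Icc le_rfl (by linarith))) (fun m hm => hG m (by omega))
      (fun m hm => hle m (by omega))
    have h1 := abs_integral_sub_mean_le hγ (m := n)
      (hg.mono (Icc_subset_Icc hn0 le_rfl)) (hG n (by omega)) (hle n (by omega))
    have hint : ∀ a b : ℝ, 0 ≤ a → a ≤ b → b ≤ n + 1 →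
        IntervalIntegrable (fun y => y ^ (1 - γ) * g y) MeasureTheory.volume a b := by
      intro a b ha hab hb
      have := intervalIntegrable_rpow_mul (α := γ - 1) (a := a) (b := b) (by linarith [hγ.2])
        (hg.mono (by rw [uIcc_of_le hab]; exact Icc_subset_Icc ha hb))
      rwa [neg_sub] at this
    rw [← intervalIntegral.integral_add_adjacent_intervals (hint 0 n le_rfl hn0 (by linarith))
      (hint n (n + 1) hn0 (by linarith) le_rfl), Finset.sum_range_succ]
    have h2 := mul_le_mul_of_nonneg_left (aHigh_succ_le hγ n) hε
    rw [abs_le] at ih h1 ⊢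
    constructor <;> linarith [ih.1, ih.2, h1.1, h1.2]

lemma abs_highForm_le (hγ : γ ∈ Ioo (1 : ℝ) 2) {x : ℕ → ℝ} {ε : ℝ} (hε : 0 ≤ ε) {n : ℕ}
    (hn : 1 ≤ n) (hx : ∀ k, 1 ≤ k → k ≤ n → |x k| ≤ ε) : |highForm γ x 0 n| ≤ 2 * ε := by
  obtain ⟨j, rfl⟩ : ∃ j, n = j + 1 := ⟨n - 1, by omega⟩
  have h1 : ∀ (i : ℕ), i ≤ j → ∑ k ∈ Finset.Icc 1 i,
      (aHigh γ (j + 1 - k - 1) - aHigh γ (j + 1 - k)) = aHigh γ (j - i) - aHigh γ j := by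
    intro i
    induction i with
    | zero => intro _; simp
    | succ i ih =>
      intro hi
      rw [Finset.sum_Icc_succ_top (by omega), ih (by omega),
        show j + 1 - (i + 1) - 1 = j - (i + 1) by omega, show j + 1 - (i + 1) = j - i by omega]
      ring
  have h2 : |∑ k ∈ Finset.Icc 1 j, (aHigh γ (j + 1 - k - 1) - aHigh γ (j + 1 - k)) * x k| ≤ ε := by
    calc _ ≤ ∑ k ∈ Finset.Icc 1 j, (aHigh γ (j + 1 - k - 1) - aHigh γ (j + 1 - k)) * ε := by
          refine (Finset.abs_sum_le_sum_abs _ _).trans (Finset.sum_le_sum fun k hk => ?_)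
          have hk := Finset.mem_Icc.1 hk
          have h3 := aHigh_antitone hγ (k := j + 1 - k) (by omega)
          rw [abs_mul, abs_of_nonneg (sub_nonneg.2 h3)]
          exact mul_le_mul_of_nonneg_left (hx k hk.1 (by omega)) (sub_nonneg.2 h3)
      _ = (1 - aHigh γ j) * ε := by
          rw [← Finset.sum_mul, h1 j le_rfl, Nat.sub_self, aHigh_zero hγ]
      _ ≤ ε := by nlinarith [aHigh_nonneg hγ j]
  simp only [highForm, Nat.add_sub_cancel, mul_zero, sub_zero, aHigh_zero hγ, one_mul]
  refine (abs_sub _ _).trans ?_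
  linarith [hx (j + 1) (by omega) le_rfl]

lemma highForm_eq_sum (γ : ℝ) (x : ℕ → ℝ) (v₀ : ℝ) (n : ℕ) :
    highForm γ x v₀ (n + 1) =
      (∑ m ∈ Finset.range n, aHigh γ m * (x (n + 1 - m) - x (n - m))) +
        aHigh γ n * (x 1 - v₀) := by
  have h : ∀ i ≤ n, ∑ m ∈ Finset.range i, aHigh γ m * (x (n + 1 - m) - x (n - m)) =
      aHigh γ 0 * x (n + 1) - (∑ m ∈ Finset.range i, (aHigh γ m - aHigh γ (m + 1)) * x (n - m)) -
        aHigh γ i * x (n + 1 - i) := by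
    intro i
    induction i with
    | zero => intro _; simp
    | succ i ih =>
      intro hi
      rw [Finset.sum_range_succ, ih (by omega), Finset.sum_range_succ,
        show n + 1 - (i + 1) = n - i by omega]
      ring
  rw [h n le_rfl, highForm, Nat.add_sub_cancel, sum_Icc_one_eq_range, ← Finset.sum_range_reflect,
    show n + 1 - n = 1 by omega]
  have : ∑ j ∈ Finset.range n, (aHigh γ (n + 1 - (n - 1 - j + 1) - 1) -
      aHigh γ (n + 1 - (n - 1 - j + 1))) * x (n - 1 - j + 1) =
      ∑ m ∈ Finset.range n, (aHigh γ m - aHigh γ (m + 1)) * x (n - m) := by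
    refine Finset.sum_congr rfl fun m hm => ?_
    have hm := Finset.mem_range.1 hm
    rw [show n - 1 - m + 1 = n - m by omega, show n + 1 - (n - m) = m + 1 by omega,
      Nat.add_sub_cancel]
  rw [this]
  ring

end

lemma caputo₂_eq {T M γ : ℝ} (hγ : γ ∈ Ioo (1 : ℝ) 2) {v v₁ v₂ : ℝ → ℝ}
    (h : TimeRegular T M v v₁ v₂) {τ : ℝ} (hτ : 0 < τ) (hT : 0 < T) (j : ℕ)
    (hmem : ∀ y ∈ Icc (0 : ℝ) ((j : ℝ) + 1 / 2), ((j : ℝ) + 1 / 2) * τ - τ * y ∈ Icc 0 T) :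
    caputo₂ T γ v (((j : ℝ) + 1 / 2) * τ) = τ ^ (2 - γ) / Real.Gamma (3 - γ) *
      ((2 - γ) * ∫ y in (0 : ℝ)..((j : ℝ) + 1 / 2),
        y ^ (1 - γ) * v₂ (((j : ℝ) + 1 / 2) * τ - τ * y)) := by
  have hp : 0 < 2 - γ := by linarith [hγ.2]
  have hG0 : 0 < Real.Gamma (3 - γ) := Real.Gamma_pos_of_pos (by linarith)
  have hs := integral_caputo_scale (α := γ - 1) hτ (m := (j : ℝ) + 1 / 2) (by positivity)
    (iteratedDerivWithin 2 v (Icc 0 T))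
  rw [neg_sub, show 1 - (γ - 1) = 2 - γ by ring] at hs
  rw [caputo₂, hs]
  have hG : Real.Gamma (3 - γ) = (2 - γ) * Real.Gamma (2 - γ) := by
    rw [← Real.Gamma_add_one hp.ne']
    congr 1; ring
  have hG1 : 0 < Real.Gamma (2 - γ) := Real.Gamma_pos_of_pos hp
  have hI : ∫ x in (0 : ℝ)..((j : ℝ) + 1 / 2), x ^ (1 - γ) *
      iteratedDerivWithin 2 v (Icc 0 T) (((j : ℝ) + 1 / 2) * τ - τ * x) =
      ∫ y in (0 : ℝ)..((j : ℝ) + 1 / 2), y ^ (1 - γ) * v₂ (((j : ℝ) + 1 / 2) * τ - τ * y) := by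
    apply intervalIntegral.integral_congr
    intro y hy
    rw [uIcc_of_le (by positivity)] at hy
    have hy' := hmem y hy
    simp only
    congr 1
    rw [iteratedDerivWithin_succ]
    have hw : EqOn (iteratedDerivWithin 1 v (Icc 0 T)) v₁ (Icc 0 T) := fun z hz => by
      rw [iteratedDerivWithin_one, (h.deriv₁ _ hz).derivWithin (uniqueDiffOn_Icc hT _ hz)]
    rw [derivWithin_congr hw (hw hy'),
      (h.deriv₂ _ hy').derivWithin (uniqueDiffOn_Icc hT _ hy')]
  rw [hI, hG]
  field_simp

set_option maxHeartbeats 1000000 in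
/-- Truncation error of the discretization of `caputo₂` at the midpoint of a time step. -/
theorem high_truncation {T M γ : ℝ} (hγ : γ ∈ Ioo (1 : ℝ) 2) {v v₁ v₂ : ℝ → ℝ}
    (h : TimeRegular T M v v₁ v₂) {τ : ℝ} (hτ : 0 < τ) {n : ℕ} (hn : 1 ≤ n)
    (hnT : (n : ℝ) * τ ≤ T) :
    |τ ^ (1 - γ) / Real.Gamma (3 - γ) * highForm γ (diffQuot τ fun k => v (k * τ)) (v₁ 0) n -
      caputo₂ T γ v (((n : ℝ) - 1 / 2) * τ) -
      τ ^ (2 - γ) / Real.Gamma (3 - γ) * initialWeight γ n * v₂ 0| ≤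
      4 / Real.Gamma (3 - γ) * M * τ ^ (3 - γ) := by
  obtain ⟨j, rfl⟩ : ∃ j, n = j + 1 := ⟨n - 1, by omega⟩
  have hj0 : (0 : ℝ) ≤ j := by positivity
  push_cast at hnT
  rw [show (((j + 1 : ℕ) : ℝ) - 1 / 2) = (j : ℝ) + 1 / 2 by push_cast; ring]
  set t := ((j : ℝ) + 1 / 2) * τ with ht
  have htT : t ≤ T := by nlinarith
  have ht0 : 0 < t := by positivity
  have hT : 0 < T := by linarith
  have h0T : (0 : ℝ) ∈ Icc 0 T := ⟨le_rfl, hT.le⟩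
  have hM := h.bound_nonneg hT.le
  have hp : 0 < 2 - γ := by linarith [hγ.2]
  have hmem : ∀ y ∈ Icc (0 : ℝ) ((j : ℝ) + 1 / 2), t - τ * y ∈ Icc 0 T := by
    intro y hy
    constructor
    · have := mul_le_mul_of_nonneg_left hy.2 hτ.le
      rw [ht]; linarith
    · have := mul_nonneg hτ.le hy.1
      linarith
  have hG0 : 0 < Real.Gamma (3 - γ) := Real.Gamma_pos_of_pos (by linarith)
  have hcap := caputo₂_eq hγ h hτ hT j hmem
  rw [← ht] at hcap
  have hτp : τ ^ (2 - γ) = τ ^ (1 - γ) * τ := by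
    rw [show 2 - γ = (1 - γ) + 1 by ring, Real.rpow_add hτ, Real.rpow_one]
  have hτp' : τ ^ (3 - γ) = τ ^ (2 - γ) * τ := by
    rw [show 3 - γ = (2 - γ) + 1 by ring, Real.rpow_add hτ, Real.rpow_one]
  set x := diffQuot τ fun k => v (k * τ) with hx
  set X : ℕ → ℝ := fun k => v₁ (((k : ℝ) - 1 / 2) * τ) with hX
  set g : ℝ → ℝ := fun y => v₂ (t - τ * y) with hg
  have hgc : ContinuousOn g (Icc 0 ((j : ℝ) + 1 / 2)) := h.continuousOn₂.comp (by fun_prop) hmem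
  have hpert : |highForm γ x (v₁ 0) (j + 1) - highForm γ X (v₁ 0) (j + 1)| ≤ 2 * (M * τ ^ 2) := by
    rw [← highForm_sub, sub_self]
    refine abs_highForm_le hγ (by positivity) (by omega) fun k hk1 hk2 => ?_
    apply h.diffQuot_le hτ hk1
    have : (k : ℝ) ≤ j + 1 := by exact_mod_cast hk2
    nlinarith
  have hsum := abs_integral_sub_sum_le hγ (ε := M * τ) (by positivity) (g := g) (n := j)
    (G := fun m => (X (j + 1 - m) - X (j - m)) / τ)
    (hgc.mono (Icc_subset_Icc le_rfl (by linarith)))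
    (by
      intro m hm
      have hmj : (m : ℝ) + 1 ≤ j := by exact_mod_cast hm
      have hm0 : (0 : ℝ) ≤ m := by positivity
      have hcast : ((j - m : ℕ) : ℝ) = (j : ℝ) - m := by rw [Nat.cast_sub hm.le]
      have hcast' : ((j + 1 - m : ℕ) : ℝ) = (j : ℝ) + 1 - m := by
        rw [Nat.cast_sub (by omega)]; push_cast; ring
      have hsub : Icc (m : ℝ) (m + 1) ⊆ Icc 0 ((j : ℝ) + 1 / 2) :=
        Icc_subset_Icc hm0 (by linarith)
      rw [intervalIntegral.integral_eq_sub_of_hasDerivAt_of_le (f := fun y => -(v₁ (t - τ * y) / τ))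
        (by linarith)]
      · simp only [hX, hcast, hcast']
        rw [show ((j : ℝ) + 1 - m - 1 / 2) * τ = t - τ * m by rw [ht]; ring,
          show ((j : ℝ) - m - 1 / 2) * τ = t - τ * (m + 1) by rw [ht]; ring]
        ring
      · exact ((h.continuousOn₁.comp (by fun_prop) hmem).mono hsub).div_const τ |>.neg
      · intro y hy
        have hy0 : 0 < y := by linarith [hy.1]
        have hyI : t - τ * y ∈ Ioo 0 T := by
          have h1 := mul_pos hτ hy0
          have h2 : τ * y < τ * ((j : ℝ) + 1 / 2) := mul_lt_mul_of_pos_left (by linarith [hy.2]) hτ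
          constructor
          · rw [ht]; linarith
          · linarith
        have hd := (h.deriv₂ _ ⟨hyI.1.le, hyI.2.le⟩).hasDerivAt (Icc_mem_nhds hyI.1 hyI.2)
        have hd' : HasDerivAt (fun y => t - τ * y) (-(τ * 1)) y :=
          ((hasDerivAt_id y).const_mul τ).const_sub t
        refine ((hd.comp y hd').div_const τ).neg.congr_deriv ?_
        simp only [hg]
        field_simp
      · apply ContinuousOn.intervalIntegrable
        rw [uIcc_of_le (by linarith)]
        exact hgc.mono hsub)
    (by
      intro m hm y hy
      have hmj : (m : ℝ) + 1 ≤ j := by exact_mod_cast hm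
      have hm0 : (0 : ℝ) ≤ m := by positivity
      have hcast : ((j - m : ℕ) : ℝ) = (j : ℝ) - m := by rw [Nat.cast_sub hm.le]
      have hcast' : ((j + 1 - m : ℕ) : ℝ) = (j : ℝ) + 1 - m := by
        rw [Nat.cast_sub (by omega)]; push_cast; ring
      simp only [hX, hcast, hcast']
      rw [show ((j : ℝ) + 1 - m - 1 / 2) * τ = t - τ * m by rw [ht]; ring,
        show ((j : ℝ) - m - 1 / 2) * τ = t - τ * (m + 1) by rw [ht]; ring]
      have hyt := hmem y ⟨by linarith [hy.1], by linarith [hy.2]⟩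
      have h1 := h.deriv_taylor hyt (hmem m ⟨hm0, by linarith⟩)
      have h2 := h.deriv_taylor hyt (hmem (m + 1) ⟨by linarith, by linarith⟩)
      rw [show t - τ * m - (t - τ * y) = τ * (y - m) by ring, sq_abs] at h1
      rw [show t - τ * (m + 1) - (t - τ * y) = -(τ * (m + 1 - y)) by ring, sq_abs] at h2
      rw [show g y - (v₁ (t - τ * m) - v₁ (t - τ * (m + 1))) / τ =
        ((v₁ (t - τ * (m + 1)) - v₁ (t - τ * y) - v₂ (t - τ * y) * -(τ * (m + 1 - y))) -
          (v₁ (t - τ * m) - v₁ (t - τ * y) - v₂ (t - τ * y) * (τ * (y - m)))) / τ by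
          simp only [hg]; field_simp; ring, abs_div, abs_of_pos hτ, div_le_iff₀ hτ]
      refine (abs_sub _ _).trans ((add_le_add h2 h1).trans ?_)
      have h3 : (m + 1 - y) ^ 2 + (y - m) ^ 2 ≤ 1 := by nlinarith [hy.1, hy.2]
      have h4 := mul_le_mul_of_nonneg_left h3 (show 0 ≤ M * τ ^ 2 by positivity)
      nlinarith [h4])
  have ha1 := aHigh_le_one hγ j
  have ha0 := aHigh_nonneg hγ j
  have hfirst : |aHigh γ j * ((X 1 - v₁ 0) / τ) - aHigh γ j / 2 * v₂ 0| ≤ M * τ / 2 := by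
    have h1 := h.deriv_taylor h0T (b := τ / 2) ⟨by linarith, by nlinarith⟩
    rw [sub_zero, sq_abs] at h1
    have e : aHigh γ j * ((X 1 - v₁ 0) / τ) - aHigh γ j / 2 * v₂ 0 =
        aHigh γ j * ((v₁ (τ / 2) - v₁ 0 - v₂ 0 * (τ / 2)) / τ) := by
      simp only [hX]
      rw [show (((1 : ℕ) : ℝ) - 1 / 2) * τ = τ / 2 by push_cast; ring]
      field_simp
    rw [e, abs_mul, abs_of_nonneg ha0, abs_div, abs_of_pos hτ]
    have h2 : |v₁ (τ / 2) - v₁ 0 - v₂ 0 * (τ / 2)| / τ ≤ M * τ / 2 := by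
      rw [div_le_iff₀ hτ]
      nlinarith [mul_nonneg hM (sq_nonneg τ)]
    have h3 : 0 ≤ M * τ := by positivity
    calc _ ≤ 1 * (M * τ / 2) := mul_le_mul ha1 h2 (by positivity) zero_le_one
      _ = _ := one_mul _
  have hlast : |(2 - γ) * (∫ y in (j : ℝ)..(j + 1 / 2), y ^ (1 - γ) * g y) -
      (((j : ℝ) + 1 / 2) ^ (2 - γ) - (j : ℝ) ^ (2 - γ)) * v₂ 0| ≤ M * τ / 2 := by
    have h1 := abs_integral_rpow_sub_le (α := γ - 1) (a := j) (b := j + 1 / 2) (ε := M * τ / 2)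
      (g := g) (k := fun _ => v₂ 0) (by linarith) hj0 (by linarith)
      (hgc.mono (Icc_subset_Icc hj0 le_rfl)) (by fun_prop) (by
        intro y hy
        have h2 := h.lipschitz 0 h0T _ (hmem y ⟨by linarith [hy.1], hy.2⟩)
        have h3 := hmem y ⟨by linarith [hy.1], hy.2⟩
        rw [sub_zero, abs_of_nonneg h3.1] at h2
        refine h2.trans ?_
        rw [mul_div_assoc]
        apply mul_le_mul_of_nonneg_left _ hM
        rw [ht]
        nlinarith [hy.1])
    rw [intervalIntegral.integral_mul_const, ← mul_assoc, integral_rpow_neg (by linarith),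
      show 1 - (γ - 1) = 2 - γ by ring, neg_sub] at h1
    refine h1.trans ?_
    have h2 : ((j : ℝ) + 1 / 2) ^ (2 - γ) ≤ ((j : ℝ) + 1) ^ (2 - γ) :=
      Real.rpow_le_rpow (by positivity) (by linarith) hp.le
    have h3 : ((j : ℝ) + 1 / 2) ^ (2 - γ) - (j : ℝ) ^ (2 - γ) ≤ 1 := by
      rw [aHigh] at ha1; linarith
    exact mul_le_of_le_one_right (by positivity) h3
  have hint : ∀ a b : ℝ, 0 ≤ a → a ≤ b → b ≤ j + 1 / 2 →
      IntervalIntegrable (fun y => y ^ (1 - γ) * g y) MeasureTheory.volume a b := by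
    intro a b ha hab hb
    have := intervalIntegrable_rpow_mul (α := γ - 1) (a := a) (b := b) (by linarith)
      (hgc.mono (by rw [uIcc_of_le hab]; exact Icc_subset_Icc ha hb))
    rwa [neg_sub] at this
  have hsplit := intervalIntegral.integral_add_adjacent_intervals
    (hint 0 j le_rfl hj0 (by linarith)) (hint j (j + 1 / 2) hj0 (by linarith) le_rfl)
  have hform : highForm γ X (v₁ 0) (j + 1) / τ =
      (∑ m ∈ Finset.range j, aHigh γ m * ((X (j + 1 - m) - X (j - m)) / τ)) +
        aHigh γ j * ((X 1 - v₁ 0) / τ) := by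
    rw [highForm_eq_sum, add_div, Finset.sum_div]
    simp only [mul_div_assoc]
  have hpert' : |highForm γ x (v₁ 0) (j + 1) / τ - highForm γ X (v₁ 0) (j + 1) / τ| ≤
      2 * (M * τ) := by
    rw [← sub_div, abs_div, abs_of_pos hτ, div_le_iff₀ hτ]
    linarith
  have hr : initialWeight γ (j + 1) =
      aHigh γ j / 2 - (((j : ℝ) + 1 / 2) ^ (2 - γ) - (j : ℝ) ^ (2 - γ)) := by
    simp only [initialWeight, Nat.add_sub_cancel]
    push_cast
    rw [show (j : ℝ) + 1 - 1 / 2 = j + 1 / 2 by ring, show (j : ℝ) + 1 - 1 = j by ring]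
  have e : τ ^ (1 - γ) / Real.Gamma (3 - γ) * highForm γ x (v₁ 0) (j + 1) - caputo₂ T γ v t -
      τ ^ (2 - γ) / Real.Gamma (3 - γ) * initialWeight γ (j + 1) * v₂ 0 =
      τ ^ (2 - γ) / Real.Gamma (3 - γ) * (highForm γ x (v₁ 0) (j + 1) / τ -
        (2 - γ) * (∫ y in (0 : ℝ)..((j : ℝ) + 1 / 2), y ^ (1 - γ) * g y) -
        initialWeight γ (j + 1) * v₂ 0) := by
    rw [hcap, hτp]
    simp only [hg]
    field_simp
  have hMτ : 0 ≤ M * τ := by positivity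
  have hmain : |highForm γ x (v₁ 0) (j + 1) / τ -
        (2 - γ) * (∫ y in (0 : ℝ)..((j : ℝ) + 1 / 2), y ^ (1 - γ) * g y) -
        initialWeight γ (j + 1) * v₂ 0| ≤ 4 * (M * τ) := by
    rw [← hsplit, hr]
    have h5 : M * τ * (1 - aHigh γ j) ≤ M * τ := mul_le_of_le_one_right hMτ (by linarith)
    have h6 := hsum.trans h5
    rw [abs_le] at hpert' h6 hfirst hlast ⊢
    constructor <;>
      linarith [hpert'.1, hpert'.2, h6.1, h6.2, hfirst.1, hfirst.2, hlast.1, hlast.2]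
  rw [e, abs_mul, abs_of_pos (by positivity), hτp']
  calc _ ≤ τ ^ (2 - γ) / Real.Gamma (3 - γ) * (4 * (M * τ)) :=
        mul_le_mul_of_nonneg_left hmain (by positivity)
    _ = _ := by ring


/-! ### Consistency of the scheme at a fixed node -/

section Node

variable {p q s : ℕ} {P : Data p q s}

/-- The left-hand side minus the Laplacian terms of the equation, for a function `v` of time with
Laplacian `ℓ`. -/
noncomputable def caputoOp (P : Data p q s) (v ℓ : ℝ → ℝ) (t : ℝ) : ℝ :=
  (∑ l, P.a l * caputo₂ P.T (P.γ l) v t) + P.b₁ * derivWithin v (Icc 0 P.T) t +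
    (∑ m, P.c m * caputo₁ P.T (P.α m) v t) + P.b₂ * v t - P.b₃ * ℓ t -
    ∑ r, P.d r * caputo₁ P.T (P.β r) ℓ t

/-- The coefficient of the initial second time derivative in the consistency error. -/
noncomputable def Data.initialForcing (P : Data p q s) (τ : ℝ) (n : ℕ) : ℝ :=
  ∑ l, P.a l * (τ ^ (2 - P.γ l) / Real.Gamma (3 - P.γ l) * initialWeight (P.γ l) n)

lemma Data.order_le_high (P : Data p q s) (l : Fin p) : order P ≤ 3 - P.γ l :=
  (min_le_left _ _).trans (ciInf_le (finite_range _).bddBelow l)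

lemma Data.order_le_low (P : Data p q s) (m : Fin q) : order P ≤ 2 - P.α m :=
  (min_le_right _ _).trans ((min_le_left _ _).trans (ciInf_le (finite_range _).bddBelow m))

lemma Data.order_le_lap (P : Data p q s) (r : Fin s) : order P ≤ 2 - P.β r :=
  (min_le_right _ _).trans ((min_le_right _ _).trans (ciInf_le (finite_range _).bddBelow r))

lemma Data.Admissible.order_le_two (hP : P.Admissible) : order P ≤ 2 := by
  have := P.order_le_high ⟨0, hP.p_pos⟩
  linarith [(hP.γ_mem ⟨0, hP.p_pos⟩).1]

lemma rpow_le_const_mul_rpow {τ T a σ : ℝ} (hτ : 0 < τ) (hτT : τ ≤ T) (h : σ ≤ a) :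
    τ ^ a ≤ T ^ (a - σ) * τ ^ σ := by
  rw [show a = (a - σ) + σ by ring, Real.rpow_add hτ, add_sub_cancel_right]
  exact mul_le_mul_of_nonneg_right (Real.rpow_le_rpow hτ.le hτT (by linarith)) (by positivity)

lemma abs_lowForm_le {α : ℝ} (hα : α ∈ Ioo (0 : ℝ) 1) {x : ℕ → ℝ} {ε : ℝ} (hε : 0 ≤ ε) {n : ℕ}
    (hn : 1 ≤ n) (hx : ∀ k, 1 ≤ k → k ≤ n → |x k| ≤ ε) :
    |lowForm α x n| ≤ 3 * (n : ℝ) ^ (1 - α) * ε := by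
  obtain ⟨j, rfl⟩ : ∃ j, n = j + 1 := ⟨n - 1, by omega⟩
  have ha := aLow_nonneg hα
  have hsum := sum_aLow (α := α) j
  rw [Finset.sum_range_succ'] at hsum
  have h1 : |∑ m ∈ Finset.range j, (aLow α (m + 1) * x (j - m) +
      bLow α (m + 1) * (x (j + 1 - m) - x (j - m)))| ≤
      ∑ m ∈ Finset.range j, 3 * ε * aLow α (m + 1) := by
    refine (Finset.abs_sum_le_sum_abs _ _).trans (Finset.sum_le_sum fun m hm => ?_)
    have hm := Finset.mem_range.1 hm
    have hb := bLow_nonneg hα (k := m + 1) (by omega)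
    have hba := bLow_le_aLow hα (k := m + 1) (by omega)
    have h2 := hx (j - m) (by omega) (by omega)
    have h3 := hx (j + 1 - m) (by omega) (by omega)
    have h4 : |x (j + 1 - m) - x (j - m)| ≤ 2 * ε := (abs_sub _ _).trans (by linarith)
    refine (abs_add_le _ _).trans ?_
    rw [abs_mul, abs_mul, abs_of_nonneg (ha _), abs_of_nonneg hb]
    have h5 := mul_le_mul_of_nonneg_left h2 (ha (m + 1))
    have h6 := mul_le_mul hba h4 (abs_nonneg _) (ha (m + 1))
    linarith
  rw [← Finset.mul_sum] at h1
  have h2 : |aLow α 0 * x (j + 1)| ≤ 3 * ε * aLow α 0 := by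
    rw [abs_mul, abs_of_nonneg (ha 0)]
    nlinarith [mul_le_mul_of_nonneg_left (hx (j + 1) (by omega) le_rfl) (ha 0),
      mul_nonneg (ha 0) hε]
  rw [lowForm_eq_sum]
  have h3 : ((j : ℝ) + 1 / 2) ^ (1 - α) ≤ ((j + 1 : ℕ) : ℝ) ^ (1 - α) :=
    Real.rpow_le_rpow (by positivity) (by push_cast; linarith) (by linarith [hα.2])
  calc _ ≤ 3 * ε * aLow α 0 + 3 * ε * ∑ m ∈ Finset.range j, aLow α (m + 1) :=
        (abs_add_le _ _).trans (add_le_add h2 h1)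
    _ = 3 * ε * ((j : ℝ) + 1 / 2) ^ (1 - α) := by rw [← hsum]; ring
    _ ≤ 3 * ε * ((j + 1 : ℕ) : ℝ) ^ (1 - α) := mul_le_mul_of_nonneg_left h3 (by positivity)
    _ = _ := by ring

lemma scaled_lowForm_le {α : ℝ} (hα : α ∈ Ioo (0 : ℝ) 1) {x : ℕ → ℝ} {ε τ T : ℝ} (hε : 0 ≤ ε)
    (hτ : 0 < τ) {n : ℕ} (hn : 1 ≤ n) (hnT : (n : ℝ) * τ ≤ T)
    (hx : ∀ k, 1 ≤ k → k ≤ n → |x k| ≤ ε) :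
    |τ ^ (1 - α) / Real.Gamma (2 - α) * lowForm α x n| ≤
      3 * T ^ (1 - α) / Real.Gamma (2 - α) * ε := by
  have hG0 : 0 < Real.Gamma (2 - α) := Real.Gamma_pos_of_pos (by linarith [hα.2])
  have h1 : τ ^ (1 - α) * (n : ℝ) ^ (1 - α) ≤ T ^ (1 - α) := by
    rw [← Real.mul_rpow hτ.le (by positivity)]
    apply Real.rpow_le_rpow (by positivity) _ (by linarith [hα.2])
    rwa [mul_comm]
  rw [abs_mul, abs_of_pos (by positivity)]
  calc _ ≤ τ ^ (1 - α) / Real.Gamma (2 - α) * (3 * (n : ℝ) ^ (1 - α) * ε) :=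
        mul_le_mul_of_nonneg_left (abs_lowForm_le hα hε hn hx) (by positivity)
    _ = 3 * ε / Real.Gamma (2 - α) * (τ ^ (1 - α) * (n : ℝ) ^ (1 - α)) := by ring
    _ ≤ 3 * ε / Real.Gamma (2 - α) * T ^ (1 - α) :=
        mul_le_mul_of_nonneg_left h1 (by positivity)
    _ = _ := by ring

lemma sum_initialForcing_le (hP : P.Admissible) : ∃ K ≥ 0, ∀ N : ℕ, 0 < N →
    (P.T / N) * ∑ n ∈ Finset.Icc 1 N, |P.initialForcing (P.T / N) n| ≤
      K * (P.T / N) ^ order P := by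
  have hG : ∀ l, 0 < Real.Gamma (3 - P.γ l) := fun l =>
    Real.Gamma_pos_of_pos (by linarith [(hP.γ_mem l).2])
  have hT := hP.T_pos
  refine ⟨∑ l, P.a l * (P.T ^ (3 - P.γ l - order P) / Real.Gamma (3 - P.γ l)),
    Finset.sum_nonneg fun l _ => ?_, fun N hN => ?_⟩
  · have := hG l
    have := hP.a_pos l
    positivity
  have hN1 : (1 : ℝ) ≤ N := by exact_mod_cast hN
  set τ := P.T / N with hτdef
  have hτ : 0 < τ := by positivity
  have hτT : τ ≤ P.T := div_le_self hT.le hN1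
  have h1 : ∀ n, |P.initialForcing τ n| ≤
      ∑ l, P.a l * (τ ^ (2 - P.γ l) / Real.Gamma (3 - P.γ l)) * |initialWeight (P.γ l) n| := by
    intro n
    refine (Finset.abs_sum_le_sum_abs _ _).trans (Finset.sum_le_sum fun l _ => ?_)
    have := hG l
    have := hP.a_pos l
    rw [← mul_assoc, abs_mul, abs_of_pos (by positivity)]
  calc _ ≤ τ * ∑ n ∈ Finset.Icc 1 N, ∑ l,
          P.a l * (τ ^ (2 - P.γ l) / Real.Gamma (3 - P.γ l)) * |initialWeight (P.γ l) n| :=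
        mul_le_mul_of_nonneg_left (Finset.sum_le_sum fun n _ => h1 n) hτ.le
    _ = ∑ l, P.a l / Real.Gamma (3 - P.γ l) * (τ ^ (2 - P.γ l) * τ) *
          ∑ n ∈ Finset.Icc 1 N, |initialWeight (P.γ l) n| := by
        rw [Finset.sum_comm, Finset.mul_sum]
        refine Finset.sum_congr rfl fun l _ => ?_
        rw [← Finset.mul_sum]
        ring
    _ ≤ _ := by
        rw [Finset.sum_mul]
        refine Finset.sum_le_sum fun l _ => ?_
        have hGl := hG l
        have hal := hP.a_pos l
        have h2 := sum_abs_initialWeight_le (hP.γ_mem l) N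
        have h3 := rpow_le_const_mul_rpow hτ hτT (P.order_le_high l)
        rw [show τ ^ (2 - P.γ l) * τ = τ ^ (3 - P.γ l) by
          rw [show 3 - P.γ l = (2 - P.γ l) + 1 by ring, Real.rpow_add hτ, Real.rpow_one]]
        calc _ ≤ P.a l / Real.Gamma (3 - P.γ l) * (P.T ^ (3 - P.γ l - order P) * τ ^ order P) * 1 :=
              mul_le_mul (mul_le_mul_of_nonneg_left h3 (by positivity)) (by linarith)
                (Finset.sum_nonneg fun _ _ => abs_nonneg _) (by positivity)
          _ = _ := by ring

lemma abs_sum_mul_sub_le {ι : Type*} [Fintype ι] {a x y B : ι → ℝ} (ha : ∀ i, 0 ≤ a i)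
    (h : ∀ i, |x i - y i| ≤ B i) :
    |(∑ i, a i * x i) - ∑ i, a i * y i| ≤ ∑ i, a i * B i := by
  rw [← Finset.sum_sub_distrib]
  refine (Finset.abs_sum_le_sum_abs _ _).trans (Finset.sum_le_sum fun i _ => ?_)
  rw [← mul_sub, abs_mul, abs_of_nonneg (ha i)]
  exact mul_le_mul_of_nonneg_left (h i) (ha i)

/-- Consistency of the scheme at a node: `z` are the nodal values of the discrete Laplacian, which
agrees with the Laplacian `ℓ` up to `ε`. -/
theorem scheme_consistency (hP : P.Admissible) {M : ℝ} (hM : 0 ≤ M) : ∃ K ≥ 0,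
    ∀ {v v₁ v₂ ℓ ℓ₁ ℓ₂ : ℝ → ℝ}, TimeRegular P.T M v v₁ v₂ → TimeRegular P.T M ℓ ℓ₁ ℓ₂ →
      ∀ {τ : ℝ}, 0 < τ → ∀ {n : ℕ}, 1 ≤ n → (n : ℝ) * τ ≤ P.T → ∀ {z : ℕ → ℝ} {ε : ℝ}, 0 ≤ ε →
      (∀ k ≤ n, |z k - ℓ (k * τ)| ≤ ε) →
      (∀ k, 1 ≤ k → k ≤ n →
        |diffQuot τ z k - diffQuot τ (fun k => ℓ (k * τ)) k| ≤ ε) →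
      |schemeOp P τ (fun k => v (k * τ)) z (v₁ 0) n -
        caputoOp P v ℓ (((n : ℝ) - 1 / 2) * τ) - P.initialForcing τ n * v₂ 0| ≤
        K * (τ ^ order P + ε) := by
  have hT := hP.T_pos
  set σ := order P with hσ
  have hGh : ∀ l, 0 < Real.Gamma (3 - P.γ l) := fun l =>
    Real.Gamma_pos_of_pos (by linarith [(hP.γ_mem l).2])
  have hGm : ∀ m, 0 < Real.Gamma (2 - P.α m) := fun m =>
    Real.Gamma_pos_of_pos (by linarith [(hP.α_mem m).2])
  have hGr : ∀ r, 0 < Real.Gamma (2 - P.β r) := fun r =>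
    Real.Gamma_pos_of_pos (by linarith [(hP.β_mem r).2])
  have ha := fun l => (hP.a_pos l).le
  have hc := fun m => (hP.c_pos m).le
  have hd := fun r => (hP.d_pos r).le
  have hb₁ := hP.b₁_pos
  have hb₂ := hP.b₂_pos
  have hb₃ := hP.b₃_pos
  set kh : Fin p → ℝ := fun l => 4 / Real.Gamma (3 - P.γ l) * M * P.T ^ (3 - P.γ l - σ) with hkh
  set km : Fin q → ℝ := fun m =>
    (1 + 4 * P.T) / Real.Gamma (2 - P.α m) * M * P.T ^ (2 - P.α m - σ) with hkm
  set kr : Fin s → ℝ := fun r =>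
    (1 + 4 * P.T) / Real.Gamma (2 - P.β r) * M * P.T ^ (2 - P.β r - σ) with hkr
  set er : Fin s → ℝ := fun r => 3 * P.T ^ (1 - P.β r) / Real.Gamma (2 - P.β r) with her
  set k2 := M * P.T ^ (2 - σ) with hk2
  have hkh0 : 0 ≤ ∑ l, P.a l * kh l := Finset.sum_nonneg fun l _ => by
    have := hGh l; have := ha l; positivity
  have hkm0 : 0 ≤ ∑ m, P.c m * km m := Finset.sum_nonneg fun m _ => by
    have := hGm m; have := hc m; positivity
  have hkr0 : 0 ≤ ∑ r, P.d r * kr r := Finset.sum_nonneg fun r _ => by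
    have := hGr r; have := hd r; positivity
  have her0 : 0 ≤ ∑ r, P.d r * er r := Finset.sum_nonneg fun r _ => by
    have := hGr r; have := hd r; positivity
  have hk20 : 0 ≤ k2 := by positivity
  set K₁ := (∑ l, P.a l * kh l) + P.b₁ * k2 + (∑ m, P.c m * km m) + P.b₂ * k2 + P.b₃ * k2 +
    ∑ r, P.d r * kr r with hK₁
  set K₂ := P.b₃ + ∑ r, P.d r * er r with hK₂
  have hK₁0 : 0 ≤ K₁ := by positivity
  have hK₂0 : 0 ≤ K₂ := by positivity
  refine ⟨K₁ + K₂, by positivity, ?_⟩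
  intro v v₁ v₂ ℓ ℓ₁ ℓ₂ hv hℓ τ hτ n hn hnT z ε hε hz hdz
  have hn1 : (1 : ℝ) ≤ n := by exact_mod_cast hn
  have hτT : τ ≤ P.T := by nlinarith
  obtain ⟨htm, -, -⟩ := mem_Icc_levels hτ hn hnT
  set t := ((n : ℝ) - 1 / 2) * τ with ht
  have hpow : ∀ {a B : ℝ}, 0 ≤ B → σ ≤ a → B * τ ^ a ≤ B * P.T ^ (a - σ) * τ ^ σ :=
    fun hB h => by
      rw [mul_assoc]
      exact mul_le_mul_of_nonneg_left (rpow_le_const_mul_rpow hτ hτT h) hB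
  have hsq : M * τ ^ 2 ≤ k2 * τ ^ σ := by
    have := hpow hM hP.order_le_two
    rwa [Real.rpow_two] at this
  have h1 : |(∑ l, P.a l * (τ ^ (1 - P.γ l) / Real.Gamma (3 - P.γ l) *
        highForm (P.γ l) (diffQuot τ fun k => v (k * τ)) (v₁ 0) n -
          τ ^ (2 - P.γ l) / Real.Gamma (3 - P.γ l) * initialWeight (P.γ l) n * v₂ 0)) -
      ∑ l, P.a l * caputo₂ P.T (P.γ l) v t| ≤ ∑ l, P.a l * (kh l * τ ^ σ) := by
    refine abs_sum_mul_sub_le ha fun l => ?_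
    have := high_truncation (hP.γ_mem l) hv hτ hn hnT
    rw [sub_right_comm]
    refine this.trans (hpow ?_ (P.order_le_high l))
    have := hGh l
    positivity
  have h2 : |P.b₁ * diffQuot τ (fun k => v (k * τ)) n - P.b₁ * derivWithin v (Icc 0 P.T) t| ≤
      P.b₁ * (k2 * τ ^ σ) := by
    rw [(hv.deriv₁ t htm).derivWithin (uniqueDiffOn_Icc hT t htm), ← mul_sub, abs_mul,
      abs_of_pos hb₁]
    exact mul_le_mul_of_nonneg_left ((hv.diffQuot_le hτ hn hnT).trans hsq) hb₁.le
  have h3 : |(∑ m, P.c m * (τ ^ (1 - P.α m) / Real.Gamma (2 - P.α m) *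
        lowForm (P.α m) (diffQuot τ fun k => v (k * τ)) n)) -
      ∑ m, P.c m * caputo₁ P.T (P.α m) v t| ≤ ∑ m, P.c m * (km m * τ ^ σ) := by
    refine abs_sum_mul_sub_le hc fun m => ?_
    refine (low_truncation (hP.α_mem m) hv hτ hn hnT).trans (hpow ?_ (P.order_le_low m))
    have := hGm m
    positivity
  have h4 : |P.b₂ * ((v (n * τ) + v ((n - 1 : ℕ) * τ)) / 2) - P.b₂ * v t| ≤
      P.b₂ * (k2 * τ ^ σ) := by
    rw [← mul_sub, abs_mul, abs_of_pos hb₂]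
    exact mul_le_mul_of_nonneg_left ((hv.mean_le hτ hn hnT).trans hsq) hb₂.le
  have h5 : |P.b₃ * ((z n + z (n - 1)) / 2) - P.b₃ * ℓ t| ≤ P.b₃ * (k2 * τ ^ σ + ε) := by
    rw [← mul_sub, abs_mul, abs_of_pos hb₃]
    apply mul_le_mul_of_nonneg_left _ hb₃.le
    have e1 := (hℓ.mean_le hτ hn hnT).trans hsq
    have e2 := hz n le_rfl
    have e3 := hz (n - 1) (by omega)
    rw [abs_le] at e1 e2 e3 ⊢
    constructor <;> linarith [e1.1, e1.2, e2.1, e2.2, e3.1, e3.2]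
  have h6 : |(∑ r, P.d r * (τ ^ (1 - P.β r) / Real.Gamma (2 - P.β r) *
        lowForm (P.β r) (diffQuot τ z) n)) -
      ∑ r, P.d r * caputo₁ P.T (P.β r) ℓ t| ≤ ∑ r, P.d r * (kr r * τ ^ σ + er r * ε) := by
    refine abs_sum_mul_sub_le hd fun r => ?_
    have e1 := low_truncation (hP.β_mem r) hℓ hτ hn hnT
    have e2 := scaled_lowForm_le (hP.β_mem r) hε hτ hn hnT hdz
    rw [lowForm_sub, mul_sub] at e2
    have e3 : (1 + 4 * P.T) / Real.Gamma (2 - P.β r) * M * τ ^ (2 - P.β r) ≤ kr r * τ ^ σ := by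
      apply hpow _ (P.order_le_lap r)
      have := hGr r
      positivity
    rw [abs_le] at e1 e2 ⊢
    constructor <;> linarith [e1.1, e1.2, e2.1, e2.2]
  have e : schemeOp P τ (fun k => v (k * τ)) z (v₁ 0) n - caputoOp P v ℓ t -
      P.initialForcing τ n * v₂ 0 =
      ((∑ l, P.a l * (τ ^ (1 - P.γ l) / Real.Gamma (3 - P.γ l) *
        highForm (P.γ l) (diffQuot τ fun k => v (k * τ)) (v₁ 0) n -
          τ ^ (2 - P.γ l) / Real.Gamma (3 - P.γ l) * initialWeight (P.γ l) n * v₂ 0)) -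
      ∑ l, P.a l * caputo₂ P.T (P.γ l) v t) +
      (P.b₁ * diffQuot τ (fun k => v (k * τ)) n - P.b₁ * derivWithin v (Icc 0 P.T) t) +
      ((∑ m, P.c m * (τ ^ (1 - P.α m) / Real.Gamma (2 - P.α m) *
        lowForm (P.α m) (diffQuot τ fun k => v (k * τ)) n)) -
      ∑ m, P.c m * caputo₁ P.T (P.α m) v t) +
      (P.b₂ * ((v (n * τ) + v ((n - 1 : ℕ) * τ)) / 2) - P.b₂ * v t) -
      (P.b₃ * ((z n + z (n - 1)) / 2) - P.b₃ * ℓ t) -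
      ((∑ r, P.d r * (τ ^ (1 - P.β r) / Real.Gamma (2 - P.β r) *
        lowForm (P.β r) (diffQuot τ z) n)) - ∑ r, P.d r * caputo₁ P.T (P.β r) ℓ t) := by
    simp only [schemeOp, caputoOp, Data.initialForcing, Data.wHigh, Data.wLow, Data.wLap, mul_sub,
      Finset.sum_sub_distrib, Finset.sum_mul, mul_assoc]
    ring
  rw [e]
  simp only [mul_add, Finset.sum_add_distrib, ← mul_assoc, ← Finset.sum_mul] at h1 h2 h3 h4 h5 h6
  have hτσ : 0 ≤ τ ^ σ := by positivity
  have h7 : (K₁ + K₂) * (τ ^ σ + ε) = (K₁ * τ ^ σ + K₂ * ε) + (K₂ * τ ^ σ + K₁ * ε) := by ring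
  have h8 : 0 ≤ K₂ * τ ^ σ + K₁ * ε := by positivity
  have h9 : K₁ * τ ^ σ + K₂ * ε = (∑ l, P.a l * kh l) * τ ^ σ + P.b₁ * k2 * τ ^ σ +
      (∑ m, P.c m * km m) * τ ^ σ + P.b₂ * k2 * τ ^ σ + P.b₃ * k2 * τ ^ σ +
      (∑ r, P.d r * kr r) * τ ^ σ + P.b₃ * ε + (∑ r, P.d r * er r) * ε := by
    rw [hK₁, hK₂]; ring
  have h10 : ∀ {a b c d e f A B C D E F : ℝ}, |a| ≤ A → |b| ≤ B → |c| ≤ C → |d| ≤ D → |e| ≤ E →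
      |f| ≤ F → |a + b + c + d - e - f| ≤ A + B + C + D + E + F := by
    intro a b c d e f A B C D E F ha hb hc hd he hf
    rw [abs_le] at *
    constructor <;> linarith [ha.1, ha.2, hb.1, hb.2, hc.1, hc.2, hd.1, hd.2, he.1, he.2, hf.1, hf.2]
  rw [h7, h9]
  have hfin := h10 h1 h2 h3 h4 h5 h6
  simp only [mul_sub, Finset.sum_sub_distrib, ← mul_assoc,
    ← Finset.sum_mul] at hfin ⊢
  linarith

end Node


/-! ### Regularity of the exact solution -/

/-- `D i j k`, `i, j ≤ 4`, `k ≤ 3`, are the partial derivatives of `u`, bounded by `M`. -/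
structure BoundedPartials (Lx Ly T M : ℝ) (u : ℝ → ℝ → ℝ → ℝ)
    (D : ℕ → ℕ → ℕ → ℝ → ℝ → ℝ → ℝ) : Prop where
  eq : ∀ x ∈ Icc 0 Lx, ∀ y ∈ Icc 0 Ly, ∀ t ∈ Icc 0 T, D 0 0 0 x y t = u x y t
  bound : ∀ i ≤ 4, ∀ j ≤ 4, ∀ k ≤ 3, ∀ x ∈ Icc 0 Lx, ∀ y ∈ Icc 0 Ly, ∀ t ∈ Icc 0 T,
    |D i j k x y t| ≤ M
  deriv_x : ∀ i < 4, ∀ j ≤ 4, ∀ k ≤ 3, ∀ x ∈ Icc 0 Lx, ∀ y ∈ Icc 0 Ly, ∀ t ∈ Icc 0 T,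
    HasDerivWithinAt (fun ξ => D i j k ξ y t) (D (i + 1) j k x y t) (Icc 0 Lx) x
  deriv_y : ∀ i ≤ 4, ∀ j < 4, ∀ k ≤ 3, ∀ x ∈ Icc 0 Lx, ∀ y ∈ Icc 0 Ly, ∀ t ∈ Icc 0 T,
    HasDerivWithinAt (fun η => D i j k x η t) (D i (j + 1) k x y t) (Icc 0 Ly) y
  deriv_t : ∀ i ≤ 4, ∀ j ≤ 4, ∀ k < 3, ∀ x ∈ Icc 0 Lx, ∀ y ∈ Icc 0 Ly, ∀ t ∈ Icc 0 T,
    HasDerivWithinAt (fun r => D i j k x y r) (D i j (k + 1) x y t) (Icc 0 T) t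

lemma IsC443.exists_boundedPartials {Lx Ly T : ℝ} {u : ℝ → ℝ → ℝ → ℝ}
    (h : IsC443 Lx Ly T u) : ∃ D M, 0 ≤ M ∧ BoundedPartials Lx Ly T M u D := by
  obtain ⟨D, heq, hcont, hx, hy, ht⟩ := h
  have hcpt : IsCompact (Icc 0 Lx ×ˢ Icc 0 Ly ×ˢ Icc 0 T) :=
    isCompact_Icc.prod (isCompact_Icc.prod isCompact_Icc)
  have hb : ∀ a : Fin 5 × Fin 5 × Fin 4, ∃ C, ∀ z ∈ Icc 0 Lx ×ˢ Icc 0 Ly ×ˢ Icc 0 T,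
      ‖D a.1 a.2.1 a.2.2 z.1 z.2.1 z.2.2‖ ≤ C := fun a =>
    hcpt.exists_bound_of_continuousOn
      (hcont _ (by omega) _ (by omega) _ (by omega))
  choose C hC using hb
  refine ⟨D, ∑ a, |C a|, Finset.sum_nonneg fun _ _ => abs_nonneg _, heq, ?_, hx, hy, ht⟩
  intro i hi j hj k hk x hxm y hym t htm
  let a : Fin 5 × Fin 5 × Fin 4 := (⟨i, by omega⟩, ⟨j, by omega⟩, ⟨k, by omega⟩)
  exact ((hC a (x, y, t) ⟨hxm, hym, htm⟩).trans (le_abs_self _)).trans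
    (Finset.single_le_sum (f := fun a => |C a|) (fun _ _ => abs_nonneg _) (Finset.mem_univ a))

lemma iteratedDerivWithin_two_eq {L : ℝ} (hL : 0 < L) {f g f₁ f₂ : ℝ → ℝ}
    (hg : EqOn f g (Icc 0 L))
    (h₁ : ∀ x ∈ Icc 0 L, HasDerivWithinAt g (f₁ x) (Icc 0 L) x)
    (h₂ : ∀ x ∈ Icc 0 L, HasDerivWithinAt f₁ (f₂ x) (Icc 0 L) x) {x : ℝ} (hx : x ∈ Icc 0 L) :
    iteratedDerivWithin 2 f (Icc 0 L) x = f₂ x := by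
  rw [iteratedDerivWithin_succ]
  have hw : EqOn (iteratedDerivWithin 1 f (Icc 0 L)) f₁ (Icc 0 L) := fun z hz => by
    rw [iteratedDerivWithin_one, derivWithin_congr hg (hg hz),
      (h₁ _ hz).derivWithin (uniqueDiffOn_Icc hL _ hz)]
  rw [derivWithin_congr hw (hw hx), (h₂ _ hx).derivWithin (uniqueDiffOn_Icc hL _ hx)]

/-- Fourth order remainder of the central second difference quotient. -/
lemma second_difference_le {L M : ℝ} {f f₁ f₂ f₃ f₄ : ℝ → ℝ}
    (h₁ : ∀ x ∈ Icc 0 L, HasDerivWithinAt f (f₁ x) (Icc 0 L) x)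
    (h₂ : ∀ x ∈ Icc 0 L, HasDerivWithinAt f₁ (f₂ x) (Icc 0 L) x)
    (h₃ : ∀ x ∈ Icc 0 L, HasDerivWithinAt f₂ (f₃ x) (Icc 0 L) x)
    (h₄ : ∀ x ∈ Icc 0 L, HasDerivWithinAt f₃ (f₄ x) (Icc 0 L) x)
    (hb₃ : ∀ x ∈ Icc 0 L, |f₃ x| ≤ M) (hb₄ : ∀ x ∈ Icc 0 L, |f₄ x| ≤ M) {x h : ℝ} (hh : 0 < h)
    (hx : x ∈ Icc 0 L) (hxl : x - h ∈ Icc 0 L) (hxr : x + h ∈ Icc 0 L) :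
    |(f (x - h) - 2 * f x + f (x + h)) / h ^ 2 - f₂ x| ≤ 2 * M * h ^ 2 := by
  have hreg : TimeRegular L M f₁ f₂ f₃ :=
    ⟨h₂, h₃, hb₃, fun a ha b hb => abs_sub_le_of_deriv_bound h₄ ha hb fun y hy _ => hb₄ y hy⟩
  have hM := hreg.bound_nonneg (hx.1.trans hx.2)
  have htaylor : ∀ b ∈ Icc 0 L, |f b - f x - f₁ x * (b - x) - f₂ x * (b - x) ^ 2 / 2 -
      f₃ x * (b - x) ^ 3 / 6| ≤ M * |b - x| ^ 4 := by
    intro b hb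
    have := abs_sub_le_of_deriv_bound
      (f := fun y => f y - f₁ x * y - f₂ x * (y - x) ^ 2 / 2 - f₃ x * (y - x) ^ 3 / 6)
      (f' := fun y => f₁ y - f₁ x - f₂ x * (y - x) - f₃ x * (y - x) ^ 2 / 2)
      (C := M * |b - x| ^ 3) (fun t ht => by
        have e2 := (((hasDerivWithinAt_id t (Icc 0 L)).sub_const x).pow 2).const_mul (f₂ x)
        have e3 := (((hasDerivWithinAt_id t (Icc 0 L)).sub_const x).pow 3).const_mul (f₃ x)
        refine ((((h₁ t ht).sub ((hasDerivWithinAt_id t _).const_mul (f₁ x))).sub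
          (e2.div_const 2)).sub (e3.div_const 6)).congr_deriv ?_
        simp only [id]
        push_cast
        ring) hx hb
      (fun y hy hya => (hreg.taylor_two hx hy).trans
        (mul_le_mul_of_nonneg_left (pow_le_pow_left₀ (abs_nonneg _) hya 3) hM))
    rw [show f b - f x - f₁ x * (b - x) - f₂ x * (b - x) ^ 2 / 2 - f₃ x * (b - x) ^ 3 / 6 =
      f b - f₁ x * b - f₂ x * (b - x) ^ 2 / 2 - f₃ x * (b - x) ^ 3 / 6 -
        (f x - f₁ x * x - f₂ x * (x - x) ^ 2 / 2 - f₃ x * (x - x) ^ 3 / 6) by ring]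
    refine this.trans_eq (by ring)
  have e1 := htaylor _ hxl
  have e2 := htaylor _ hxr
  rw [sub_sub_cancel_left, abs_neg, abs_of_pos hh] at e1
  rw [add_sub_cancel_left, abs_of_pos hh] at e2
  have e : (f (x - h) - 2 * f x + f (x + h)) / h ^ 2 - f₂ x =
      ((f (x - h) - f x - f₁ x * -h - f₂ x * (-h) ^ 2 / 2 - f₃ x * (-h) ^ 3 / 6) +
        (f (x + h) - f x - f₁ x * h - f₂ x * h ^ 2 / 2 - f₃ x * h ^ 3 / 6)) / h ^ 2 := by
    field_simp
    ring
  rw [e, abs_div, abs_of_pos (by positivity : 0 < h ^ 2), div_le_iff₀ (by positivity)]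
  refine (abs_add_le _ _).trans ((add_le_add e1 e2).trans_eq ?_)
  ring

lemma hasDerivWithinAt_eq_zero_of_eq_zero {T : ℝ} (hT : 0 < T) {v w : ℝ → ℝ}
    (hv : ∀ t ∈ Icc 0 T, HasDerivWithinAt v (w t) (Icc 0 T) t) (h0 : ∀ t ∈ Ioc 0 T, v t = 0) :
    ∀ t ∈ Icc 0 T, w t = 0 := by
  have hc : ContinuousOn v (Icc 0 T) := fun t ht => (hv t ht).continuousWithinAt
  have hz : EqOn v (fun _ => 0) (Icc 0 T) :=
    EqOn.of_subset_closure (s := Ioc 0 T) h0 hc continuousOn_const Ioc_subset_Icc_self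
      (closure_Ioc hT.ne).ge
  intro t ht
  rw [← (hv t ht).derivWithin (uniqueDiffOn_Icc hT t ht), derivWithin_congr hz (hz ht)]
  simp

section Regular

variable {Lx Ly T M : ℝ} {u : ℝ → ℝ → ℝ → ℝ} {D : ℕ → ℕ → ℕ → ℝ → ℝ → ℝ → ℝ}

lemma TimeRegular.congr {v w v₁ v₂ : ℝ → ℝ} (h : TimeRegular T M v v₁ v₂)
    (hw : ∀ t ∈ Icc 0 T, w t = v t) : TimeRegular T M w v₁ v₂ :=
  ⟨fun t ht => (h.deriv₁ t ht).congr hw (hw t ht), h.deriv₂, h.bound, h.lipschitz⟩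

lemma TimeRegular.mono {M' : ℝ} {v v₁ v₂ : ℝ → ℝ} (h : TimeRegular T M v v₁ v₂) (hM : M ≤ M') :
    TimeRegular T M' v v₁ v₂ :=
  ⟨h.deriv₁, h.deriv₂, fun t ht => (h.bound t ht).trans hM, fun a ha b hb =>
    (h.lipschitz a ha b hb).trans (mul_le_mul_of_nonneg_right hM (abs_nonneg _))⟩

lemma TimeRegular.add {M' : ℝ} {v v₁ v₂ w w₁ w₂ : ℝ → ℝ} (h : TimeRegular T M v v₁ v₂)
    (h' : TimeRegular T M' w w₁ w₂) :
    TimeRegular T (M + M') (fun t => v t + w t) (fun t => v₁ t + w₁ t) (fun t => v₂ t + w₂ t) := by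
  refine ⟨fun t ht => (h.deriv₁ t ht).add (h'.deriv₁ t ht),
    fun t ht => (h.deriv₂ t ht).add (h'.deriv₂ t ht),
    fun t ht => (abs_add_le _ _).trans (add_le_add (h.bound t ht) (h'.bound t ht)),
    fun a ha b hb => ?_⟩
  rw [add_sub_add_comm, add_mul]
  exact (abs_add_le _ _).trans (add_le_add (h.lipschitz a ha b hb) (h'.lipschitz a ha b hb))

variable (h : BoundedPartials Lx Ly T M u D)
include h

lemma BoundedPartials.timeRegular {i j : ℕ} (hi : i ≤ 4) (hj : j ≤ 4) {x y : ℝ}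
    (hx : x ∈ Icc 0 Lx) (hy : y ∈ Icc 0 Ly) :
    TimeRegular T M (fun t => D i j 0 x y t) (fun t => D i j 1 x y t) (fun t => D i j 2 x y t) :=
  ⟨fun t ht => h.deriv_t i hi j hj 0 (by omega) x hx y hy t ht,
    fun t ht => h.deriv_t i hi j hj 1 (by omega) x hx y hy t ht,
    fun t ht => h.bound i hi j hj 2 (by omega) x hx y hy t ht,
    fun _ ha _ hb => abs_sub_le_of_deriv_bound
      (fun t ht => h.deriv_t i hi j hj 2 (by omega) x hx y hy t ht) ha hb
      fun r hr _ => h.bound i hi j hj 3 le_rfl x hx y hy r hr⟩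

lemma BoundedPartials.timeRegular_self {x y : ℝ} (hx : x ∈ Icc 0 Lx) (hy : y ∈ Icc 0 Ly) :
    TimeRegular T M (fun t => u x y t) (fun t => D 0 0 1 x y t) (fun t => D 0 0 2 x y t) :=
  (h.timeRegular (by omega) (by omega) hx hy).congr fun t ht => (h.eq x hx y hy t ht).symm

lemma BoundedPartials.laplacian_eq (hLx : 0 < Lx) (hLy : 0 < Ly) {x y t : ℝ}
    (hx : x ∈ Icc 0 Lx) (hy : y ∈ Icc 0 Ly) (ht : t ∈ Icc 0 T) :
    laplacian Lx Ly u x y t = D 2 0 0 x y t + D 0 2 0 x y t := by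
  rw [laplacian]
  congr 1
  · exact iteratedDerivWithin_two_eq hLx (g := fun ξ => D 0 0 0 ξ y t)
      (f₁ := fun ξ => D 1 0 0 ξ y t) (f₂ := fun ξ => D 2 0 0 ξ y t)
      (fun ξ hξ => (h.eq ξ hξ y hy t ht).symm)
      (fun ξ hξ => h.deriv_x 0 (by omega) 0 (by omega) 0 (by omega) ξ hξ y hy t ht)
      (fun ξ hξ => h.deriv_x 1 (by omega) 0 (by omega) 0 (by omega) ξ hξ y hy t ht) hx
  · exact iteratedDerivWithin_two_eq hLy (g := fun η => D 0 0 0 x η t)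
      (f₁ := fun η => D 0 1 0 x η t) (f₂ := fun η => D 0 2 0 x η t)
      (fun η hη => (h.eq x hx η hη t ht).symm)
      (fun η hη => h.deriv_y 0 (by omega) 0 (by omega) 0 (by omega) x hx η hη t ht)
      (fun η hη => h.deriv_y 0 (by omega) 1 (by omega) 0 (by omega) x hx η hη t ht) hy

lemma BoundedPartials.timeRegular_laplacian (hLx : 0 < Lx) (hLy : 0 < Ly) {x y : ℝ}
    (hx : x ∈ Icc 0 Lx) (hy : y ∈ Icc 0 Ly) :
    TimeRegular T (M + M) (fun t => laplacian Lx Ly u x y t)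
      (fun t => D 2 0 1 x y t + D 0 2 1 x y t) (fun t => D 2 0 2 x y t + D 0 2 2 x y t) :=
  ((h.timeRegular (by omega) (by omega) hx hy).add
    (h.timeRegular (by omega) (by omega) hx hy)).congr
      fun _ ht => h.laplacian_eq hLx hLy hx hy ht

/-- Truncation error of the five-point stencil, uniformly for the time derivatives. -/
lemma BoundedPartials.stencil_le {k : ℕ} (hk : k ≤ 3) {x y t hx hy : ℝ} (hhx : 0 < hx)
    (hhy : 0 < hy) (hxm : x ∈ Icc 0 Lx) (hxl : x - hx ∈ Icc 0 Lx) (hxr : x + hx ∈ Icc 0 Lx)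
    (hym : y ∈ Icc 0 Ly) (hyl : y - hy ∈ Icc 0 Ly) (hyr : y + hy ∈ Icc 0 Ly)
    (ht : t ∈ Icc 0 T) :
    |(D 0 0 k (x - hx) y t - 2 * D 0 0 k x y t + D 0 0 k (x + hx) y t) / hx ^ 2 +
      (D 0 0 k x (y - hy) t - 2 * D 0 0 k x y t + D 0 0 k x (y + hy) t) / hy ^ 2 -
      (D 2 0 k x y t + D 0 2 k x y t)| ≤ 2 * M * (hx ^ 2 + hy ^ 2) := by
  have e1 := second_difference_le (f := fun ξ => D 0 0 k ξ y t) (f₁ := fun ξ => D 1 0 k ξ y t)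
    (f₂ := fun ξ => D 2 0 k ξ y t) (f₃ := fun ξ => D 3 0 k ξ y t) (f₄ := fun ξ => D 4 0 k ξ y t)
    (fun ξ hξ => h.deriv_x 0 (by omega) 0 (by omega) k hk ξ hξ y hym t ht)
    (fun ξ hξ => h.deriv_x 1 (by omega) 0 (by omega) k hk ξ hξ y hym t ht)
    (fun ξ hξ => h.deriv_x 2 (by omega) 0 (by omega) k hk ξ hξ y hym t ht)
    (fun ξ hξ => h.deriv_x 3 (by omega) 0 (by omega) k hk ξ hξ y hym t ht)
    (fun ξ hξ => h.bound 3 (by omega) 0 (by omega) k hk ξ hξ y hym t ht)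
    (fun ξ hξ => h.bound 4 (by omega) 0 (by omega) k hk ξ hξ y hym t ht) hhx hxm hxl hxr
  have e2 := second_difference_le (f := fun η => D 0 0 k x η t) (f₁ := fun η => D 0 1 k x η t)
    (f₂ := fun η => D 0 2 k x η t) (f₃ := fun η => D 0 3 k x η t) (f₄ := fun η => D 0 4 k x η t)
    (fun η hη => h.deriv_y 0 (by omega) 0 (by omega) k hk x hxm η hη t ht)
    (fun η hη => h.deriv_y 0 (by omega) 1 (by omega) k hk x hxm η hη t ht)
    (fun η hη => h.deriv_y 0 (by omega) 2 (by omega) k hk x hxm η hη t ht)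
    (fun η hη => h.deriv_y 0 (by omega) 3 (by omega) k hk x hxm η hη t ht)
    (fun η hη => h.bound 0 (by omega) 3 (by omega) k hk x hxm η hη t ht)
    (fun η hη => h.bound 0 (by omega) 4 (by omega) k hk x hxm η hη t ht) hhy hym hyl hyr
  rw [abs_le] at e1 e2 ⊢
  constructor <;> linarith [e1.1, e1.2, e2.1, e2.2]

/-- The time increments of the truncation error of the five-point stencil. -/
lemma BoundedPartials.stencil_increment_le {x y a b hx hy : ℝ} (hhx : 0 < hx)
    (hhy : 0 < hy) (hxm : x ∈ Icc 0 Lx) (hxl : x - hx ∈ Icc 0 Lx) (hxr : x + hx ∈ Icc 0 Lx)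
    (hym : y ∈ Icc 0 Ly) (hyl : y - hy ∈ Icc 0 Ly) (hyr : y + hy ∈ Icc 0 Ly)
    (ha : a ∈ Icc 0 T) (hb : b ∈ Icc 0 T) :
    |((D 0 0 0 (x - hx) y b - 2 * D 0 0 0 x y b + D 0 0 0 (x + hx) y b) / hx ^ 2 +
      (D 0 0 0 x (y - hy) b - 2 * D 0 0 0 x y b + D 0 0 0 x (y + hy) b) / hy ^ 2 -
      (D 2 0 0 x y b + D 0 2 0 x y b)) -
      ((D 0 0 0 (x - hx) y a - 2 * D 0 0 0 x y a + D 0 0 0 (x + hx) y a) / hx ^ 2 +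
      (D 0 0 0 x (y - hy) a - 2 * D 0 0 0 x y a + D 0 0 0 x (y + hy) a) / hy ^ 2 -
      (D 2 0 0 x y a + D 0 2 0 x y a))| ≤ 2 * M * (hx ^ 2 + hy ^ 2) * |b - a| := by
  have hd : ∀ {i j : ℕ}, i ≤ 4 → j ≤ 4 → ∀ {ξ η : ℝ}, ξ ∈ Icc 0 Lx → η ∈ Icc 0 Ly →
      ∀ {t : ℝ}, t ∈ Icc 0 T →
      HasDerivWithinAt (fun r => D i j 0 ξ η r) (D i j 1 ξ η t) (Icc 0 T) t :=
    fun hi hj _ _ hξ hη _ ht => h.deriv_t _ hi _ hj 0 (by omega) _ hξ _ hη _ ht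
  have z : 0 ≤ 4 := by omega
  have w : 2 ≤ 4 := by omega
  exact abs_sub_le_of_deriv_bound
    (f := fun t => (D 0 0 0 (x - hx) y t - 2 * D 0 0 0 x y t + D 0 0 0 (x + hx) y t) / hx ^ 2 +
      (D 0 0 0 x (y - hy) t - 2 * D 0 0 0 x y t + D 0 0 0 x (y + hy) t) / hy ^ 2 -
      (D 2 0 0 x y t + D 0 2 0 x y t))
    (fun t ht => (((((hd z z hxl hym ht).sub ((hd z z hxm hym ht).const_mul 2)).add
      (hd z z hxr hym ht)).div_const _).add ((((hd z z hxm hyl ht).sub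
      ((hd z z hxm hym ht).const_mul 2)).add (hd z z hxm hyr ht)).div_const _)).sub
      ((hd w z hxm hym ht).add (hd z w hxm hym ht)))
    ha hb (fun t ht _ => h.stencil_le (k := 1) (by omega) hhx hhy hxm hxl hxr hym hyl hyr ht)

end Regular


/-! ### The nodes of the grid -/

section Grid

lemma node_mem_Icc {L : ℝ} (hL : 0 < L) {M i : ℕ} (hi : i ≤ M) :
    (i : ℝ) * (L / M) ∈ Icc 0 L := by
  rcases Nat.eq_zero_or_pos M with rfl | hM
  · simpa using hL.le
  have hM' : (0 : ℝ) < M := by exact_mod_cast hM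
  have hi' : (i : ℝ) ≤ M := by exact_mod_cast hi
  refine ⟨by positivity, ?_⟩
  rw [← mul_div_assoc, div_le_iff₀ hM', mul_comm L]
  exact mul_le_mul_of_nonneg_right hi' hL.le

lemma node_mem_Ioo {L : ℝ} (hL : 0 < L) {M i : ℕ} (hi : i ∈ Finset.Icc 1 (M - 1)) :
    (i : ℝ) * (L / M) ∈ Ioo 0 L := by
  have hi := Finset.mem_Icc.1 hi
  have hM' : (0 : ℝ) < M := by exact_mod_cast (by omega : 0 < M)
  have hi0 : (0 : ℝ) < i := by exact_mod_cast hi.1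
  have hi' : (i : ℝ) < M := by exact_mod_cast (by omega : i < M)
  refine ⟨by positivity, ?_⟩
  rw [← mul_div_assoc, div_lt_iff₀ hM', mul_comm L]
  exact mul_lt_mul_of_pos_right hi' hL

lemma cast_pred_mul {i : ℕ} (hi : 1 ≤ i) (h : ℝ) : ((i - 1 : ℕ) : ℝ) * h = i * h - h := by
  rw [Nat.cast_sub hi, Nat.cast_one]; ring

lemma cast_succ_mul (i : ℕ) (h : ℝ) : ((i + 1 : ℕ) : ℝ) * h = i * h + h := by
  push_cast; ring

lemma sum_sum_Icc_le {Mx My Ax Ay : ℕ} (hx : Ax ≤ Mx) (hy : Ay ≤ My) {f : ℕ → ℕ → ℝ} {B : ℝ}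
    (hB : 0 ≤ B) (hf : ∀ i, 1 ≤ i → i ≤ Mx → ∀ j, 1 ≤ j → j ≤ My → f i j ≤ B) {Lx Ly : ℝ}
    (hMx : 0 < Mx) (hMy : 0 < My) (hLx : 0 < Lx) (hLy : 0 < Ly) :
    Lx / Mx * (Ly / My) * ∑ i ∈ Finset.Icc 1 Ax, ∑ j ∈ Finset.Icc 1 Ay, f i j ≤ Lx * Ly * B := by
  have hMx' : (0 : ℝ) < Mx := by exact_mod_cast hMx
  have hMy' : (0 : ℝ) < My := by exact_mod_cast hMy
  have h1 : ∑ i ∈ Finset.Icc 1 Ax, ∑ j ∈ Finset.Icc 1 Ay, f i j ≤ Mx * (My * B) := by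
    calc _ ≤ ∑ i ∈ Finset.Icc 1 Ax, ∑ j ∈ Finset.Icc 1 Ay, B := by
          refine Finset.sum_le_sum fun i hi => Finset.sum_le_sum fun j hj => ?_
          have hi := Finset.mem_Icc.1 hi
          have hj := Finset.mem_Icc.1 hj
          exact hf i hi.1 (hi.2.trans hx) j hj.1 (hj.2.trans hy)
      _ = Ax * (Ay * B) := by simp
      _ ≤ _ := by gcongr
  calc _ ≤ Lx / Mx * (Ly / My) * (Mx * (My * B)) :=
        mul_le_mul_of_nonneg_left h1 (by positivity)
    _ = _ := by field_simp

end Grid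

section Convergence

variable {p q s : ℕ} {P : Data p q s} {u : ℝ → ℝ → ℝ → ℝ} {M : ℝ}
  {D : ℕ → ℕ → ℕ → ℝ → ℝ → ℝ → ℝ}

lemma BoundedPartials.initial_acceleration_norm_le (hP : P.Admissible)
    (h : BoundedPartials P.Lx P.Ly P.T M u D) {Mx My : ℕ} (hMx : 0 < Mx) (hMy : 0 < My) :
    P.b₂ * normZeroSq (P.Lx / Mx) (P.Ly / My) Mx My
        (fun i j => D 0 0 2 (i * (P.Lx / Mx)) (j * (P.Ly / My)) 0) +
      P.b₃ * seminormGradSq (P.Lx / Mx) (P.Ly / My) Mx My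
        (fun i j => D 0 0 2 (i * (P.Lx / Mx)) (j * (P.Ly / My)) 0) ≤
      (P.b₂ + 2 * P.b₃) * (P.Lx * P.Ly * M ^ 2) := by
  have hLx := hP.Lx_pos
  have hLy := hP.Ly_pos
  have h0 : (0 : ℝ) ∈ Icc 0 P.T := ⟨le_rfl, hP.T_pos.le⟩
  have hMx' : (0 : ℝ) < Mx := by exact_mod_cast hMx
  have hMy' : (0 : ℝ) < My := by exact_mod_cast hMy
  have h1 : normZeroSq (P.Lx / Mx) (P.Ly / My) Mx My
      (fun i j => D 0 0 2 (i * (P.Lx / Mx)) (j * (P.Ly / My)) 0) ≤ P.Lx * P.Ly * M ^ 2 := by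
    refine sum_sum_Icc_le (Nat.sub_le _ _) (Nat.sub_le _ _) (sq_nonneg M) ?_ hMx hMy hLx hLy
    intro i _ hi j _ hj
    exact sq_le_sq' (abs_le.1 (h.bound 0 (by omega) 0 (by omega) 2 (by omega) _
      (node_mem_Icc hLx hi) _ (node_mem_Icc hLy hj) 0 h0)).1 (abs_le.1 (h.bound 0 (by omega) 0
      (by omega) 2 (by omega) _ (node_mem_Icc hLx hi) _ (node_mem_Icc hLy hj) 0 h0)).2
  have h2 : seminormGradSq (P.Lx / Mx) (P.Ly / My) Mx My
      (fun i j => D 0 0 2 (i * (P.Lx / Mx)) (j * (P.Ly / My)) 0) ≤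
      P.Lx * P.Ly * (2 * M ^ 2) := by
    refine sum_sum_Icc_le le_rfl le_rfl (by positivity) ?_ hMx hMy hLx hLy
    intro i hi1 hi j hj1 hj
    have hhx : 0 < P.Lx / Mx := by positivity
    have hhy : 0 < P.Ly / My := by positivity
    have e1 := abs_sub_le_of_deriv_bound
      (f := fun ξ => D 0 0 2 ξ (j * (P.Ly / My)) 0) (C := M)
      (fun ξ hξ => h.deriv_x 0 (by omega) 0 (by omega) 2 (by omega) ξ hξ _ (node_mem_Icc hLy hj) 0 h0)
      (node_mem_Icc hLx (show i - 1 ≤ Mx by omega)) (node_mem_Icc hLx hi)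
      (fun ξ hξ _ => h.bound 1 (by omega) 0 (by omega) 2 (by omega) ξ hξ _ (node_mem_Icc hLy hj) 0 h0)
    have e2 := abs_sub_le_of_deriv_bound
      (f := fun η => D 0 0 2 (i * (P.Lx / Mx)) η 0) (C := M)
      (fun η hη => h.deriv_y 0 (by omega) 0 (by omega) 2 (by omega) _ (node_mem_Icc hLx hi) η hη 0 h0)
      (node_mem_Icc hLy (show j - 1 ≤ My by omega)) (node_mem_Icc hLy hj)
      (fun η hη _ => h.bound 0 (by omega) 1 (by omega) 2 (by omega) _ (node_mem_Icc hLx hi) η hη 0 h0)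
    rw [cast_pred_mul hi1, sub_sub_cancel, abs_of_pos hhx, ← cast_pred_mul hi1] at e1
    rw [cast_pred_mul hj1, sub_sub_cancel, abs_of_pos hhy, ← cast_pred_mul hj1] at e2
    have hd : ∀ {a b : ℝ}, 0 < b → |a| ≤ M * b → (a / b) ^ 2 ≤ M ^ 2 := by
      intro a b hb hab
      have : |a / b| ≤ M := by rwa [abs_div, abs_of_pos hb, div_le_iff₀ hb]
      exact sq_le_sq' (abs_le.1 this).1 (abs_le.1 this).2
    have e3 := hd hhx e1
    have e4 := hd hhy e2
    simp only [dx, dy]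
    linarith
  have h3 := mul_le_mul_of_nonneg_left h1 hP.b₂_pos.le
  have h4 := mul_le_mul_of_nonneg_left h2 hP.b₃_pos.le
  linarith

lemma IsExactSolution.boundary_eq_zero (hP : P.Admissible) (hu : IsExactSolution P u) {Mx My : ℕ}
    (hMx : 0 < Mx) (hMy : 0 < My) {i j : ℕ} (hi : i ≤ Mx) (hj : j ≤ My)
    (hb : i = 0 ∨ i = Mx ∨ j = 0 ∨ j = My) {t : ℝ} (ht : t ∈ Ioc 0 P.T) :
    u (i * (P.Lx / Mx)) (j * (P.Ly / My)) t = 0 := by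
  have hMx' : (Mx : ℝ) ≠ 0 := by exact_mod_cast hMx.ne'
  have hMy' : (My : ℝ) ≠ 0 := by exact_mod_cast hMy.ne'
  rcases hb with rfl | rfl | rfl | rfl
  · simpa using (hu.boundary_x _ (node_mem_Icc hP.Ly_pos hj) t ht).1
  · rw [mul_div_cancel₀ _ hMx']
    exact (hu.boundary_x _ (node_mem_Icc hP.Ly_pos hj) t ht).2
  · simpa using (hu.boundary_y _ (node_mem_Icc hP.Lx_pos hi) t ht).1
  · rw [mul_div_cancel₀ _ hMy']
    exact (hu.boundary_y _ (node_mem_Icc hP.Lx_pos hi) t ht).2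

lemma BoundedPartials.initial_acceleration_boundaryZero (hP : P.Admissible)
    (hu : IsExactSolution P u) (h : BoundedPartials P.Lx P.Ly P.T M u D) {Mx My : ℕ}
    (hMx : 0 < Mx) (hMy : 0 < My) :
    BoundaryZero Mx My (fun i j => D 0 0 2 (i * (P.Lx / Mx)) (j * (P.Ly / My)) 0) := by
  intro i hi j hj hb
  have hreg := h.timeRegular_self (node_mem_Icc hP.Lx_pos hi) (node_mem_Icc hP.Ly_pos hj)
  have h1 := hasDerivWithinAt_eq_zero_of_eq_zero hP.T_pos hreg.deriv₁
    fun t ht => hu.boundary_eq_zero hP hMx hMy hi hj hb ht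
  exact hasDerivWithinAt_eq_zero_of_eq_zero hP.T_pos hreg.deriv₂
    (fun t ht => h1 t (Ioc_subset_Icc_self ht)) 0 ⟨le_rfl, hP.T_pos.le⟩

/-- Consistency of the scheme on the grid. The initial second time derivative enters the
consistency error with weights that are only summable in time. -/
theorem grid_consistency (hP : P.Admissible) (hu : IsExactSolution P u) (hM : 0 ≤ M)
    (h : BoundedPartials P.Lx P.Ly P.T M u D) :
    ∃ K ≥ 0, ∀ Mx My N : ℕ, 0 < Mx → 0 < My → 0 < N → ∀ n ∈ Finset.Icc 1 N,
      ∀ i ∈ Finset.Icc 1 (Mx - 1), ∀ j ∈ Finset.Icc 1 (My - 1),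
      |schemeOp P (P.T / N) (fun n => u (i * (P.Lx / Mx)) (j * (P.Ly / My)) (n * (P.T / N)))
          (fun n => discLaplacian (P.Lx / Mx) (P.Ly / My)
            (fun i j => u (i * (P.Lx / Mx)) (j * (P.Ly / My)) (n * (P.T / N))) i j)
          (P.ϕ (i * (P.Lx / Mx)) (j * (P.Ly / My))) n - midSource P Mx My N n i j -
        P.initialForcing (P.T / N) n * D 0 0 2 (i * (P.Lx / Mx)) (j * (P.Ly / My)) 0| ≤
      K * ((P.T / N) ^ order P + (P.Lx / Mx) ^ 2 + (P.Ly / My) ^ 2) := by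
  obtain ⟨K, hK, hcons⟩ := scheme_consistency hP (M := M + M) (by linarith)
  refine ⟨K * (1 + 2 * M), by positivity, ?_⟩
  intro Mx My N hMx hMy hN n hn i hi j hj
  have hT := hP.T_pos
  have hMx' : (0 : ℝ) < Mx := by exact_mod_cast hMx
  have hMy' : (0 : ℝ) < My := by exact_mod_cast hMy
  have hN' : (0 : ℝ) < N := by exact_mod_cast hN
  have hLx := hP.Lx_pos
  have hLy := hP.Ly_pos
  have hhx : 0 < P.Lx / Mx := by positivity
  have hhy : 0 < P.Ly / My := by positivity
  have hτ : 0 < P.T / N := by positivity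
  have hn' := Finset.mem_Icc.1 hn
  have hi' := Finset.mem_Icc.1 hi
  have hj' := Finset.mem_Icc.1 hj
  have hxo := node_mem_Ioo hLx hi
  have hyo := node_mem_Ioo hLy hj
  have hx := Ioo_subset_Icc_self hxo
  have hy := Ioo_subset_Icc_self hyo
  have hxl : (i : ℝ) * (P.Lx / Mx) - P.Lx / Mx ∈ Icc 0 P.Lx := by
    rw [← cast_pred_mul hi'.1]; exact node_mem_Icc hLx (by omega)
  have hxr : (i : ℝ) * (P.Lx / Mx) + P.Lx / Mx ∈ Icc 0 P.Lx := by
    rw [← cast_succ_mul]; exact node_mem_Icc hLx (by omega)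
  have hyl : (j : ℝ) * (P.Ly / My) - P.Ly / My ∈ Icc 0 P.Ly := by
    rw [← cast_pred_mul hj'.1]; exact node_mem_Icc hLy (by omega)
  have hyr : (j : ℝ) * (P.Ly / My) + P.Ly / My ∈ Icc 0 P.Ly := by
    rw [← cast_succ_mul]; exact node_mem_Icc hLy (by omega)
  have hlev : ∀ k ≤ N, (k : ℝ) * (P.T / N) ∈ Icc 0 P.T := fun k hk => node_mem_Icc hT hk
  have hnT := (hlev n hn'.2).2
  have hreg := h.timeRegular_self hx hy
  have hϕ : P.ϕ (i * (P.Lx / Mx)) (j * (P.Ly / My)) =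
      D 0 0 1 (i * (P.Lx / Mx)) (j * (P.Ly / My)) 0 := by
    rw [← hu.initial_velocity _ hxo _ hyo]
    exact (hreg.deriv₁ 0 ⟨le_rfl, hT.le⟩).derivWithin (uniqueDiffOn_Icc hT 0 ⟨le_rfl, hT.le⟩)
  obtain ⟨htm, -, -⟩ := mem_Icc_levels hτ hn'.1 hnT
  have ht0 : 0 < ((n : ℝ) - 1 / 2) * (P.T / N) := by
    have : (1 : ℝ) ≤ n := by exact_mod_cast hn'.1
    exact mul_pos (by linarith) hτ
  have hf : caputoOp P (fun t => u (i * (P.Lx / Mx)) (j * (P.Ly / My)) t)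
      (fun t => laplacian P.Lx P.Ly u (i * (P.Lx / Mx)) (j * (P.Ly / My)) t)
      (((n : ℝ) - 1 / 2) * (P.T / N)) = midSource P Mx My N n i j := by
    have := hu.equation _ hxo _ hyo _ ⟨ht0, htm.2⟩
    simp only [caputoOp, midSource]
    linarith
  have hz : ∀ k ≤ N, discLaplacian (P.Lx / Mx) (P.Ly / My)
      (fun i j => u (i * (P.Lx / Mx)) (j * (P.Ly / My)) (k * (P.T / N))) i j =
      (D 0 0 0 (i * (P.Lx / Mx) - P.Lx / Mx) (j * (P.Ly / My)) (k * (P.T / N)) -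
        2 * D 0 0 0 (i * (P.Lx / Mx)) (j * (P.Ly / My)) (k * (P.T / N)) +
        D 0 0 0 (i * (P.Lx / Mx) + P.Lx / Mx) (j * (P.Ly / My)) (k * (P.T / N))) /
          (P.Lx / Mx) ^ 2 +
      (D 0 0 0 (i * (P.Lx / Mx)) (j * (P.Ly / My) - P.Ly / My) (k * (P.T / N)) -
        2 * D 0 0 0 (i * (P.Lx / Mx)) (j * (P.Ly / My)) (k * (P.T / N)) +
        D 0 0 0 (i * (P.Lx / Mx)) (j * (P.Ly / My) + P.Ly / My) (k * (P.T / N))) /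
          (P.Ly / My) ^ 2 := by
    intro k hk
    have ht := hlev k hk
    simp only [discLaplacian, cast_pred_mul hi'.1, cast_pred_mul hj'.1, cast_succ_mul]
    rw [h.eq _ hx _ hy _ ht, h.eq _ hxl _ hy _ ht, h.eq _ hxr _ hy _ ht, h.eq _ hx _ hyl _ ht,
      h.eq _ hx _ hyr _ ht]
  have hε : 0 ≤ 2 * M * ((P.Lx / Mx) ^ 2 + (P.Ly / My) ^ 2) := by positivity
  have hmain := hcons (hreg.mono (by linarith : M ≤ M + M)) (h.timeRegular_laplacian hLx hLy hx hy)
    hτ hn'.1 hnT (z := fun n => discLaplacian (P.Lx / Mx) (P.Ly / My)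
            (fun i j => u (i * (P.Lx / Mx)) (j * (P.Ly / My)) (n * (P.T / N))) i j) hε
    (by
      intro k hk
      have ht := hlev k (hk.trans hn'.2)
      rw [hz k (hk.trans hn'.2), h.laplacian_eq hLx hLy hx hy ht]
      exact h.stencil_le (by omega) hhx hhy hx hxl hxr hy hyl hyr ht)
    (by
      intro k hk1 hk
      have ht := hlev k (hk.trans hn'.2)
      have ht' := hlev (k - 1) (by omega)
      have e := h.stencil_increment_le hhx hhy hx hxl hxr hy hyl hyr ht' ht
      rw [← hz k (by omega), ← hz (k - 1) (by omega), ← h.laplacian_eq hLx hLy hx hy ht,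
        ← h.laplacian_eq hLx hLy hx hy ht'] at e
      have e2 : (k : ℝ) * (P.T / N) - ((k - 1 : ℕ) : ℝ) * (P.T / N) = P.T / N := by
        rw [cast_pred_mul hk1]; ring
      rw [e2, abs_of_pos hτ] at e
      simp only [diffQuot]
      rw [← sub_div, abs_div, abs_of_pos hτ, div_le_iff₀ hτ]
      refine le_trans (le_of_eq ?_) e
      congr 1
      ring)
  rw [hf, ← hϕ] at hmain
  refine hmain.trans ?_
  have hτσ : 0 ≤ (P.T / N) ^ order P := by positivity
  have e1 : 0 ≤ K * (2 * M * (P.T / N) ^ order P) := by positivity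
  have e2 : 0 ≤ K * ((P.Lx / Mx) ^ 2 + (P.Ly / My) ^ 2) := by positivity
  linarith

lemma seminormSumSq_le {hx hy : ℝ} (hhx : 0 ≤ hx) (hhy : 0 ≤ hy) (Mx My : ℕ) (v : ℕ → ℕ → ℝ) :
    seminormSumSq hx hy Mx My v ≤ 2 * seminormGradSq hx hy Mx My v := by
  have h : ∑ i ∈ Finset.Icc 1 Mx, ∑ j ∈ Finset.Icc 1 My, (dx hx v i j + dy hy v i j) ^ 2 ≤
      2 * ∑ i ∈ Finset.Icc 1 Mx, ∑ j ∈ Finset.Icc 1 My, (dx hx v i j ^ 2 + dy hy v i j ^ 2) := by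
    simp only [Finset.mul_sum]
    exact Finset.sum_le_sum fun i _ => Finset.sum_le_sum fun j _ => add_sq_le
  rw [seminormSumSq, seminormGradSq, mul_left_comm 2]
  exact mul_le_mul_of_nonneg_left h (mul_nonneg hhx hhy)

lemma schemeOp_eq_source {Mx My N : ℕ} {F U : ℕ → ℕ → ℕ → ℝ}
    (hU : IsSchemeSolution P Mx My N F U) {n i j : ℕ} (hn : n ∈ Finset.Icc 1 N)
    (hi : i ∈ Finset.Icc 1 (Mx - 1)) (hj : j ∈ Finset.Icc 1 (My - 1)) :
    schemeOp P (P.T / N) (fun n => U n i j)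
      (fun n => discLaplacian (P.Lx / Mx) (P.Ly / My) (U n) i j)
      (P.ϕ (i * (P.Lx / Mx)) (j * (P.Ly / My))) n = F n i j := by
  have := hU.equation n hn i hi j hj
  simp only [dt] at this
  simp only [schemeOp, Data.wHigh, Data.wLow, Data.wLap, highForm, lowForm, diffQuot]
  linarith

/-- Convergence of the scheme with a source that agrees with `midSource` up to `O(τ^order)`. -/
theorem error_estimate (hP : P.Admissible) (hu : IsExactSolution P u)
    (hreg : IsC443 P.Lx P.Ly P.T u) {κ : ℝ} (hκ : 0 ≤ κ) :
    ∃ C : ℝ, 0 < C ∧ ∀ Mx My N : ℕ, 0 < Mx → 0 < My → 0 < N → ∀ F U : ℕ → ℕ → ℕ → ℝ,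
      (∀ n ∈ Finset.Icc 1 N, ∀ i ∈ Finset.Icc 1 (Mx - 1), ∀ j ∈ Finset.Icc 1 (My - 1),
        |F n i j - midSource P Mx My N n i j| ≤ κ * (P.T / N) ^ order P) →
      IsSchemeSolution P Mx My N F U → ∀ n ≤ N,
        normH1Grad P Mx My (error P Mx My N u U n) ≤ C * rate P Mx My N ∧
        normH1Sum P Mx My (error P Mx My N u U n) ≤ C * rate P Mx My N := by
  obtain ⟨D, M, hM, h⟩ := hreg.exists_boundedPartials
  obtain ⟨C₁, hC₁, hgrid⟩ := grid_estimate hP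
  obtain ⟨K, hK, hcons⟩ := grid_consistency hP hu hM h
  obtain ⟨K₃, hK₃, hforce⟩ := sum_initialForcing_le hP
  have hT := hP.T_pos
  have hLx := hP.Lx_pos
  have hLy := hP.Ly_pos
  have hb₁ := hP.b₁_pos
  have hb₂ := hP.b₂_pos
  have hb₃ := hP.b₃_pos
  set S := Real.sqrt (P.T * P.Lx * P.Ly /
      ((∑ l, P.a l * P.T ^ (1 - P.γ l) / Real.Gamma (2 - P.γ l)) + 2 * P.b₁)) with hS
  have hS0 : 0 < S := by
    apply Real.sqrt_pos.2
    have : 0 ≤ ∑ l, P.a l * P.T ^ (1 - P.γ l) / Real.Gamma (2 - P.γ l) :=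
      Finset.sum_nonneg fun l _ => by
        have := hP.a_pos l
        have := Real.Gamma_pos_of_pos (by linarith [(hP.γ_mem l).2] : 0 < 2 - P.γ l)
        positivity
    positivity
  set C₂ := C₁ * (P.T * P.Lx * P.Ly * (K + κ) ^ 2) +
    C₁ * ((P.b₂ + 2 * P.b₃) * (P.Lx * P.Ly * M ^ 2)) * K₃ ^ 2 with hC₂
  have hC₂0 : 0 ≤ C₂ := by positivity
  refine ⟨Real.sqrt (2 * C₂) / S + 1, by positivity, ?_⟩
  intro Mx My N hMx hMy hN F U hF hU n hn
  have hMx' : (0 : ℝ) < Mx := by exact_mod_cast hMx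
  have hMy' : (0 : ℝ) < My := by exact_mod_cast hMy
  have hN' : (0 : ℝ) < N := by exact_mod_cast hN
  have hτ : 0 < P.T / N := by positivity
  set E := (P.T / N) ^ order P + (P.Lx / Mx) ^ 2 + (P.Ly / My) ^ 2 with hE
  have hτσ : 0 ≤ (P.T / N) ^ order P := by positivity
  have hτE : (P.T / N) ^ order P ≤ E := by
    have : 0 ≤ (P.Lx / Mx) ^ 2 + (P.Ly / My) ^ 2 := by positivity
    linarith
  have hE0 : 0 ≤ E := hτσ.trans hτE
  set g : ℕ → ℕ → ℝ := fun i j => D 0 0 2 (i * (P.Lx / Mx)) (j * (P.Ly / My)) 0 with hg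
  set e := error P Mx My N u U with he
  have he0 : ∀ i ≤ Mx, ∀ j ≤ My, e 0 i j = 0 := by
    intro i hi j hj
    simp only [he, error]
    rw [hU.initial i hi j hj, Nat.cast_zero, zero_mul,
      hu.initial _ (node_mem_Icc hLx hi) _ (node_mem_Icc hLy hj), sub_self]
  have heb : ∀ n ≤ N, BoundaryZero Mx My (e n) := by
    intro m hm i hi j hj hb
    rcases Nat.eq_zero_or_pos m with rfl | hm0
    · exact he0 i hi j hj
    have hm0' : (0 : ℝ) < m := by exact_mod_cast hm0
    simp only [he, error]
    rw [hU.boundary m (Finset.mem_Icc.2 ⟨hm0, hm⟩) i hi j hj hb,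
      hu.boundary_eq_zero hP hMx hMy hi hj hb ⟨by positivity, (node_mem_Icc hT hm).2⟩, sub_self]
  have hbound := hgrid Mx My N hMx hMy hN e
    (fun n i j => schemeOp P (P.T / N) (fun n => e n i j)
      (fun n => discLaplacian (P.Lx / Mx) (P.Ly / My) (e n) i j) 0 n -
        P.initialForcing (P.T / N) n * g i j)
    g (P.initialForcing (P.T / N)) ((K + κ) * E) heb he0
    (h.initial_acceleration_boundaryZero hP hu hMx hMy)
    (by
      intro m hm i hi j hj
      have hlap : (fun n : ℕ => discLaplacian (P.Lx / Mx) (P.Ly / My) (e n) i j) =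
          fun n : ℕ => discLaplacian (P.Lx / Mx) (P.Ly / My)
            (fun i j => u (i * (P.Lx / Mx)) (j * (P.Ly / My)) (n * (P.T / N))) i j -
            discLaplacian (P.Lx / Mx) (P.Ly / My) (U n) i j := by
        ext k
        simp only [he, error, discLaplacian]
        ring
      have hsub := schemeOp_sub P (P.T / N)
        (fun n => u (i * (P.Lx / Mx)) (j * (P.Ly / My)) (n * (P.T / N)))
        (fun n => discLaplacian (P.Lx / Mx) (P.Ly / My)
            (fun i j => u (i * (P.Lx / Mx)) (j * (P.Ly / My)) (n * (P.T / N))) i j)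
        (fun n => U n i j) (fun n => discLaplacian (P.Lx / Mx) (P.Ly / My) (U n) i j)
        (P.ϕ (i * (P.Lx / Mx)) (j * (P.Ly / My))) (P.ϕ (i * (P.Lx / Mx)) (j * (P.Ly / My))) m
      rw [sub_self, schemeOp_eq_source hU hm hi hj, ← hlap] at hsub
      have h1 := hcons Mx My N hMx hMy hN m hm i hi j hj
      have h2 := hF m hm i hi j hj
      have h3 : κ * (P.T / N) ^ order P ≤ κ * E := mul_le_mul_of_nonneg_left hτE hκ
      have h4 : schemeOp P (P.T / N) (fun n => e n i j)
          (fun n => discLaplacian (P.Lx / Mx) (P.Ly / My) (e n) i j) 0 m =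
          schemeOp P (P.T / N) (fun n => u (i * (P.Lx / Mx)) (j * (P.Ly / My)) (n * (P.T / N)))
            (fun n => discLaplacian (P.Lx / Mx) (P.Ly / My)
              (fun i j => u (i * (P.Lx / Mx)) (j * (P.Ly / My)) (n * (P.T / N))) i j)
            (P.ϕ (i * (P.Lx / Mx)) (j * (P.Ly / My))) m - F m i j := hsub
      rw [h4]
      rw [abs_le] at h1 h2 ⊢
      constructor <;> linarith [h1.1, h1.2, h2.1, h2.2])
    (fun m _ i _ j _ => by ring) n hn
  have hZ : 0 ≤ normZeroSq (P.Lx / Mx) (P.Ly / My) Mx My (e n) :=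
    mul_nonneg (by positivity) (Finset.sum_nonneg fun _ _ => Finset.sum_nonneg fun _ _ => sq_nonneg _)
  have hsq : P.b₂ * normZeroSq (P.Lx / Mx) (P.Ly / My) Mx My (e n) +
      P.b₃ * seminormGradSq (P.Lx / Mx) (P.Ly / My) Mx My (e n) ≤ C₂ * E ^ 2 := by
    refine hbound.trans ?_
    have h1 := h.initial_acceleration_norm_le hP hMx hMy
    have h2 : ((P.T / N) * ∑ n ∈ Finset.Icc 1 N, |P.initialForcing (P.T / N) n|) ^ 2 ≤
        (K₃ * E) ^ 2 := by
      apply pow_le_pow_left₀ (mul_nonneg hτ.le (Finset.sum_nonneg fun _ _ => abs_nonneg _))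
      exact (hforce N hN).trans (mul_le_mul_of_nonneg_left hτE hK₃)
    have h3 := mul_le_mul (mul_le_mul_of_nonneg_left h1 hC₁.le) h2 (sq_nonneg _)
      (by positivity)
    refine (add_le_add le_rfl h3).trans_eq ?_
    rw [hC₂]
    ring
  have hsqrt : Real.sqrt (2 * C₂ * E ^ 2) = Real.sqrt (2 * C₂) * E := by
    rw [Real.sqrt_mul (by positivity), Real.sqrt_sq hE0]
  have hfin : Real.sqrt (2 * C₂) * E ≤ (Real.sqrt (2 * C₂) / S + 1) * rate P Mx My N := by
    have hr : rate P Mx My N = S * E := rfl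
    rw [hr, add_mul, ← mul_assoc, div_mul_cancel₀ _ hS0.ne']
    have : 0 ≤ 1 * (S * E) := by positivity
    linarith
  have hCE : 0 ≤ C₂ * E ^ 2 := by positivity
  refine ⟨le_trans ?_ hfin, le_trans ?_ hfin⟩
  · rw [← hsqrt]
    exact Real.sqrt_le_sqrt (hsq.trans (by linarith))
  · rw [← hsqrt]
    apply Real.sqrt_le_sqrt
    have h1 := mul_le_mul_of_nonneg_left
      (seminormSumSq_le (hx := P.Lx / Mx) (hy := P.Ly / My) (by positivity) (by positivity) Mx My
        (e n)) hb₃.le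
    have h2 := mul_nonneg hb₂.le hZ
    linarith

end Convergence

end OldroydB

theorem theorem3 {p q s : ℕ} (P : OldroydB.Data p q s) (hP : P.Admissible)
    (u : ℝ → ℝ → ℝ → ℝ) (hu : OldroydB.IsExactSolution P u)
    (hreg : OldroydB.IsC443 P.Lx P.Ly P.T u) :
    (∃ C : ℝ, 0 < C ∧ ∀ Mx My N : ℕ, 0 < Mx → 0 < My → 0 < N → ∀ U : ℕ → ℕ → ℕ → ℝ,
      OldroydB.IsSchemeSolution P Mx My N (OldroydB.midSource P Mx My N) U →
      ∀ n ≤ N,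
        OldroydB.normH1Grad P Mx My (OldroydB.error P Mx My N u U n) ≤
          C * OldroydB.rate P Mx My N ∧
        OldroydB.normH1Sum P Mx My (OldroydB.error P Mx My N u U n) ≤
          C * OldroydB.rate P Mx My N) ∧
    (OldroydB.AveragingConsistent P →
      ∃ C : ℝ, 0 < C ∧ ∀ Mx My N : ℕ, 0 < Mx → 0 < My → 0 < N → ∀ U : ℕ → ℕ → ℕ → ℝ,
        OldroydB.IsSchemeSolution P Mx My N (OldroydB.avgSource P Mx My N) U →
        ∀ n ≤ N,
          OldroydB.normH1Grad P Mx My (OldroydB.error P Mx My N u U n) ≤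
            C * OldroydB.rate P Mx My N ∧
          OldroydB.normH1Sum P Mx My (OldroydB.error P Mx My N u U n) ≤
            C * OldroydB.rate P Mx My N) := by
  have hT := hP.T_pos
  constructor
  · obtain ⟨C, hC, hest⟩ := OldroydB.error_estimate hP hu hreg le_rfl
    refine ⟨C, hC, fun Mx My N hMx hMy hN U hU =>
      hest Mx My N hMx hMy hN _ U (fun n _ i _ j _ => ?_) hU⟩
    simp
  · rintro ⟨K, hK⟩
    obtain ⟨C, hC, hest⟩ := OldroydB.error_estimate hP hu hreg (abs_nonneg K)
    refine ⟨C, hC, fun Mx My N hMx hMy hN U hU =>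
      hest Mx My N hMx hMy hN _ U (fun n hn i hi j hj => ?_) hU⟩
    have hN' : (0 : ℝ) < N := by exact_mod_cast hN
    have hn' := Finset.mem_Icc.1 hn
    have hn1 : (1 : ℝ) ≤ n := by exact_mod_cast hn'.1
    have hτ : 0 < P.T / N := by positivity
    have hlev := (OldroydB.node_mem_Icc hT hn'.2).2
    have h := hK _ (OldroydB.node_mem_Ioo hP.Lx_pos hi) _ (OldroydB.node_mem_Ioo hP.Ly_pos hj)
      (((n : ℝ) - 1) * (P.T / N)) (P.T / N) (mul_nonneg (by linarith) hτ.le) hτ (by linarith)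
    rw [show ((n : ℝ) - 1) * (P.T / N) + P.T / N = n * (P.T / N) by ring,
      show ((n : ℝ) - 1) * (P.T / N) + P.T / N / 2 = ((n : ℝ) - 1 / 2) * (P.T / N) by ring] at h
    exact h.trans (mul_le_mul_of_nonneg_right (le_abs_self K) (by positivity))
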